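/- Throughout, manifolds are smooth, Hausdorff, $\sigma$-compact and without boundary, forms are smooth, $I,J,K,L\in\{0,1,2,3\}$, repeated indices are summed, $\epsilon_{IJKL}$ is the Levi-Civita symbol with $\epsilon_{0123}=1$, and $[KL]$ denotes antisymmetrization with the factor $\tfrac12$. Let $\mathcal M$ be an oriented 4-manifold, let $\phi^{(1)}_1,\dots,\phi^{(1)}_{n_1}$ and $\phi^{(2)}_1,\dots,\phi^{(2)}_{n_2}$ be closed 1-forms and closed 2-forms on $\mathcal M$ whose classes form bases of $H^1_{\mathrm{dR}}(\mathcal M)$ and $H^2_{\mathrm{dR}}(\mathcal M)$ (assumed finite-dimensional), and let $\imath:\Sigma\to\mathcal M$ be a smooth map from a closed oriented 3-manifold $\Sigma$ (for instance a Cauchy embedding, $\mathcal M\cong\mathbb R\times\Sigma$). The fields are a nondegenerate tetrad $e^I\in\Omega^1(\mathcal M)$ (linearly independent at every point) and a $U(1)^6$-connection, given by $\omega^{KL}=-\omega^{LK}\in\Omega^1(\mathcal M)$. The action is $S(e,\omega)=\int_{\mathcal M}\epsilon_{IJKL}\,e^I\wedge e^J\wedge d\omega^{KL}$; a solution is a field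 $(e,\omega)$ at which $S$ is stationary under all compactly supported variations. Put $\mathsf{vol}_e=\frac1{4!}\epsilon_{IJKL}e^I\wedge e^J\wedge e^K\wedge e^L$, and for a 4-form $\tau$ write $\tau=(\tau/\mathsf{vol}_e)\,\mathsf{vol}_e$. 1. (Field equations.) For compactly supported variations, $\delta S=\int_{\mathcal M}\big(E_I\wedge\delta e^I+E_{IJ}\wedge\delta\omega^{IJ}\big)$ with $E_I=-2\epsilon_{IJKL}e^J\wedge d\omega^{KL}$ and $E_{IJ}=-\epsilon_{IJKL}\,d(e^K\wedge e^L)$. A field $(e,\omega)$ is a solution if and only if $E_I=0$ and $E_{IJ}=0$, and if and only if $$de^I=0,\qquad \epsilon_{IJKL}\,e^J\wedge d\omega^{KL}=0 .$$ 2. (Connection in terms of $B$.) For a nondegenerate tetrad $e$ and 2-forms $B_I$, the equation $\epsilon_{IJKL}\,e^J\wedge\omega^{KL}=B_I$ has exactly one solution $\omega^{KL}$ antisymmetric in $KL$, namely $$\omega^{KL}=-\frac12\Big(\frac{B_I\wedge e^K\wedge e^L}{\mathsf{vol}_e}\Big)e^I-\frac12\Big(\frac{B_I\wedge e^I\wedge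 e^{[K}}{\mathsf{vol}_e}\Big)e^{L]}.\qquad(*)$$ 3. (General solution.) The solutions are exactly the pairs $(e,\omega)$ with $e^I=dh^I+\sum_i\eta^I_i\phi^{(1)}_i$ nondegenerate and $\omega^{KL}$ given by $(*)$ with $B_I=dg_I+\sum_j\gamma_{Ij}\phi^{(2)}_j$, where $h^I\in\Omega^0(\mathcal M)$, $g_I\in\Omega^1(\mathcal M)$ and $\eta^I_i,\gamma_{Ij}\in\mathbb R$. The numbers $\eta^I_i$ and the forms $dh^I$ are determined by $e$; the numbers $\gamma_{Ij}$ and the forms $dg_I$ are determined by $B$. 4. (Symplectic form.) Let $T$ be the space of tangent vectors to the solution space at a solution $(e,\omega)$, i.e. of all $\delta=(\delta e,\delta\omega)$, $\delta\omega$ antisymmetric, with $d\delta e^I=0$ and $\epsilon_{IJKL}(\delta e^J\wedge d\omega^{KL}+e^J\wedge d\delta\omega^{KL})=0$. Put $\delta B_I=\epsilon_{IJKL}(\delta e^J\wedge\omega^{KL}+e^J\wedge\delta\omega^{KL})$. Every $\delta\in T$ satisfies $\delta e^I=d\delta h^I+\sum_i\delta\eta^I_i\phi^{(1)}_i$ and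 $\delta B_I=d\delta g_I+\sum_j\delta\gamma_{Ij}\phi^{(2)}_j$ for some $(\delta h,\delta\eta,\delta g,\delta\gamma)$; conversely any such data come from exactly one $\delta\in T$, and $\delta\omega$ is then the derivative at $t=0$ of $(*)$ taken at $(e+t\,\delta e,\;B+t\,\delta B)$. For the symplectic form $$\Omega(\delta_1,\delta_2)=\int_\Sigma\imath^*\Big[\epsilon_{IJKL}\big(\delta_1e^I\wedge e^J\wedge\delta_2\omega^{KL}-\delta_2e^I\wedge e^J\wedge\delta_1\omega^{KL}\big)\Big]$$ on $T$ one has $$\Omega(\delta_1,\delta_2)=\sum_{i=1}^{n_1}\sum_{j=1}^{n_2}\Big(\int_\Sigma\imath^*\phi^{(1)}_i\wedge\imath^*\phi^{(2)}_j\Big)\big(\delta_1\eta^I_i\,\delta_2\gamma_{Ij}-\delta_2\eta^I_i\,\delta_1\gamma_{Ij}\big),$$ i.e. $\Omega=\sum_{i,j}\big(\int_\Sigma\phi^{(1)}_i\wedge\phi^{(2)}_j\big)\,\mathrm d\eta^I_i\wedge\mathrm d\gamma_{Ij}$. In particular the model has no local degrees of freedom: the quotient of $T$ by the kernel of $\Omega$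 is finite-dimensional, of dimension at most $4(n_1+n_2)$. -/

import Mathlib

open scoped Manifold ContDiff

noncomputable section

namespace AbelianCP

/-! ### Differential forms on smooth manifolds -/

/-- The model space `ℝⁿ`. -/
abbrev Model (n : ℕ) : Type := EuclideanSpace ℝ (Fin n)

/-- (Not necessarily smooth) differential `k`-forms on an `n`-dimensional manifold `M`. The value
at `x` is an alternating `k`-linear form on the tangent space at `x`; Mathlib's
`TangentSpace (𝓡 n) x` is by definition the model space, identified with the
tangent space by the preferred chart at `x`. -/
abbrev DForm (n k : ℕ) (M : Type*) : Type _ := M → (Model n) [⋀^Fin k]→L[ℝ] ℝ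

instance instAddCommGroupDForm (n k : ℕ) (M : Type*) : AddCommGroup (DForm n k M) :=
  Pi.addCommGroup

instance instAddCommMonoidDForm (n k : ℕ) (M : Type*) : AddCommMonoid (DForm n k M) :=
  (instAddCommGroupDForm n k M).toAddCommMonoid

section Forms

variable {n m k : ℕ}
variable {M : Type*} [TopologicalSpace M] [ChartedSpace (Model n) M]
variable {N : Type*} [TopologicalSpace N] [ChartedSpace (Model m) N]

/-- The pullback `f^* θ` of a form along a map of manifolds. -/
def pullback (f : N → M) (θ : DForm n k M) : DForm m k N := fun x =>
  (θ (f x)).compContinuousLinearMap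
    (mfderiv (𝓡 m) (𝓡 n) f x : Model m →L[ℝ] Model n)

/-- The expression of a form in the preferred chart around `x₀`, a form on (an open subset
of) the model space. -/
def chartRep (θ : DForm n k M) (x₀ : M) : Model n → (Model n) [⋀^Fin k]→L[ℝ] ℝ :=
  pullback (extChartAt (𝓡 n) x₀).symm θ

/-- Smoothness of a form: all its chart expressions are smooth. -/
def IsSmooth (θ : DForm n k M) : Prop :=
  ∀ x₀ : M, ContDiffOn ℝ ∞ (chartRep θ x₀) (extChartAt (𝓡 n) x₀).target

/-- The exterior derivative, computed at `x` in the preferred chart around `x`. -/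
def d (θ : DForm n k M) : DForm n (k + 1) M := fun x =>
  (extDeriv (chartRep θ x) (extChartAt (𝓡 n) x x)).compContinuousLinearMap
    (mfderiv (𝓡 n) (𝓡 n) (extChartAt (𝓡 n) x) x : Model n →L[ℝ] Model n)

end Forms

section Wedge

variable {n k : ℕ} {M : Type*}

/-- The wedge product `α ∧ β` of a one-form with a `k`-form:
`(α ∧ β)(v₀, …, v_k) = ∑ i, (-1) ^ i * α (v_i) * β (v₀, …, v_k without v_i)`. -/
def wedge (α : DForm n 1 M) (β : DForm n k M) : DForm n (k + 1) M := fun x =>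
  ContinuousAlternatingMap.alternatizeUncurryFin
    (((ContinuousAlternatingMap.ofSubsingleton ℝ (Model n) ℝ (0 : Fin 1)).symm (α x)).smulRight
      (β x))

theorem wedge_apply (α : DForm n 1 M) (β : DForm n k M) (x : M) (v : Fin (k + 1) → Model n) :
    wedge α β x v = ∑ i : Fin (k + 1), (-1 : ℝ) ^ (i : ℕ) *
      (α x (fun _ => v i) * β x (i.removeNth v)) := by
  simp [wedge, ContinuousAlternatingMap.alternatizeUncurryFin_apply]

theorem wedge_add_left (α α' : DForm n 1 M) (β : DForm n k M) :
    wedge (α + α') β = wedge α β + wedge α' β := by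
  funext x; ext v
  simp [wedge_apply, mul_add, add_mul, Finset.sum_add_distrib]

theorem wedge_add_right (α : DForm n 1 M) (β β' : DForm n k M) :
    wedge α (β + β') = wedge α β + wedge α β' := by
  funext x; ext v
  simp [wedge_apply, mul_add, Finset.sum_add_distrib]

theorem wedge_smul_left (c : ℝ) (α : DForm n 1 M) (β : DForm n k M) :
    wedge (c • α) β = c • wedge α β := by
  funext x; ext v
  simp only [wedge_apply, Pi.smul_apply, ContinuousAlternatingMap.smul_apply, smul_eq_mul,
    Finset.mul_sum]
  exact Finset.sum_congr rfl fun i _ => by ring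

theorem wedge_smul_right (c : ℝ) (α : DForm n 1 M) (β : DForm n k M) :
    wedge α (c • β) = c • wedge α β := by
  funext x; ext v
  simp only [wedge_apply, Pi.smul_apply, ContinuousAlternatingMap.smul_apply, smul_eq_mul,
    Finset.mul_sum]
  exact Finset.sum_congr rfl fun i _ => by ring

end Wedge

section Linear

variable {n k : ℕ} {M : Type*} [TopologicalSpace M] [ChartedSpace (Model n) M]

theorem chartRep_add (θ θ' : DForm n k M) (x₀ : M) :
    chartRep (θ + θ') x₀ = chartRep θ x₀ + chartRep θ' x₀ := by
  funext y; ext v; rfl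

theorem chartRep_smul (c : ℝ) (θ : DForm n k M) (x₀ : M) :
    chartRep (c • θ) x₀ = c • chartRep θ x₀ := by
  funext y; ext v; rfl

theorem IsSmooth.add {θ θ' : DForm n k M} (h : IsSmooth θ) (h' : IsSmooth θ') :
    IsSmooth (θ + θ') := fun x₀ => by
  rw [chartRep_add]; exact (h x₀).add (h' x₀)

theorem IsSmooth.smul {θ : DForm n k M} (c : ℝ) (h : IsSmooth θ) : IsSmooth (c • θ) :=
  fun x₀ => by rw [chartRep_smul]; exact (h x₀).const_smul c

theorem isSmooth_zero : IsSmooth (0 : DForm n k M) := fun x₀ => by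
  have : chartRep (0 : DForm n k M) x₀ = fun _ => 0 := by funext y; ext v; rfl
  rw [this]; exact contDiffOn_const

theorem IsSmooth.differentiableAt {θ : DForm n k M} (h : IsSmooth θ) (x : M) :
    DifferentiableAt ℝ (chartRep θ x) (extChartAt (𝓡 n) x x) :=
  ((h x).contDiffAt (extChartAt_target_mem_nhds x)).differentiableAt (by simp)

theorem d_add {θ θ' : DForm n k M} (h : IsSmooth θ) (h' : IsSmooth θ') :
    d (θ + θ') = d θ + d θ' := by
  funext x; ext v
  simp only [d, chartRep_add, extDeriv_add (h.differentiableAt x) (h'.differentiableAt x)]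
  rfl

theorem d_smul (c : ℝ) (θ : DForm n k M) : d (c • θ) = c • d θ := by
  funext x; ext v
  simp only [d, chartRep_smul, extDeriv_smul]
  rfl

theorem d_zero : d (0 : DForm n k M) = 0 := by
  have := d_smul (0 : ℝ) (0 : DForm n k M)
  simpa using this

end Linear

/-! ### De Rham cohomology -/

section DeRham

variable (n k : ℕ) (M : Type*) [TopologicalSpace M] [ChartedSpace (Model n) M]

/-- Smooth closed `k`-forms. -/
def closedForms : Submodule ℝ (DForm n k M) where
  carrier := {θ | IsSmooth θ ∧ d θ = 0}
  add_mem' := fun {a b} ha hb => ⟨ha.1.add hb.1, by rw [d_add ha.1 hb.1, ha.2, hb.2, add_zero]⟩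
  zero_mem' := ⟨isSmooth_zero, d_zero⟩
  smul_mem' := fun c a ha => ⟨ha.1.smul c, by rw [d_smul, ha.2, smul_zero]⟩

/-- Exact `(k+1)`-forms: exterior derivatives of smooth `k`-forms. -/
def exactForms : Submodule ℝ (DForm n (k + 1) M) where
  carrier := {θ | ∃ β : DForm n k M, IsSmooth β ∧ d β = θ}
  add_mem' := by
    rintro _ _ ⟨β, hβ, rfl⟩ ⟨β', hβ', rfl⟩
    exact ⟨β + β', hβ.add hβ', d_add hβ hβ'⟩
  zero_mem' := ⟨0, isSmooth_zero, d_zero⟩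
  smul_mem' := by
    rintro c _ ⟨β, hβ, rfl⟩
    exact ⟨c • β, hβ.smul c, d_smul c β⟩

/-- The de Rham cohomology group `H^{k+1}_dR(M)`: closed forms modulo exact forms. -/
abbrev DeRham : Type _ :=
  closedForms n (k + 1) M ⧸ (exactForms n k M).comap (closedForms n (k + 1) M).subtype

variable {n k M}

/-- The de Rham class of a closed form. -/
def deRhamClass (θ : closedForms n (k + 1) M) : DeRham n k M := Submodule.Quotient.mk θ

/-- The classes of the closed forms `φ i` form a basis of `H^{k+1}_dR(M)`. -/
def RepresentsBasis {r : ℕ} (φ : Fin r → closedForms n (k + 1) M) : Prop :=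
  LinearIndependent ℝ (fun i => deRhamClass (φ i)) ∧
    Submodule.span ℝ (Set.range fun i => deRhamClass (φ i)) = ⊤

end DeRham

/-! ### Integration of top-degree forms -/

section Integration

variable {n k : ℕ} {M : Type*} [TopologicalSpace M] [ChartedSpace (Model n) M]

/-- The form vanishes outside of a compact set. -/
def HasCompactSupp (θ : DForm n k M) : Prop :=
  ∃ K : Set M, IsCompact K ∧ ∀ x, x ∉ K → θ x = 0

/-- A volume form: a smooth nowhere vanishing form of top degree. It is used to fix an
orientation. -/
def IsVolumeForm (o : DForm n n M) : Prop := IsSmooth o ∧ ∀ x, o x ≠ 0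

/-- The standard basis of the model space. -/
def stdBasis (n : ℕ) : Fin n → Model n := fun i => EuclideanSpace.basisFun (Fin n) ℝ i

variable (n M) in
/-- A smooth partition of unity subordinate to the preferred charts. -/
def chartPartition [IsManifold (𝓡 n) ∞ M] [T2Space M] [SigmaCompactSpace M] :
    SmoothPartitionOfUnity M (𝓡 n) M Set.univ :=
  (SmoothPartitionOfUnity.exists_isSubordinate_chartAt_source (𝓡 n) M).choose

/-- The integral of a (compactly supported, smooth) top-degree form `θ` over `M` with the
orientation given by the volume form `o`: a partition of unity cuts `θ` into pieces supported in
charts, where the coefficient of the piece is integrated with respect to Lebesgue measure, with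
sign `±1` according to whether the chart is positively or negatively oriented. The value does not
depend on the partition of unity, and on `o` only through the orientation. -/
def intForm [IsManifold (𝓡 n) ∞ M] [T2Space M] [SigmaCompactSpace M] (o θ : DForm n n M) : ℝ :=
  ∑ᶠ i : M, ∫ y in (extChartAt (𝓡 n) i).target,
    chartPartition n M i ((extChartAt (𝓡 n) i).symm y) *
      (Real.sign (chartRep o i y (stdBasis n)) * chartRep θ i y (stdBasis n))

end Integration

/-! ### The abelianized Cartan–Palatini model -/

/-- The Levi-Civita symbol `ε_{IJKL}`, with `ε_{0123} = 1`. -/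
def eps (I J K L : Fin 4) : ℝ :=
  ((((J.val : ℤ) - I.val).sign * ((K.val : ℤ) - I.val).sign * ((L.val : ℤ) - I.val).sign *
    ((K.val : ℤ) - J.val).sign * ((L.val : ℤ) - J.val).sign * ((L.val : ℤ) - K.val).sign : ℤ) : ℝ)

/-- Quadruples of one-forms `e^I`. -/
abbrev Tetrad (n : ℕ) (M : Type*) : Type _ := Fin 4 → DForm n 1 M

/-- Families of one-forms `w^{KL}`. -/
abbrev Conn (n : ℕ) (M : Type*) : Type _ := Fin 4 → Fin 4 → DForm n 1 M

section Model

variable {M : Type*}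

/-- The one-forms `e^I` are linearly independent at every point. -/
def Nondegenerate (e : Tetrad 4 M) : Prop :=
  ∀ x, LinearIndependent ℝ fun I => e I x

/-- Antisymmetry `w^{KL} = -w^{LK}`. -/
def Antisymm {n : ℕ} (w : Conn n M) : Prop := ∀ K L, w K L = -w L K

/-- `vol_e = (1/4!) ε_{IJKL} e^I ∧ e^J ∧ e^K ∧ e^L`. -/
def vol (e : Tetrad 4 M) : DForm 4 4 M :=
  (1 / 24 : ℝ) • ∑ I, ∑ J, ∑ K, ∑ L,
    eps I J K L • wedge (e I) (wedge (e J) (wedge (e K) (e L)))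

/-- The function `η / v` such that `η = (η / v) v`, for top-degree forms `η` and `v`, the latter
being nowhere zero. -/
def ratio (η v : DForm 4 4 M) : M → ℝ := fun x => η x (stdBasis 4) / v x (stdBasis 4)

/-- The two-forms `ε_{IJKL} e^J ∧ w^{KL}`. -/
def epsWedge (e : Tetrad 4 M) (w : Conn 4 M) : Fin 4 → DForm 4 2 M := fun I =>
  ∑ J, ∑ K, ∑ L, eps I J K L • wedge (e J) (w K L)

/-- The one-forms
`-½ (B_I ∧ e^K ∧ e^L / vol_e) e^I - ½ (B_I ∧ e^I ∧ e^[K / vol_e) e^L]`, where the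
antisymmetrization `[KL]` carries the factor `½`. The two-forms `B_I` are written as the last
factor of the wedge products, which does not change them. -/
def connOf (e : Tetrad 4 M) (B : Fin 4 → DForm 4 2 M) : Conn 4 M := fun K L x =>
  -(1 / 2 : ℝ) • (∑ I, ratio (wedge (e K) (wedge (e L) (B I))) (vol e) x • e I x)
    - (1 / 2 : ℝ) • ∑ I, (1 / 2 : ℝ) •
      (ratio (wedge (e I) (wedge (e K) (B I))) (vol e) x • e L x
        - ratio (wedge (e I) (wedge (e L) (B I))) (vol e) x • e K x)

variable [TopologicalSpace M] [ChartedSpace (Model 4) M]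

/-- The fields of the model: a smooth nondegenerate tetrad `e^I` and a `U(1)⁶`-connection, i.e.
smooth real one-forms `w^{KL} = -w^{LK}`. -/
structure IsField (e : Tetrad 4 M) (w : Conn 4 M) : Prop where
  smooth_tetrad : ∀ I, IsSmooth (e I)
  nondegenerate : Nondegenerate e
  smooth_conn : ∀ K L, IsSmooth (w K L)
  antisymm : Antisymm w

/-- Smooth compactly supported variations of the fields. -/
structure IsVariation (δe : Tetrad 4 M) (δw : Conn 4 M) : Prop where
  smooth_tetrad : ∀ I, IsSmooth (δe I)
  compact_tetrad : ∀ I, HasCompactSupp (δe I)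
  smooth_conn : ∀ K L, IsSmooth (δw K L)
  compact_conn : ∀ K L, HasCompactSupp (δw K L)
  antisymm : Antisymm δw

/-- The Lagrangian `ε_{IJKL} e^I ∧ e^J ∧ dw^{KL}`. -/
def lagrangian (e : Tetrad 4 M) (w : Conn 4 M) : DForm 4 4 M :=
  ∑ I, ∑ J, ∑ K, ∑ L, eps I J K L • wedge (e I) (wedge (e J) (d (w K L)))

/-- The Euler forms `-2 ε_{IJKL} e^J ∧ dw^{KL}` of the tetrad. -/
def eulerTetrad (e : Tetrad 4 M) (w : Conn 4 M) : Fin 4 → DForm 4 3 M := fun I =>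
  (-2 : ℝ) • ∑ J, ∑ K, ∑ L, eps I J K L • wedge (e J) (d (w K L))

/-- The Euler forms `-ε_{IJKL} d(e^K ∧ e^L)` of the connection. -/
def eulerConn (e : Tetrad 4 M) : Fin 4 → Fin 4 → DForm 4 3 M := fun I J =>
  -∑ K, ∑ L, eps I J K L • d (wedge (e K) (e L))

/-- The equations `de^I = 0` and `ε_{IJKL} e^J ∧ dw^{KL} = 0`. -/
def ReducedEqs (e : Tetrad 4 M) (w : Conn 4 M) : Prop :=
  (∀ I, d (e I) = 0) ∧
    ∀ I, ∑ J, ∑ K, ∑ L, eps I J K L • wedge (e J) (d (w K L)) = 0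

/-- The space of pairs `(δe, δw)` of smooth one-forms, `δw` antisymmetric, solving the linearized
equations `dδe^I = 0` and `ε_{IJKL} (δe^J ∧ dw^{KL} + e^J ∧ dδw^{KL}) = 0` at `(e, w)`: the tangent
space at `(e, w)` to the space of solutions. -/
def tangentSpace (e : Tetrad 4 M) (w : Conn 4 M) : Submodule ℝ (Tetrad 4 M × Conn 4 M) where
  carrier := {δ | (∀ I, IsSmooth (δ.1 I)) ∧ (∀ K L, IsSmooth (δ.2 K L)) ∧ Antisymm δ.2 ∧
    (∀ I, d (δ.1 I) = 0) ∧
    ∀ I, ∑ J, ∑ K, ∑ L, eps I J K L •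
      (wedge (δ.1 J) (d (w K L)) + wedge (e J) (d (δ.2 K L))) = 0}
  add_mem' := by
    rintro a b ⟨ha1, ha2, ha3, ha4, ha5⟩ ⟨hb1, hb2, hb3, hb4, hb5⟩
    refine ⟨fun I => (ha1 I).add (hb1 I), fun K L => (ha2 K L).add (hb2 K L), fun K L => ?_,
      fun I => ?_, fun I => ?_⟩
    · show a.2 K L + b.2 K L = -(a.2 L K + b.2 L K)
      rw [ha3 K L, hb3 K L, neg_add]
    · show d (a.1 I + b.1 I) = 0
      rw [d_add (ha1 I) (hb1 I), ha4, hb4, add_zero]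
    · have h := congrArg₂ (· + ·) (ha5 I) (hb5 I)
      simp only [← Finset.sum_add_distrib, ← smul_add, add_zero] at h
      rw [← h]
      refine Finset.sum_congr rfl fun J _ => Finset.sum_congr rfl fun K _ =>
        Finset.sum_congr rfl fun L _ => congrArg _ ?_
      show wedge (a.1 J + b.1 J) _ + wedge _ (d (a.2 K L + b.2 K L)) = _
      rw [d_add (ha2 K L) (hb2 K L), wedge_add_left, wedge_add_right]
      abel
  zero_mem' := by
    refine ⟨fun _ => isSmooth_zero, fun _ _ => isSmooth_zero, fun K L => ?_, fun I => d_zero,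
      fun I => ?_⟩
    · show (0 : DForm 4 1 M) = -0
      simp
    · refine Finset.sum_eq_zero fun J _ => Finset.sum_eq_zero fun K _ =>
        Finset.sum_eq_zero fun L _ => ?_
      show _ • (wedge (0 : DForm 4 1 M) _ + wedge _ (d (0 : DForm 4 1 M))) = _
      have h0 := wedge_smul_left (0 : ℝ) (0 : DForm 4 1 M) (d (w K L))
      have h1 := wedge_smul_right (0 : ℝ) (e J) (0 : DForm 4 2 M)
      rw [zero_smul, zero_smul] at h0 h1
      rw [d_zero, h0, h1, add_zero, smul_zero]
  smul_mem' := by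
    rintro c a ⟨ha1, ha2, ha3, ha4, ha5⟩
    refine ⟨fun I => (ha1 I).smul c, fun K L => (ha2 K L).smul c, fun K L => ?_,
      fun I => ?_, fun I => ?_⟩
    · show c • a.2 K L = -(c • a.2 L K)
      rw [ha3 K L, smul_neg]
    · show d (c • a.1 I) = 0
      rw [d_smul, ha4, smul_zero]
    · have h := congrArg (c • ·) (ha5 I)
      simp only [Finset.smul_sum, smul_zero] at h
      rw [← h]
      refine Finset.sum_congr rfl fun J _ => Finset.sum_congr rfl fun K _ =>
        Finset.sum_congr rfl fun L _ => ?_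
      show _ • (wedge (c • a.1 J) _ + wedge _ (d (c • a.2 K L))) = _
      rw [d_smul, wedge_smul_left, wedge_smul_right, ← smul_add, smul_comm]

/-- The variation `ε_{IJKL} (δe^J ∧ w^{KL} + e^J ∧ δw^{KL})` of the two-forms
`B_I = ε_{IJKL} e^J ∧ w^{KL}`. -/
def varB (e : Tetrad 4 M) (w : Conn 4 M) (δ : Tetrad 4 M × Conn 4 M) : Fin 4 → DForm 4 2 M :=
  epsWedge δ.1 w + epsWedge e δ.2

/-- Data `(h^I, η^I_i, g_I, γ_{Ij})`. -/
structure Params (M : Type*) (n₁ n₂ : ℕ) where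
  h : Fin 4 → DForm 4 0 M
  η : Fin 4 → Fin n₁ → ℝ
  g : Fin 4 → DForm 4 1 M
  γ : Fin 4 → Fin n₂ → ℝ

variable {n₁ n₂ : ℕ}

/-- Smoothness of the functions `h^I` and of the one-forms `g_I`. -/
def Params.Smooth (p : Params M n₁ n₂) : Prop := (∀ I, IsSmooth (p.h I)) ∧ ∀ I, IsSmooth (p.g I)

/-- `dh^I + ∑ i, η^I_i φ_i^{(1)}`. -/
def Params.tetrad (p : Params M n₁ n₂) (φ₁ : Fin n₁ → closedForms 4 1 M) : Tetrad 4 M := fun I =>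
  d (p.h I) + ∑ i, p.η I i • (φ₁ i : DForm 4 1 M)

/-- `dg_I + ∑ j, γ_{Ij} φ_j^{(2)}`. -/
def Params.B (p : Params M n₁ n₂) (φ₂ : Fin n₂ → closedForms 4 2 M) : Fin 4 → DForm 4 2 M :=
  fun I => d (p.g I) + ∑ j, p.γ I j • (φ₂ j : DForm 4 2 M)

variable [IsManifold (𝓡 4) ∞ M] [T2Space M] [SigmaCompactSpace M]

/-- The change `S(e + δe, w + δw) - S(e, w)` of the action under a compactly supported
variation. -/
def actionChange (o : DForm 4 4 M) (e : Tetrad 4 M) (w : Conn 4 M) (δe : Tetrad 4 M)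
    (δw : Conn 4 M) : ℝ :=
  intForm o (lagrangian (e + δe) (w + δw) - lagrangian e w)

/-- The action is stationary at `(e, w)` under all compactly supported variations. -/
def IsStationary (o : DForm 4 4 M) (e : Tetrad 4 M) (w : Conn 4 M) : Prop :=
  ∀ δe δw, IsVariation δe δw →
    HasDerivAt (fun t : ℝ => actionChange o e w (t • δe) (t • δw)) 0 0

/-- Solutions of the model: fields at which the action is stationary. -/
def IsSolution (o : DForm 4 4 M) (e : Tetrad 4 M) (w : Conn 4 M) : Prop :=
  IsField e w ∧ IsStationary o e w

end Model

section Symplectic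

variable {M : Type*} [TopologicalSpace M] [ChartedSpace (Model 4) M]
variable {S : Type*} [TopologicalSpace S] [ChartedSpace (Model 3) S]

/-- Pullback of all one-forms of a tetrad. -/
def pullTetrad (ι : S → M) (e : Tetrad 4 M) : Tetrad 3 S := fun I => pullback ι (e I)

/-- Pullback of all one-forms of a connection. -/
def pullConn (ι : S → M) (w : Conn 4 M) : Conn 3 S := fun K L => pullback ι (w K L)

variable [IsManifold (𝓡 3) ∞ S] [T2Space S] [SigmaCompactSpace S]

/-- The two-form `∫_S ε_{IJKL} 𝕕e^I ⩓ (e^J ∧ 𝕕w^{KL})` on field space at a tetrad `e`, evaluated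
on two tangent vectors, all fields being pulled back to `S`. For one-forms `a` and `b` on field
space, `(a ⩓ b)(δ₁, δ₂) = a(δ₁) ∧ b(δ₂) - a(δ₂) ∧ b(δ₁)`. -/
def symplecticForm (o : DForm 3 3 S) (ι : S → M) (e : Tetrad 4 M)
    (δ₁ δ₂ : Tetrad 4 M × Conn 4 M) : ℝ :=
  intForm o (∑ I, ∑ J, ∑ K, ∑ L, eps I J K L •
    (wedge (pullTetrad ι δ₁.1 I) (wedge (pullTetrad ι e J) (pullConn ι δ₂.2 K L))
      - wedge (pullTetrad ι δ₂.1 I) (wedge (pullTetrad ι e J) (pullConn ι δ₁.2 K L))))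

end Symplectic

end AbelianCP

end

/-! The action is quadratic in the tetrad and linear in the connection, so its change along a
compactly supported variation is a cubic polynomial in the parameter. The linear coefficient differs
from the claimed Euler expression by the integral of an exact form, which vanishes by Stokes
(`hasDerivAt_actionChange`). Testing with bump-function multiples of the coframe gives pointwise
equations. Those for the connection say `d(e^K ∧ e^L) = 0`, and in dimension four linear algebra in
a dual frame turns this into `de^K = 0` (`eq_zero_of_wedge_two`).

The algebraic core is that, for nondegenerate `e`, the map from `ω` to `B_I = ε_{IJKL} e^J ∧ ω^{KL}`
is an isomorphism at each point. In a dual frame it is a linear map between two 24-dimensional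
spaces of arrays, and the explicit formula is checked to be a two-sided inverse (`connComp_epsComp`,
`epsComp_connComp`, `connOf_iff`). When `de^I = 0`, one has `dB_I = -ε_{IJKL} e^J ∧ dω^{KL}`, so the
remaining field equation says precisely that `B_I` is closed. Solutions are thus pairs of closed
forms `(e, B)`, and de Rham representatives parametrize them.

The same argument applied to the linearized equations describes tangent vectors by closed forms
`(δe, δB)`. In the symplectic form `e ∧ δω` may be replaced by `δB`, because the extra terms are
symmetric in the two variations and cancel (`sum_wedge_varB`). What remains is a wedge product of
closed forms, which on a closed 3-manifold sees only cohomology classes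
(`exists_wedge_eq_exact_add_sum`). Hence the form factors through the coefficients `(δη, δγ)`, a
space of dimension `4(n₁ + n₂)`.

Forms and integrals are defined through preferred charts, so naturality of `d`, the Leibniz rules,
change of variables and Stokes' theorem are established for these definitions. -/

open scoped Manifold ContDiff

noncomputable section

namespace AbelianCP

set_option maxSynthPendingDepth 3
set_option linter.unusedSectionVars false

/-! ### Exterior algebra and exterior derivatives on a vector space. -/

section Pointwise

variable {E : Type*} [NormedAddCommGroup E] [NormedSpace ℝ E] {k : ℕ}

/-- The wedge product of an alternating one-form and an alternating `k`-form. -/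
def ewedge (a : E [⋀^Fin 1]→L[ℝ] ℝ) (b : E [⋀^Fin k]→L[ℝ] ℝ) : E [⋀^Fin (k + 1)]→L[ℝ] ℝ :=
  ContinuousAlternatingMap.alternatizeUncurryFin
    (((ContinuousAlternatingMap.ofSubsingleton ℝ E ℝ (0 : Fin 1)).symm a).smulRight b)

theorem ewedge_apply (a : E [⋀^Fin 1]→L[ℝ] ℝ) (b : E [⋀^Fin k]→L[ℝ] ℝ) (v : Fin (k + 1) → E) :
    ewedge a b v = ∑ i : Fin (k + 1), (-1 : ℝ) ^ (i : ℕ) *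
      (a (fun _ => v i) * b (i.removeNth v)) := by
  simp [ewedge, ContinuousAlternatingMap.alternatizeUncurryFin_apply]

theorem ewedge_add_left (a a' : E [⋀^Fin 1]→L[ℝ] ℝ) (b : E [⋀^Fin k]→L[ℝ] ℝ) :
    ewedge (a + a') b = ewedge a b + ewedge a' b := by
  ext v; simp [ewedge_apply, mul_add, add_mul, Finset.sum_add_distrib]

theorem ewedge_add_right (a : E [⋀^Fin 1]→L[ℝ] ℝ) (b b' : E [⋀^Fin k]→L[ℝ] ℝ) :
    ewedge a (b + b') = ewedge a b + ewedge a b' := by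
  ext v; simp [ewedge_apply, mul_add, Finset.sum_add_distrib]

theorem ewedge_smul_left (c : ℝ) (a : E [⋀^Fin 1]→L[ℝ] ℝ) (b : E [⋀^Fin k]→L[ℝ] ℝ) :
    ewedge (c • a) b = c • ewedge a b := by
  ext v
  simp only [ewedge_apply, ContinuousAlternatingMap.smul_apply, smul_eq_mul, Finset.mul_sum]
  exact Finset.sum_congr rfl fun i _ => by ring

theorem ewedge_smul_right (c : ℝ) (a : E [⋀^Fin 1]→L[ℝ] ℝ) (b : E [⋀^Fin k]→L[ℝ] ℝ) :
    ewedge a (c • b) = c • ewedge a b := by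
  ext v
  simp only [ewedge_apply, ContinuousAlternatingMap.smul_apply, smul_eq_mul, Finset.mul_sum]
  exact Finset.sum_congr rfl fun i _ => by ring

/-- The wedge product as a bilinear map. -/
def ewedgeₗ : (E [⋀^Fin 1]→L[ℝ] ℝ) →ₗ[ℝ] (E [⋀^Fin k]→L[ℝ] ℝ) →ₗ[ℝ] E [⋀^Fin (k + 1)]→L[ℝ] ℝ :=
  LinearMap.mk₂ ℝ ewedge ewedge_add_left ewedge_smul_left ewedge_add_right ewedge_smul_right

theorem ewedge_sum_right {ι : Type*} (s : Finset ι) (a : E [⋀^Fin 1]→L[ℝ] ℝ)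
    (b : ι → E [⋀^Fin k]→L[ℝ] ℝ) : ewedge a (∑ i ∈ s, b i) = ∑ i ∈ s, ewedge a (b i) :=
  map_sum (ewedgeₗ (E := E) (k := k) a) b s

theorem ewedge_neg_right (a : E [⋀^Fin 1]→L[ℝ] ℝ) (b : E [⋀^Fin k]→L[ℝ] ℝ) :
    ewedge a (-b) = -ewedge a b :=
  map_neg (ewedgeₗ (E := E) (k := k) a) b

theorem ewedge_comp {F : Type*} [NormedAddCommGroup F] [NormedSpace ℝ F] (A : F →L[ℝ] E)
    (a : E [⋀^Fin 1]→L[ℝ] ℝ) (b : E [⋀^Fin k]→L[ℝ] ℝ) :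
    (ewedge a b).compContinuousLinearMap A =
      ewedge (a.compContinuousLinearMap A) (b.compContinuousLinearMap A) := by
  ext v
  simp only [ContinuousAlternatingMap.compContinuousLinearMap_apply, ewedge_apply]
  rfl

/-- The tensor `a ⊗ b ⊗ c + b ⊗ a ⊗ c` is symmetric in its first two slots, so alternating twice
kills it. This is the mechanism behind `d ∘ d = 0`. -/
theorem ewedge_anticomm (a b : E [⋀^Fin 1]→L[ℝ] ℝ) (c : E [⋀^Fin k]→L[ℝ] ℝ) :
    ewedge a (ewedge b c) = -ewedge b (ewedge a c) := by
  set A := (ContinuousAlternatingMap.ofSubsingleton ℝ E ℝ (0 : Fin 1)).symm a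
  set B := (ContinuousAlternatingMap.ofSubsingleton ℝ E ℝ (0 : Fin 1)).symm b
  let f₁ : E →L[ℝ] E →L[ℝ] E [⋀^Fin k]→L[ℝ] ℝ := A.smulRight (B.smulRight c)
  let f₂ : E →L[ℝ] E →L[ℝ] E [⋀^Fin k]→L[ℝ] ℝ := B.smulRight (A.smulRight c)
  have h := ContinuousAlternatingMap.alternatizeUncurryFin_alternatizeUncurryFinCLM_comp_of_symmetric
    (f := f₁ + f₂) (fun x y => by
      change A x • B y • c + B x • A y • c = A y • B x • c + B y • A x • c
      simp only [smul_smul]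
      rw [add_comm, mul_comm (B x), mul_comm (A x)])
  rw [eq_neg_iff_add_eq_zero, ← h, ContinuousLinearMap.comp_add,
    ContinuousAlternatingMap.alternatizeUncurryFin_add]
  congr 1 <;>
  · rw [ewedge]
    congr 1
    ext1 x
    exact (map_smul (ContinuousAlternatingMap.alternatizeUncurryFinCLM ℝ E ℝ) _ _).symm

theorem ewedge_comm (a b : E [⋀^Fin 1]→L[ℝ] ℝ) : ewedge a b = -ewedge b a := by
  ext v
  simp only [ewedge_apply, ContinuousAlternatingMap.neg_apply]
  -- In `Fin 2`, keeping entry `i` is the same as removing entry `1 - i`.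
  have h0 : ∀ i : Fin 2, (fun _ : Fin 1 => v i) = (1 - i).removeNth v := by
    intro i; fin_cases i <;> ext j <;> fin_cases j <;> rfl
  have e0 := h0 0
  have e1 := h0 1
  simp only [sub_zero, sub_self] at e0 e1
  simp [e0, e1]
  ring

/-- A map `E → Λ^k` on a finite-dimensional space is a sum of rank one maps. -/
theorem alternatize_eq_sum {ι : Type*} [Fintype ι] (b : Module.Basis ι ℝ E)
    [FiniteDimensional ℝ E] (A : E →L[ℝ] E [⋀^Fin k]→L[ℝ] ℝ) :
    ContinuousAlternatingMap.alternatizeUncurryFin A =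
      ∑ i, ewedge (ContinuousAlternatingMap.ofSubsingleton ℝ E ℝ (0 : Fin 1)
        (b.coord i).toContinuousLinearMap) (A (b i)) := by
  have : A = ∑ i, ((b.coord i).toContinuousLinearMap).smulRight (A (b i)) := by
    ext1 x
    conv_lhs => rw [← b.sum_repr x, map_sum]
    simp only [map_smul, FunLike.coe_sum, Finset.sum_apply]
    rfl
  conv_lhs => rw [this]
  rw [← ContinuousAlternatingMap.alternatizeUncurryFinCLM_apply, map_sum]
  refine Finset.sum_congr rfl fun i _ => ?_
  rw [ewedge, Equiv.symm_apply_apply]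
  rfl

variable [FiniteDimensional ℝ E]

/-- The half of the Leibniz rule in which the second factor is differentiated: after expansion into
rank one maps, the sign comes from moving the basis covector past `a`. -/
theorem alternatize_wedge_const (a : E [⋀^Fin 1]→L[ℝ] ℝ) (B : E →L[ℝ] E [⋀^Fin k]→L[ℝ] ℝ)
    (C : E →L[ℝ] E [⋀^Fin (k + 1)]→L[ℝ] ℝ) (hC : ∀ v, C v = ewedge a (B v)) :
    ContinuousAlternatingMap.alternatizeUncurryFin C =
      -ewedge a (ContinuousAlternatingMap.alternatizeUncurryFin B) := by
  have b := Module.finBasis ℝ E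
  rw [alternatize_eq_sum b, alternatize_eq_sum b, ewedge_sum_right, ← Finset.sum_neg_distrib]
  refine Finset.sum_congr rfl fun i _ => ?_
  rw [hC, ewedge_anticomm]

/-- The other half. Since only one-forms may stand on the left of a wedge, `da ∧ b` has to be
written `b ∧ da`; no sign arises because `da` has even degree. -/
theorem alternatize_wedge_one (A : E →L[ℝ] E [⋀^Fin 1]→L[ℝ] ℝ) (b : E [⋀^Fin 1]→L[ℝ] ℝ)
    (C : E →L[ℝ] E [⋀^Fin 2]→L[ℝ] ℝ) (hC : ∀ v, C v = ewedge (A v) b) :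
    ContinuousAlternatingMap.alternatizeUncurryFin C =
      ewedge b (ContinuousAlternatingMap.alternatizeUncurryFin A) := by
  have e := Module.finBasis ℝ E
  rw [alternatize_eq_sum e, alternatize_eq_sum e, ewedge_sum_right]
  refine Finset.sum_congr rfl fun i _ => ?_
  rw [hC, ewedge_comm (A _), ewedge_neg_right, ewedge_anticomm, neg_neg]

theorem alternatize_wedge_two (A : E →L[ℝ] E [⋀^Fin 1]→L[ℝ] ℝ) (b c : E [⋀^Fin 1]→L[ℝ] ℝ)
    (C : E →L[ℝ] E [⋀^Fin 3]→L[ℝ] ℝ) (hC : ∀ v, C v = ewedge (A v) (ewedge b c)) :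
    ContinuousAlternatingMap.alternatizeUncurryFin C =
      ewedge b (ewedge c (ContinuousAlternatingMap.alternatizeUncurryFin A)) := by
  have e := Module.finBasis ℝ E
  rw [alternatize_eq_sum e, alternatize_eq_sum e, ewedge_sum_right, ewedge_sum_right]
  refine Finset.sum_congr rfl fun i _ => ?_
  generalize ContinuousAlternatingMap.ofSubsingleton ℝ E ℝ (0 : Fin 1) _ = α
  rw [hC, ewedge_anticomm (A _), ewedge_comm (A _) c]
  simp only [ewedge_neg_right, neg_neg]
  rw [ewedge_anticomm α b, ewedge_anticomm α c]
  simp only [ewedge_neg_right, neg_neg]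

/-- The values of a form on tuples of basis vectors. -/
def basisValues (E : Type*) [NormedAddCommGroup E] [NormedSpace ℝ E] [FiniteDimensional ℝ E] (k : ℕ) :
    (E [⋀^Fin k]→L[ℝ] ℝ) →ₗ[ℝ] ((Fin k → Fin (Module.finrank ℝ E)) → ℝ) where
  toFun := fun θ s => θ (fun i => (Module.finBasis ℝ E) (s i))
  map_add' := fun _ _ => rfl
  map_smul' := fun _ _ => rfl

theorem basisValues_injective : Function.Injective (basisValues E k) := fun _ _ h => by
  apply ContinuousAlternatingMap.toAlternatingMap_injective
  apply AlternatingMap.coe_multilinearMap_injective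
  exact Module.Basis.ext_multilinear (fun _ => Module.finBasis ℝ E) fun s => congrFun h s

/-- Finite dimension makes the bilinear wedge product automatically continuous, hence
differentiable. -/
instance finiteDimensional_forms : FiniteDimensional ℝ (E [⋀^Fin k]→L[ℝ] ℝ) :=
  FiniteDimensional.of_injective (basisValues E k) basisValues_injective

section Smooth

variable {F : Type*} [NormedAddCommGroup F] [NormedSpace ℝ F] {θ : F → E [⋀^Fin k]→L[ℝ] ℝ}
  {s : Set F} {y : F} {r : WithTop ℕ∞}

/-- Smoothness may be tested on scalar components: the evaluation on basis tuples has a linear left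
inverse, which is continuous in finite dimension. -/
theorem contDiffWithinAt_form_iff :
    ContDiffWithinAt ℝ r θ s y ↔ ∀ v, ContDiffWithinAt ℝ r (fun y => θ y v) s y := by
  refine ⟨fun h v => ?_, fun h => ?_⟩
  · exact (ContinuousAlternatingMap.apply ℝ E ℝ v).contDiff.comp_contDiffWithinAt h
  · obtain ⟨g, hg⟩ := (basisValues E k).exists_leftInverse_of_injective
      (LinearMap.ker_eq_bot.2 basisValues_injective)
    have : θ = fun y => g.toContinuousLinearMap (basisValues E k (θ y)) := by
      funext y
      exact (LinearMap.congr_fun hg (θ y)).symm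
    rw [this]
    exact g.toContinuousLinearMap.contDiff.comp_contDiffWithinAt
      (contDiffWithinAt_pi.2 fun s => h _)

theorem contDiffOn_form_iff :
    ContDiffOn ℝ r θ s ↔ ∀ v, ContDiffOn ℝ r (fun y => θ y v) s :=
  ⟨fun h v y hy => contDiffWithinAt_form_iff.1 (h y hy) v,
    fun h y hy => contDiffWithinAt_form_iff.2 fun v => h v y hy⟩

theorem contDiffOn_ewedge {a : F → E [⋀^Fin 1]→L[ℝ] ℝ} (ha : ContDiffOn ℝ r a s)
    (hθ : ContDiffOn ℝ r θ s) : ContDiffOn ℝ r (fun y => ewedge (a y) (θ y)) s := by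
  rw [contDiffOn_form_iff] at ha hθ ⊢
  intro v
  simp only [ewedge_apply]
  exact ContDiffOn.sum fun i _ => contDiffOn_const.mul ((ha _).mul (hθ _))

theorem contDiffWithinAt_form_apply {u : Fin k → F → E} (hθ : ContDiffWithinAt ℝ r θ s y)
    (hu : ∀ i, ContDiffWithinAt ℝ r (u i) s y) :
    ContDiffWithinAt ℝ r (fun y => θ y (fun i => u i y)) s y := by
  let b := Module.finBasis ℝ E
  have : (fun y => θ y (fun i => u i y)) = fun y => ∑ σ : Fin k → Fin (Module.finrank ℝ E),
      (∏ i, (b.coord (σ i)).toContinuousLinearMap (u i y)) * θ y (fun i => b (σ i)) := by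
    funext y
    have h : (fun i => u i y) = fun i => ∑ j, b.repr (u i y) j • b j := by
      funext i; exact (b.sum_repr _).symm
    rw [h]
    have := (θ y).toMultilinearMap.map_sum (fun i j => b.repr (u i y) j • b j)
    refine this.trans (Finset.sum_congr rfl fun σ _ => ?_)
    exact (θ y).toMultilinearMap.map_smul_univ _ _
  rw [this]
  refine ContDiffWithinAt.sum fun σ _ => ContDiffWithinAt.mul (contDiffWithinAt_prod fun i _ => ?_)
    (contDiffWithinAt_form_iff.1 hθ _)
  exact (ContinuousLinearMap.contDiff _).comp_contDiffWithinAt (hu i)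

end Smooth

/-- The derivative of a wedge product. -/
theorem hasFDerivAt_ewedge {F : Type*} [NormedAddCommGroup F] [NormedSpace ℝ F]
    {a : F → E [⋀^Fin 1]→L[ℝ] ℝ} {b : F → E [⋀^Fin k]→L[ℝ] ℝ} {y : F}
    (ha : DifferentiableAt ℝ a y) (hb : DifferentiableAt ℝ b y) :
    ∃ C D : F →L[ℝ] E [⋀^Fin (k + 1)]→L[ℝ] ℝ,
      (∀ v, C v = ewedge (fderiv ℝ a y v) (b y)) ∧
      (∀ v, D v = ewedge (a y) (fderiv ℝ b y v)) ∧
      HasFDerivAt (fun y => ewedge (a y) (b y)) (C + D) y := by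
  let W : (E [⋀^Fin 1]→L[ℝ] ℝ) →L[ℝ] (E [⋀^Fin k]→L[ℝ] ℝ) →L[ℝ] E [⋀^Fin (k + 1)]→L[ℝ] ℝ :=
    ewedgeₗ.toContinuousBilinearMap
  have h := W.hasFDerivAt_of_bilinear ha.hasFDerivAt hb.hasFDerivAt
  refine ⟨(W.precompL F (fderiv ℝ a y) (b y)), W.precompR F (a y) (fderiv ℝ b y), fun v => rfl,
    fun v => rfl, ?_⟩
  exact (add_comm (W.precompL F (fderiv ℝ a y) (b y)) _) ▸ h

variable {a b c : E → E [⋀^Fin 1]→L[ℝ] ℝ} {y : E}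

theorem extDeriv_ewedge_one (ha : DifferentiableAt ℝ a y) (hb : DifferentiableAt ℝ b y) :
    extDeriv (fun y => ewedge (a y) (b y)) y =
      ewedge (b y) (extDeriv a y) - ewedge (a y) (extDeriv b y) := by
  obtain ⟨C, D, hC, hD, h⟩ := hasFDerivAt_ewedge ha hb
  rw [extDeriv, h.fderiv, ContinuousAlternatingMap.alternatizeUncurryFin_add,
    alternatize_wedge_one _ _ C hC, alternatize_wedge_const _ _ D hD, sub_eq_add_neg]
  rfl

theorem extDeriv_ewedge_two (ha : DifferentiableAt ℝ a y)
    (hbc : DifferentiableAt ℝ (fun y => ewedge (b y) (c y)) y) :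
    extDeriv (fun y => ewedge (a y) (ewedge (b y) (c y))) y =
      ewedge (b y) (ewedge (c y) (extDeriv a y)) -
        ewedge (a y) (extDeriv (fun y => ewedge (b y) (c y)) y) := by
  obtain ⟨C, D, hC, hD, h⟩ := hasFDerivAt_ewedge ha hbc
  rw [extDeriv, h.fderiv, ContinuousAlternatingMap.alternatizeUncurryFin_add,
    alternatize_wedge_two _ _ _ C hC, alternatize_wedge_const _ _ D hD, sub_eq_add_neg]
  rfl

end Pointwise

/-- The regularity needed for symmetry of second derivatives, used for `d ∘ d = 0` and for
naturality of `d`. -/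
theorem two_le_smooth : minSmoothness ℝ 2 ≤ (∞ : WithTop ℕ∞) := by
  rw [minSmoothness_of_isRCLikeNormedField]
  exact WithTop.coe_le_coe.2 (le_top : (2 : ℕ∞) ≤ ⊤)

/-! ### Naturality of pullback and of the exterior derivative. -/

section Pullback

open Filter Topology

variable {n m k : ℕ}
variable {M : Type*} [TopologicalSpace M] [ChartedSpace (Model n) M]
variable {N : Type*} [TopologicalSpace N] [ChartedSpace (Model m) N]

theorem isOpen_chart_target (x₀ : M) : IsOpen (extChartAt (𝓡 n) x₀).target :=
  isOpen_extChartAt_target x₀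

theorem pullback_comp_apply {P : Type*} {l : ℕ} [TopologicalSpace P] [ChartedSpace (Model l) P]
    {f : N → M} {g : P → N} (θ : DForm n k M) {z : P}
    (hf : MDifferentiableAt (𝓡 m) (𝓡 n) f (g z)) (hg : MDifferentiableAt (𝓡 l) (𝓡 m) g z) :
    pullback (m := l) g (pullback (m := m) f θ) z = pullback (m := l) (f ∘ g) θ z := by
  ext v
  simp only [pullback]
  rw [mfderiv_comp z hf hg]
  rfl

theorem IsSmooth.contDiffAt {θ : DForm n k M} (h : IsSmooth θ) {x₀ : M} {y : Model n}
    (hy : y ∈ (extChartAt (𝓡 n) x₀).target) : ContDiffAt ℝ ∞ (chartRep θ x₀) y :=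
  (h x₀).contDiffAt ((isOpen_chart_target x₀).mem_nhds hy)

variable [IsManifold (𝓡 n) ∞ M]

theorem contMDiffOn_chart_symm (x₀ : M) :
    ContMDiffOn (𝓡 n) (𝓡 n) ∞ (extChartAt (𝓡 n) x₀).symm (extChartAt (𝓡 n) x₀).target :=
  contMDiffOn_extChartAt_symm x₀

theorem mfderiv_chart_symm_comp {x₀ x : M} (hx : x ∈ (extChartAt (𝓡 n) x₀).source) :
    (mfderiv (𝓡 n) (𝓡 n) (extChartAt (𝓡 n) x₀).symm (extChartAt (𝓡 n) x₀ x)).comp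
      (mfderiv (𝓡 n) (𝓡 n) (extChartAt (𝓡 n) x₀) x) = ContinuousLinearMap.id ℝ (Model n) := by
  have h := mfderivWithin_extChartAt_symm_comp_mfderiv_extChartAt' (I := 𝓡 n) hx
  rw [ModelWithCorners.range_eq_univ, mfderivWithin_univ] at h
  exact h

theorem mfderiv_chart_comp_symm {x₀ : M} {y : Model n} (hy : y ∈ (extChartAt (𝓡 n) x₀).target) :
    (mfderiv (𝓡 n) (𝓡 n) (extChartAt (𝓡 n) x₀) ((extChartAt (𝓡 n) x₀).symm y)).comp
      (mfderiv (𝓡 n) (𝓡 n) (extChartAt (𝓡 n) x₀).symm y) = ContinuousLinearMap.id ℝ (Model n) := by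
  have h := mfderiv_extChartAt_comp_mfderivWithin_extChartAt_symm (I := 𝓡 n) hy
  rw [ModelWithCorners.range_eq_univ, mfderivWithin_univ] at h
  exact h

/-- The tangent space at `x` is identified with the model space by the chart at `x`, so the inverse
chart has identity derivative at the centre. -/
theorem chartRep_self (θ : DForm n k M) (x : M) :
    chartRep θ x (extChartAt (𝓡 n) x x) = θ x := by
  have h := mfderivWithin_range_extChartAt_symm (I := 𝓡 n) (x := x)
  rw [ModelWithCorners.range_eq_univ, mfderivWithin_univ] at h
  ext v
  simp only [chartRep, pullback]
  rw [h, extChartAt_to_inv]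
  rfl

theorem d_apply (θ : DForm n k M) (x : M) :
    d θ x = extDeriv (chartRep θ x) (extChartAt (𝓡 n) x x) := by
  ext v
  simp only [d]
  rw [mfderiv_extChartAt_self]
  rfl

/-- A pulled back form, in terms of any chart. -/
theorem pullback_eq_chart {g : N → M} {z : N} (θ : DForm n k M) {x₀ : M}
    (hg : MDifferentiableAt (𝓡 m) (𝓡 n) g z) (hz : g z ∈ (extChartAt (𝓡 n) x₀).source) :
    pullback (m := m) g θ z = (chartRep θ x₀ (extChartAt (𝓡 n) x₀ (g z))).compContinuousLinearMap
      (mfderiv (𝓡 m) (𝓡 n) (extChartAt (𝓡 n) x₀ ∘ g) z : Model m →L[ℝ] Model n) := by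
  have hc : MDifferentiableAt (𝓡 n) (𝓡 n) (extChartAt (𝓡 n) x₀) (g z) :=
    mdifferentiableAt_extChartAt (by rwa [extChartAt_source] at hz)
  ext v
  simp only [chartRep, pullback]
  rw [mfderiv_comp z hc hg, (extChartAt (𝓡 n) x₀).left_inv hz]
  refine congrArg (θ (g z)) (funext fun i => ?_)
  have := congrArg (fun A => A (mfderiv (𝓡 m) (𝓡 n) g z (v i))) (mfderiv_chart_symm_comp hz)
  exact this.symm

/-- Near `y` the pullback along a map into the manifold becomes a pullback between model spaces,
where the vector space calculus applies. -/
theorem pullback_eventuallyEq_chart {g : Model m → M} {U : Set (Model m)} (hU : IsOpen U)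
    (hg : ContMDiffOn (𝓡 m) (𝓡 n) ∞ g U) {y : Model m} (hy : y ∈ U) (θ : DForm n k M) {x₀ : M}
    (hx : g y ∈ (extChartAt (𝓡 n) x₀).source) :
    ContDiffAt ℝ ∞ (extChartAt (𝓡 n) x₀ ∘ g) y ∧
    pullback (m := m) g θ =ᶠ[𝓝 y] fun z => (chartRep θ x₀ ((extChartAt (𝓡 n) x₀ ∘ g) z)).compContinuousLinearMap
      (fderiv ℝ (extChartAt (𝓡 n) x₀ ∘ g) z) := by
  have hgy : ContMDiffAt (𝓡 m) (𝓡 n) ∞ g y := hg.contMDiffAt (hU.mem_nhds hy)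
  constructor
  · rw [← contMDiffAt_iff_contDiffAt]
    exact (contMDiffAt_extChartAt' (by rwa [extChartAt_source] at hx)).comp y hgy
  · filter_upwards [hU.mem_nhds hy,
      hgy.continuousAt.preimage_mem_nhds ((isOpen_extChartAt_source x₀).mem_nhds hx)] with z hz hz'
    have := (hg.contMDiffAt (hU.mem_nhds hz)).mdifferentiableAt (by simp)
    rw [pullback_eq_chart θ this hz', mfderiv_eq_fderiv]
    rfl

theorem extDeriv_pullback_form {g : Model m → M} {U : Set (Model m)} (hU : IsOpen U)
    (hg : ContMDiffOn (𝓡 m) (𝓡 n) ∞ g U) {y : Model m} (hy : y ∈ U) {θ : DForm n k M}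
    (hθ : IsSmooth θ) : extDeriv (pullback (m := m) g θ) y = pullback (m := m) g (d θ) y := by
  have hx := mem_extChartAt_source (I := 𝓡 n) (g y)
  have hgy := (hg.contMDiffAt (hU.mem_nhds hy)).mdifferentiableAt (by simp)
  obtain ⟨hs, he⟩ := pullback_eventuallyEq_chart hU hg hy θ hx
  have hd : DifferentiableAt ℝ (chartRep θ (g y)) ((extChartAt (𝓡 n) (g y) ∘ g) y) :=
    hθ.differentiableAt (g y)
  rw [he.extDeriv_eq, extDeriv_pullback hd hs two_le_smooth,
    pullback_eq_chart (d θ) hgy hx, chartRep_self, d_apply, mfderiv_eq_fderiv]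
  rfl

/-- Chart independence of `d`: its definition changes chart from point to point, but one fixed chart
computes it on its whole domain, by naturality under the inverse chart. -/
theorem chartRep_d {θ : DForm n k M} (hθ : IsSmooth θ) (x₀ : M) {y : Model n}
    (hy : y ∈ (extChartAt (𝓡 n) x₀).target) :
    chartRep (d θ) x₀ y = extDeriv (chartRep θ x₀) y :=
  (extDeriv_pullback_form (isOpen_chart_target x₀) (contMDiffOn_chart_symm x₀) hy hθ).symm

theorem contDiffOn_pullback_form {g : Model m → M} {U : Set (Model m)} (hU : IsOpen U)
    (hg : ContMDiffOn (𝓡 m) (𝓡 n) ∞ g U) {θ : DForm n k M} (hθ : IsSmooth θ) :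
    ContDiffOn ℝ ∞ (pullback (m := m) g θ) U := by
  intro y hy
  have hx := mem_extChartAt_source (I := 𝓡 n) (g y)
  obtain ⟨hs, he⟩ := pullback_eventuallyEq_chart hU hg hy θ hx
  refine ContDiffAt.contDiffWithinAt (ContDiffAt.congr_of_eventuallyEq ?_ he)
  have hd := hs.fderiv_right (m := ∞) le_rfl
  have hθ' : ContDiffAt ℝ ∞ (fun z => chartRep θ (g y) ((extChartAt (𝓡 n) (g y) ∘ g) z)) y :=
    ContDiffAt.comp y (hθ.contDiffAt (mem_extChartAt_target _)) hs
  simp only [← contDiffWithinAt_univ] at hd hθ' ⊢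
  rw [contDiffWithinAt_form_iff]
  intro v
  exact contDiffWithinAt_form_apply (u := fun i z => fderiv ℝ (extChartAt (𝓡 n) (g y) ∘ g) z (v i))
    hθ' fun i => hd.clm_apply contDiffWithinAt_const

variable [IsManifold (𝓡 m) ∞ N]

omit [IsManifold (𝓡 n) ∞ M] in
theorem chartRep_pullback {f : N → M} (hf : ContMDiff (𝓡 m) (𝓡 n) ∞ f) (θ : DForm n k M) (z₀ : N)
    {y : Model m} (hy : y ∈ (extChartAt (𝓡 m) z₀).target) :
    chartRep (pullback (m := m) f θ) z₀ y = pullback (m := m) (f ∘ (extChartAt (𝓡 m) z₀).symm) θ y :=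
  pullback_comp_apply θ (hf.mdifferentiable (by simp) _)
    (((contMDiffOn_chart_symm z₀).contMDiffAt ((isOpen_chart_target z₀).mem_nhds hy)).mdifferentiableAt
      (by simp))

theorem IsSmooth.pullback {f : N → M} (hf : ContMDiff (𝓡 m) (𝓡 n) ∞ f) {θ : DForm n k M}
    (hθ : IsSmooth θ) : IsSmooth (pullback (m := m) f θ) := fun z₀ =>
  (contDiffOn_pullback_form (isOpen_chart_target z₀)
    (hf.comp_contMDiffOn (contMDiffOn_chart_symm z₀)) hθ).congr
      fun _ hy => chartRep_pullback hf θ z₀ hy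

theorem d_pullback {f : N → M} (hf : ContMDiff (𝓡 m) (𝓡 n) ∞ f) {θ : DForm n k M}
    (hθ : IsSmooth θ) : d (AbelianCP.pullback (m := m) f θ) = AbelianCP.pullback (m := m) f (d θ) := by
  funext z
  have hy := mem_extChartAt_target (I := 𝓡 m) z
  have he : chartRep (AbelianCP.pullback (m := m) f θ) z =ᶠ[𝓝 (extChartAt (𝓡 m) z z)]
      AbelianCP.pullback (m := m) (f ∘ (extChartAt (𝓡 m) z).symm) θ := by
    filter_upwards [(isOpen_chart_target z).mem_nhds hy] with y hy
    exact chartRep_pullback hf θ z hy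
  rw [d_apply, he.extDeriv_eq, extDeriv_pullback_form (isOpen_chart_target z)
    (hf.comp_contMDiffOn (contMDiffOn_chart_symm z)) hy hθ, ← chartRep_pullback hf (d θ) z hy,
    chartRep_self]

theorem IsSmooth.d {θ : DForm n k M} (hθ : IsSmooth θ) : IsSmooth (d θ) := fun x₀ => by
  have h : ContDiffOn ℝ ∞ (fderiv ℝ (chartRep θ x₀)) (extChartAt (𝓡 n) x₀).target :=
    (hθ x₀).fderiv_of_isOpen (isOpen_chart_target x₀) le_rfl
  exact ((ContinuousAlternatingMap.alternatizeUncurryFinCLM ℝ (Model n) ℝ).contDiff.comp_contDiffOn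
    h).congr fun y hy => chartRep_d hθ x₀ hy

theorem d_d {θ : DForm n k M} (hθ : IsSmooth θ) : AbelianCP.d (AbelianCP.d θ) = 0 := by
  funext x
  have hy := mem_extChartAt_target (I := 𝓡 n) x
  have he : chartRep (AbelianCP.d θ) x =ᶠ[𝓝 (extChartAt (𝓡 n) x x)] extDeriv (chartRep θ x) := by
    filter_upwards [(isOpen_chart_target x).mem_nhds hy] with y hy
    exact chartRep_d hθ x hy
  rw [d_apply, he.extDeriv_eq, extDeriv_extDeriv_apply (hθ.contDiffAt hy) two_le_smooth]
  rfl

end Pullback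

/-! ### Wedge products of forms on manifolds and the Leibniz rules. -/

section Leibniz

open Filter Topology

variable {n k : ℕ} {M : Type*}

theorem wedge_neg_right (α : DForm n 1 M) (β : DForm n k M) : wedge α (-β) = -wedge α β := by
  simpa using wedge_smul_right (-1) α β

theorem wedge_zero_right (α : DForm n 1 M) : wedge α (0 : DForm n k M) = 0 := by
  simpa using wedge_smul_right (0 : ℝ) α (0 : DForm n k M)

theorem wedge_zero_left (β : DForm n k M) : wedge (0 : DForm n 1 M) β = 0 := by
  simpa using wedge_smul_left (0 : ℝ) (0 : DForm n 1 M) β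

theorem wedge_sum_right {ι : Type*} (s : Finset ι) (α : DForm n 1 M) (β : ι → DForm n k M) :
    wedge α (∑ i ∈ s, β i) = ∑ i ∈ s, wedge α (β i) := by
  classical
  induction s using Finset.induction_on with
  | empty => simp [wedge_zero_right]
  | insert a s ha ih => rw [Finset.sum_insert ha, Finset.sum_insert ha, wedge_add_right, ih]

theorem wedge_sum_left {ι : Type*} (s : Finset ι) (α : ι → DForm n 1 M) (β : DForm n k M) :
    wedge (∑ i ∈ s, α i) β = ∑ i ∈ s, wedge (α i) β := by
  classical
  induction s using Finset.induction_on with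
  | empty => simp [wedge_zero_left]
  | insert a s ha ih => rw [Finset.sum_insert ha, Finset.sum_insert ha, wedge_add_left, ih]

theorem wedge_anticomm (a b : DForm n 1 M) (c : DForm n k M) :
    wedge a (wedge b c) = -wedge b (wedge a c) :=
  funext fun x => ewedge_anticomm (a x) (b x) (c x)

theorem wedge_comm (a b : DForm n 1 M) : wedge a b = -wedge b a :=
  funext fun x => ewedge_comm (a x) (b x)

/-- The product of a function and a form. -/
def fmul (f : M → ℝ) (θ : DForm n k M) : DForm n k M := fun x => f x • θ x

theorem wedge_fmul_left (f : M → ℝ) (a : DForm n 1 M) (b : DForm n k M) :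
    wedge (fmul f a) b = fmul f (wedge a b) :=
  funext fun x => ewedge_smul_left (f x) (a x) (b x)

variable [TopologicalSpace M] [ChartedSpace (Model n) M]

variable (n) in
/-- Smoothness of a function in the preferred charts. -/
def SmoothFun (f : M → ℝ) : Prop :=
  ∀ x₀ : M, ContDiffOn ℝ ∞ (f ∘ (extChartAt (𝓡 n) x₀).symm) (extChartAt (𝓡 n) x₀).target

theorem SmoothFun.mul {f g : M → ℝ} (hf : SmoothFun n f) (hg : SmoothFun n g) :
    SmoothFun n (fun x => f x * g x) := fun x₀ => (hf x₀).mul (hg x₀)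

theorem SmoothFun.of_contMDiff [IsManifold (𝓡 n) ∞ M] {f : M → ℝ}
    (hf : ContMDiff (𝓡 n) 𝓘(ℝ, ℝ) ∞ f) : SmoothFun n f := fun x₀ =>
  contMDiffOn_iff_contDiffOn.1 (hf.comp_contMDiffOn (contMDiffOn_chart_symm x₀))

theorem chartRep_fmul (f : M → ℝ) (θ : DForm n k M) (x₀ : M) :
    chartRep (fmul f θ) x₀ = fun y => f ((extChartAt (𝓡 n) x₀).symm y) • chartRep θ x₀ y := by
  funext y; ext v; rfl

theorem IsSmooth.fmul {f : M → ℝ} {θ : DForm n k M} (hf : SmoothFun n f) (hθ : IsSmooth θ) :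
    IsSmooth (fmul f θ) := fun x₀ => by
  rw [chartRep_fmul]
  exact (hf x₀).smul (hθ x₀)

theorem chartRep_wedge (α : DForm n 1 M) (β : DForm n k M) (x₀ : M) :
    chartRep (wedge α β) x₀ = fun y => ewedge (chartRep α x₀ y) (chartRep β x₀ y) := by
  funext y
  exact ewedge_comp _ _ _

theorem pullback_wedge {m : ℕ} {N : Type*} [TopologicalSpace N] [ChartedSpace (Model m) N]
    (f : N → M) (α : DForm n 1 M) (β : DForm n k M) :
    pullback (m := m) f (wedge α β) = wedge (pullback f α) (pullback f β) := by
  funext y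
  exact ewedge_comp _ _ _

theorem IsSmooth.wedge {α : DForm n 1 M} {β : DForm n k M} (hα : IsSmooth α) (hβ : IsSmooth β) :
    IsSmooth (wedge α β) := fun x₀ => by
  rw [chartRep_wedge]
  exact contDiffOn_ewedge (hα x₀) (hβ x₀)

theorem IsSmooth.neg {θ : DForm n k M} (h : IsSmooth θ) : IsSmooth (-θ) := by
  simpa using h.smul (-1)

theorem IsSmooth.sub {θ θ' : DForm n k M} (h : IsSmooth θ) (h' : IsSmooth θ') :
    IsSmooth (θ - θ') := by
  rw [sub_eq_add_neg]; exact h.add h'.neg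

theorem IsSmooth.sum {ι : Type*} {s : Finset ι} {θ : ι → DForm n k M}
    (h : ∀ i ∈ s, IsSmooth (θ i)) : IsSmooth (∑ i ∈ s, θ i) := by
  classical
  induction s using Finset.induction_on with
  | empty => simpa using isSmooth_zero
  | insert a s ha ih =>
    rw [Finset.sum_insert ha]
    exact (h a (by simp)).add (ih fun i hi => h i (by simp [hi]))

theorem d_neg (θ : DForm n k M) : d (-θ) = -d θ := by
  simpa using d_smul (-1) θ

theorem d_sub {θ θ' : DForm n k M} (h : IsSmooth θ) (h' : IsSmooth θ') :
    d (θ - θ') = d θ - d θ' := by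
  rw [sub_eq_add_neg, d_add h h'.neg, d_neg, sub_eq_add_neg]

theorem d_sum {ι : Type*} {s : Finset ι} {θ : ι → DForm n k M}
    (h : ∀ i ∈ s, IsSmooth (θ i)) : d (∑ i ∈ s, θ i) = ∑ i ∈ s, d (θ i) := by
  classical
  induction s using Finset.induction_on with
  | empty => simpa using d_zero
  | insert a s ha ih =>
    rw [Finset.sum_insert ha, Finset.sum_insert ha,
      d_add (h a (by simp)) (IsSmooth.sum fun i hi => h i (by simp [hi])),
      ih fun i hi => h i (by simp [hi])]

variable [IsManifold (𝓡 n) ∞ M]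

theorem d_wedge_one {a b : DForm n 1 M} (ha : IsSmooth a) (hb : IsSmooth b) :
    d (wedge a b) = wedge b (d a) - wedge a (d b) := by
  funext x
  rw [d_apply, chartRep_wedge,
    extDeriv_ewedge_one (ha.differentiableAt x) (hb.differentiableAt x), chartRep_self,
    chartRep_self, ← d_apply, ← d_apply]
  rfl

theorem d_wedge_two {a b c : DForm n 1 M} (ha : IsSmooth a) (hb : IsSmooth b) (hc : IsSmooth c) :
    d (wedge a (wedge b c)) = wedge b (wedge c (d a)) - wedge a (d (wedge b c)) := by
  funext x
  have h := (hb.wedge hc).differentiableAt x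
  rw [chartRep_wedge] at h
  rw [d_apply, chartRep_wedge, chartRep_wedge,
    extDeriv_ewedge_two (ha.differentiableAt x) h, ← chartRep_wedge, chartRep_self,
    chartRep_self, chartRep_self, ← d_apply, ← d_apply]
  rfl

/-- The function defined by a zero-form. -/
def toFun (h : DForm n 0 M) : M → ℝ := fun x => h x 0

omit [IsManifold (𝓡 n) ∞ M] in
theorem IsSmooth.toFun {h : DForm n 0 M} (hh : IsSmooth h) : SmoothFun n (toFun h) := fun x₀ => by
  refine (contDiffOn_form_iff.1 (hh x₀) 0).congr fun y _ => ?_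
  exact congrArg (h ((extChartAt (𝓡 n) x₀).symm y)) (Subsingleton.elim (α := Fin 0 → Model n) _ _)

theorem d_fmul {h : DForm n 0 M} {β : DForm n k M} (hh : IsSmooth h) (hβ : IsSmooth β) :
    d (fmul (toFun h) β) = wedge (d h) β + fmul (toFun h) (d β) := by
  funext x
  set y := extChartAt (𝓡 n) x x
  set f : Model n → ℝ := fun y => chartRep h x y 0
  have hf : DifferentiableAt ℝ f y :=
    ((contDiffOn_form_iff.1 (hh x) 0).contDiffAt (extChartAt_target_mem_nhds x)).differentiableAt
      (by simp)
  -- A zero-form is its value on the only empty tuple, which reduces its exterior derivative to the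
  -- derivative of the scalar function `f`.
  have h1 : chartRep h x = fun y => ContinuousAlternatingMap.constOfIsEmpty ℝ (Model n) (Fin 0) (f y) := by
    funext y; ext v
    exact congrArg _ (Subsingleton.elim _ _)
  have h2 : chartRep (fmul (toFun h) β) x = fun y => f y • chartRep β x y := by
    rw [chartRep_fmul]
    funext y
    exact congrArg (fun c => h ((extChartAt (𝓡 n) x).symm y) c • chartRep β x y)
      (Subsingleton.elim (α := Fin 0 → Model n) _ _)
  have h3 : f y = toFun h x := by
    show chartRep h x (extChartAt (𝓡 n) x x) 0 = _
    rw [chartRep_self]; rfl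
  have h4 := (hf.hasFDerivAt.smul (hβ.differentiableAt x).hasFDerivAt).fderiv
  show d _ x = ewedge (d h x) (β x) + toFun h x • d β x
  rw [d_apply, h2, extDeriv, d_apply, h1, extDeriv_constOfIsEmpty, d_apply, ewedge,
    Equiv.symm_apply_apply, ← h3, ← chartRep_self β x, extDeriv,
    ← ContinuousAlternatingMap.alternatizeUncurryFin_smul,
    ← ContinuousAlternatingMap.alternatizeUncurryFin_add]
  exact congrArg _ (h4.trans (add_comm _ _))

end Leibniz

/-! ### Top-degree forms and integrals of derivatives on the model space. -/

section VectorSpace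

open Set MeasureTheory Topology Filter

variable {n : ℕ}

theorem stdBasis_eq : stdBasis n = (EuclideanSpace.basisFun (Fin n) ℝ).toBasis := by
  funext i; simp [stdBasis]

theorem top_form_apply (θ : Model n [⋀^Fin n]→L[ℝ] ℝ) (v : Fin n → Model n) :
    θ v = θ (stdBasis n) * (EuclideanSpace.basisFun (Fin n) ℝ).toBasis.det v := by
  have := congrArg (fun f => f v) (AlternatingMap.eq_smul_basis_det
    (EuclideanSpace.basisFun (Fin n) ℝ).toBasis θ.toAlternatingMap)
  rw [← stdBasis_eq] at this
  exact this

theorem top_form_comp (θ : Model n [⋀^Fin n]→L[ℝ] ℝ) (A : Model n →L[ℝ] Model n) :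
    θ.compContinuousLinearMap A (stdBasis n) = A.det * θ (stdBasis n) := by
  have h : θ.compContinuousLinearMap A (stdBasis n) = θ (A ∘ stdBasis n) := rfl
  have h2 := Module.Basis.det_comp (EuclideanSpace.basisFun (Fin n) ℝ).toBasis
    (A : Model n →ₗ[ℝ] Model n) (stdBasis n)
  rw [stdBasis_eq, Module.Basis.det_self, mul_one, ← stdBasis_eq] at h2
  rw [h, top_form_apply, mul_comm]
  congr 1

theorem top_form_ne_zero {θ : Model n [⋀^Fin n]→L[ℝ] ℝ} (h : θ ≠ 0) : θ (stdBasis n) ≠ 0 := by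
  contrapose! h
  ext v
  rw [top_form_apply, h, zero_mul]
  rfl

/-- With `a` a Jacobian determinant and `b`, `c` the coefficients of the orientation and of the
integrand, the orientation sign converts the Jacobian into the absolute value demanded by change of
variables. -/
theorem sign_mul_mul (a b c : ℝ) :
    Real.sign (a * b) * (a * c) = |a| * (Real.sign b * c) := by
  rcases lt_trichotomy a 0 with ha | rfl | ha
  · rcases lt_trichotomy b 0 with hb | rfl | hb
    · rw [Real.sign_of_pos (mul_pos_of_neg_of_neg ha hb), Real.sign_of_neg hb, abs_of_neg ha]; ring
    · simp
    · rw [Real.sign_of_neg (mul_neg_of_neg_of_pos ha hb), Real.sign_of_pos hb, abs_of_neg ha]; ring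
  · simp
  · rcases lt_trichotomy b 0 with hb | rfl | hb
    · rw [Real.sign_of_neg (mul_neg_of_pos_of_neg ha hb), Real.sign_of_neg hb, abs_of_pos ha]; ring
    · simp
    · rw [Real.sign_of_pos (mul_pos ha hb), Real.sign_of_pos hb, abs_of_pos ha]; ring

variable {T C : Set (Model n)} {f : Model n → ℝ}

/-- Extension by zero is smooth because `T` and the complement of `C` are open and cover the space.
-/
theorem contDiff_indicator (hT : IsOpen T) (hC : IsCompact C) (hCT : C ⊆ T)
    (hf : ContDiffOn ℝ ∞ f T) (h0 : ∀ y ∈ T, y ∉ C → f y = 0) :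
    ContDiff ℝ ∞ (T.indicator f) ∧ HasCompactSupport (T.indicator f) := by
  have hz : ∀ y, y ∉ C → T.indicator f y = 0 := fun y hy => by
    by_cases hyT : y ∈ T
    · rw [indicator_of_mem hyT, h0 y hyT hy]
    · exact indicator_of_notMem hyT _
  refine ⟨contDiff_iff_contDiffAt.2 fun y => ?_, HasCompactSupport.intro hC hz⟩
  by_cases hy : y ∈ T
  · refine (hf.contDiffAt (hT.mem_nhds hy)).congr_of_eventuallyEq ?_
    filter_upwards [hT.mem_nhds hy] with z hz using indicator_of_mem hz _
  · refine (contDiffAt_const (c := (0 : ℝ))).congr_of_eventuallyEq ?_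
    filter_upwards [hC.isClosed.isOpen_compl.mem_nhds fun h => hy (hCT h)] with z h using hz z h

theorem integrableOn_of_contDiffOn (hT : IsOpen T) (hC : IsCompact C) (hCT : C ⊆ T)
    (hf : ContDiffOn ℝ ∞ f T) (h0 : ∀ y ∈ T, y ∉ C → f y = 0) : IntegrableOn f T := by
  obtain ⟨h1, h2⟩ := contDiff_indicator hT hC hCT hf h0
  exact (integrable_indicator_iff hT.measurableSet).1
    (h1.continuous.integrable_of_hasCompactSupport h2)

/-- Integration by parts against the constant function `1`. -/
theorem integral_fderiv_eq_zero {g : Model n → ℝ} (hg : ContDiff ℝ ∞ g) (hc : HasCompactSupport g)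
    (v : Model n) : ∫ y, fderiv ℝ g y v = 0 := by
  have hd : Continuous fun y => fderiv ℝ g y v :=
    (hg.continuous_fderiv (by simp)).clm_apply continuous_const
  have hi : Integrable fun y => fderiv ℝ g y v :=
    hd.integrable_of_hasCompactSupport (hc.fderiv_apply (𝕜 := ℝ) v)
  have := integral_mul_fderiv_eq_neg_fderiv_mul_of_integrable (μ := volume) (f := fun _ => (1 : ℝ))
    (g := g) (v := v) (by simp) (by simpa using hi)
    (by simpa using hg.continuous.integrable_of_hasCompactSupport hc)
    (fun x _ => differentiableAt_const _) (fun x _ => (hg.differentiable (by simp)) x)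
  simpa using this

/-- The integral of a derivative, with a locally constant weight. -/
theorem setIntegral_sign_fderiv (hT : IsOpen T) (hC : IsCompact C) (hCT : C ⊆ T)
    {u s : Model n → ℝ} (hu : ContDiffOn ℝ ∞ u T) (h0 : ∀ y ∈ T, y ∉ C → u y = 0)
    (hs : ∀ y ∈ T, ∀ᶠ z in 𝓝 y, s z = s y) (v : Model n) :
    IntegrableOn (fun y => s y * fderiv ℝ u y v) T ∧ ∫ y in T, s y * fderiv ℝ u y v = 0 := by
  -- The weight need not be constant on `T`, which may be disconnected; being locally constant, it
  -- can still be moved under the derivative.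
  have hsu : ContDiffOn ℝ ∞ (fun y => s y * u y) T := fun y hy =>
    (((contDiffAt_const (c := s y)).congr_of_eventuallyEq (hs y hy)).mul
      (hu.contDiffAt (hT.mem_nhds hy))).contDiffWithinAt
  obtain ⟨h1, h2⟩ := contDiff_indicator hT hC hCT hsu fun y hy hyC => by rw [h0 y hy hyC, mul_zero]
  have key : ∀ y ∈ T, fderiv ℝ (T.indicator fun y => s y * u y) y v = s y * fderiv ℝ u y v := by
    intro y hy
    have : (T.indicator fun y => s y * u y) =ᶠ[𝓝 y] fun z => s y * u z := by
      filter_upwards [hT.mem_nhds hy, hs y hy] with z hz hz'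
      rw [indicator_of_mem hz, hz']
    rw [this.fderiv_eq, fderiv_const_mul
      ((hu.contDiffAt (hT.mem_nhds hy)).differentiableAt (by simp))]
    rfl
  have hd : Continuous fun y => fderiv ℝ (T.indicator fun y => s y * u y) y v :=
    (h1.continuous_fderiv (by simp)).clm_apply continuous_const
  constructor
  · exact (hd.integrable_of_hasCompactSupport (h2.fderiv_apply (𝕜 := ℝ) v)).integrableOn.congr_fun
      (fun y hy => key y hy) hT.measurableSet
  · rw [← setIntegral_congr_fun hT.measurableSet fun y hy => key y hy,
      setIntegral_eq_integral_of_forall_compl_eq_zero, integral_fderiv_eq_zero h1 h2]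
    intro y hy
    have : (T.indicator fun y => s y * u y) =ᶠ[𝓝 y] fun _ => 0 := by
      filter_upwards [hC.isClosed.isOpen_compl.mem_nhds fun h => hy (hCT h)] with z hz
      by_cases hzT : z ∈ T
      · rw [indicator_of_mem hzT, h0 z hzT hz, mul_zero]
      · exact indicator_of_notMem hzT _
    rw [this.fderiv_eq]
    simp

end VectorSpace

/-! ### Integration in one chart: change of variables and Stokes. -/

section Charts

open Set MeasureTheory Topology Filter

variable {n k : ℕ} {M : Type*} [TopologicalSpace M] [ChartedSpace (Model n) M]

/-- The integral of a top-degree form over a chart domain. -/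
def chartInt (o η : DForm n n M) (i : M) : ℝ :=
  ∫ y in (extChartAt (𝓡 n) i).target,
    Real.sign (chartRep o i y (stdBasis n)) * chartRep η i y (stdBasis n)

theorem chartRep_eq_zero {η : DForm n k M} {i : M} {y : Model n}
    (h : η ((extChartAt (𝓡 n) i).symm y) = 0) : chartRep η i y = 0 := by
  ext v
  simp only [chartRep, pullback]
  rw [h]
  rfl

theorem chartRep_top (η : DForm n n M) (i : M) (y : Model n) :
    chartRep η i y (stdBasis n) =
      (mfderiv (𝓡 n) (𝓡 n) (extChartAt (𝓡 n) i).symm y : Model n →L[ℝ] Model n).det *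
        η ((extChartAt (𝓡 n) i).symm y) (stdBasis n) :=
  top_form_comp _ _

theorem isCompact_chart_image {C : Set M} {i : M} (hC : IsCompact C)
    (hCi : C ⊆ (extChartAt (𝓡 n) i).source) : IsCompact (extChartAt (𝓡 n) i '' C) ∧
      extChartAt (𝓡 n) i '' C ⊆ (extChartAt (𝓡 n) i).target ∧
      ∀ y ∈ (extChartAt (𝓡 n) i).target, y ∉ extChartAt (𝓡 n) i '' C →
        (extChartAt (𝓡 n) i).symm y ∉ C := by
  refine ⟨hC.image_of_continuousOn ((continuousOn_extChartAt i).mono hCi), ?_, fun y hy h h' => ?_⟩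
  · rintro _ ⟨x, hx, rfl⟩
    exact (extChartAt (𝓡 n) i).map_source (hCi hx)
  · exact h ⟨_, h', (extChartAt (𝓡 n) i).right_inv hy⟩

variable [IsManifold (𝓡 n) ∞ M]

theorem det_chart_symm_ne_zero {i : M} {y : Model n} (hy : y ∈ (extChartAt (𝓡 n) i).target) :
    (mfderiv (𝓡 n) (𝓡 n) (extChartAt (𝓡 n) i).symm y : Model n →L[ℝ] Model n).det ≠ 0 := by
  intro h0
  have h := congrArg (fun A : Model n →L[ℝ] Model n => A.det) (mfderiv_chart_comp_symm hy)
  have h1 : (ContinuousLinearMap.id ℝ (Model n)).det = 1 := LinearMap.det_id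
  have h2 : ∀ A B : Model n →L[ℝ] Model n, (A.comp B).det = A.det * B.det :=
    fun A B => LinearMap.det_comp _ _
  have h3 := (h2 (mfderiv (𝓡 n) (𝓡 n) (extChartAt (𝓡 n) i) ((extChartAt (𝓡 n) i).symm y))
    (mfderiv (𝓡 n) (𝓡 n) (extChartAt (𝓡 n) i).symm y)).symm.trans (h.trans h1)
  exact zero_ne_one ((mul_eq_zero_of_right _ h0).symm.trans h3)

theorem chartRep_top_ne_zero {o : DForm n n M} (ho : ∀ x, o x ≠ 0) {i : M} {y : Model n}
    (hy : y ∈ (extChartAt (𝓡 n) i).target) : chartRep o i y (stdBasis n) ≠ 0 := by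
  rw [chartRep_top]
  exact mul_ne_zero (det_chart_symm_ne_zero hy) (top_form_ne_zero (ho _))

/-- The coefficient of a volume form is continuous and has no zeros in the chart. -/
theorem sign_locally_const {o : DForm n n M} (ho : IsVolumeForm o) {i : M} {y : Model n}
    (hy : y ∈ (extChartAt (𝓡 n) i).target) : ∀ᶠ z in 𝓝 y,
      Real.sign (chartRep o i z (stdBasis n)) = Real.sign (chartRep o i y (stdBasis n)) := by
  have hc : ContinuousAt (fun z => chartRep o i z (stdBasis n)) y :=
    ((contDiffOn_form_iff.1 (ho.1 i) _).contDiffAt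
      ((isOpen_chart_target i).mem_nhds hy)).continuousAt
  rcases (chartRep_top_ne_zero ho.2 hy).lt_or_gt with h | h
  · filter_upwards [hc.eventually (gt_mem_nhds h)] with z hz
    rw [Real.sign_of_neg hz, Real.sign_of_neg h]
  · filter_upwards [hc.eventually (lt_mem_nhds h)] with z hz
    rw [Real.sign_of_pos hz, Real.sign_of_pos h]

theorem contDiffOn_sign_mul {o : DForm n n M} (ho : IsVolumeForm o) {η : DForm n n M}
    (hη : IsSmooth η) (i : M) : ContDiffOn ℝ ∞
      (fun y => Real.sign (chartRep o i y (stdBasis n)) * chartRep η i y (stdBasis n))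
      (extChartAt (𝓡 n) i).target := fun y hy =>
  (((contDiffAt_const (c := Real.sign (chartRep o i y (stdBasis n)))).congr_of_eventuallyEq
    (sign_locally_const ho hy)).mul ((contDiffOn_form_iff.1 (hη i) _).contDiffAt
      ((isOpen_chart_target i).mem_nhds hy))).contDiffWithinAt

/-- Change of variables between two charts. -/
theorem chartInt_eq_chartInt (o η : DForm n n M) {i j : M}
    (hi : ∀ x, x ∉ (extChartAt (𝓡 n) i).source → η x = 0)
    (hj : ∀ x, x ∉ (extChartAt (𝓡 n) j).source → η x = 0) :
    chartInt o η i = chartInt o η j := by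
  set φi := extChartAt (𝓡 n) i
  set φj := extChartAt (𝓡 n) j
  have hopen : ∀ a b : M, IsOpen ((extChartAt (𝓡 n) a).target ∩
      (extChartAt (𝓡 n) a).symm ⁻¹' (extChartAt (𝓡 n) b).source) := fun a b =>
    (continuousOn_extChartAt_symm a).isOpen_inter_preimage (isOpen_chart_target a)
      (isOpen_extChartAt_source b)
  -- The integrand vanishes off the other chart domain, so each integral reduces to the overlap,
  -- where the transition map is defined.
  have hrestr : ∀ a b : M, (∀ x, x ∉ (extChartAt (𝓡 n) b).source → η x = 0) →
      chartInt o η a = ∫ y in (extChartAt (𝓡 n) a).target ∩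
      (extChartAt (𝓡 n) a).symm ⁻¹' (extChartAt (𝓡 n) b).source,
        Real.sign (chartRep o a y (stdBasis n)) * chartRep η a y (stdBasis n) := by
    intro a b hb
    refine setIntegral_eq_of_subset_of_forall_sdiff_eq_zero (isOpen_chart_target a).measurableSet
      inter_subset_left fun y hy => ?_
    have : η ((extChartAt (𝓡 n) a).symm y) = 0 := hb _ fun h => hy.2 ⟨hy.1, h⟩
    rw [chartRep_eq_zero this]
    simp
  rw [hrestr i j hj, hrestr j i hi]
  set V := φi.target ∩ φi.symm ⁻¹' φj.source
  have himg : φj.target ∩ φj.symm ⁻¹' φi.source = (φj ∘ φi.symm) '' V := by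
    ext y
    constructor
    · rintro ⟨h1, h2⟩
      refine ⟨φi (φj.symm y), ⟨φi.map_source h2, ?_⟩, ?_⟩
      · show φi.symm (φi (φj.symm y)) ∈ φj.source
        rw [φi.left_inv h2]; exact φj.map_target h1
      · show φj (φi.symm (φi (φj.symm y))) = y
        rw [φi.left_inv h2, φj.right_inv h1]
    · rintro ⟨z, ⟨h1, h2⟩, rfl⟩
      refine ⟨φj.map_source h2, ?_⟩
      show φj.symm (φj (φi.symm z)) ∈ φi.source
      rw [φj.left_inv h2]; exact φi.map_target h1
  have hinj : InjOn (φj ∘ φi.symm) V := by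
    rintro y ⟨hy, hy'⟩ z ⟨hz, hz'⟩ h
    exact φi.symm.injOn hy hz (φj.injOn hy' hz' h)
  have hloc : ∀ y ∈ V, ContDiffAt ℝ ∞ (φj ∘ φi.symm) y ∧ ∀ θ : DForm n n M,
      chartRep θ i y (stdBasis n) = (fderiv ℝ (φj ∘ φi.symm) y).det *
        chartRep θ j ((φj ∘ φi.symm) y) (stdBasis n) := fun y hy => by
    have h := fun θ : DForm n n M => pullback_eventuallyEq_chart (isOpen_chart_target i)
      (contMDiffOn_chart_symm i) hy.1 θ (x₀ := j) hy.2
    refine ⟨(h 0).1, fun θ => ?_⟩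
    rw [← top_form_comp]
    exact congrArg (fun w => w (stdBasis n)) (h θ).2.self_of_nhds
  rw [himg, integral_image_eq_integral_abs_det_fderiv_smul volume (hopen i j).measurableSet
    (fun y hy => (((hloc y hy).1.differentiableAt (by simp)).hasFDerivAt.hasFDerivWithinAt)) hinj]
  refine setIntegral_congr_fun (hopen i j).measurableSet fun y hy => ?_
  simp only [(hloc y hy).2, sign_mul_mul, smul_eq_mul]

variable {o : DForm n n M} {C : Set M} {i : M}

theorem integrableOn_chart (ho : IsVolumeForm o) {η : DForm n n M} (hη : IsSmooth η)
    (hC : IsCompact C) (hCi : C ⊆ (extChartAt (𝓡 n) i).source) (h0 : ∀ x, x ∉ C → η x = 0) :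
    IntegrableOn (fun y => Real.sign (chartRep o i y (stdBasis n)) * chartRep η i y (stdBasis n))
      (extChartAt (𝓡 n) i).target := by
  obtain ⟨h1, h2, h3⟩ := isCompact_chart_image hC hCi
  refine integrableOn_of_contDiffOn (isOpen_chart_target i) h1 h2 (contDiffOn_sign_mul ho hη i)
    fun y hy hyC => ?_
  rw [chartRep_eq_zero (h0 _ (h3 y hy hyC))]
  simp

theorem chartInt_add (ho : IsVolumeForm o) {η η' : DForm n n M} (hη : IsSmooth η)
    (hη' : IsSmooth η') (hC : IsCompact C) (hCi : C ⊆ (extChartAt (𝓡 n) i).source)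
    (h0 : ∀ x, x ∉ C → η x = 0) (h0' : ∀ x, x ∉ C → η' x = 0) :
    chartInt o (η + η') i = chartInt o η i + chartInt o η' i := by
  rw [chartInt, chartInt, chartInt, ← integral_add (integrableOn_chart ho hη hC hCi h0)
    (integrableOn_chart ho hη' hC hCi h0')]
  congr 1
  funext y
  rw [chartRep_add, ← mul_add]
  rfl

theorem chartInt_sum (ho : IsVolumeForm o) {ι : Type*} {s : Finset ι} {η : ι → DForm n n M}
    (hη : ∀ a ∈ s, IsSmooth (η a)) (hC : IsCompact C) (hCi : C ⊆ (extChartAt (𝓡 n) i).source)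
    (h0 : ∀ a ∈ s, ∀ x, x ∉ C → η a x = 0) :
    chartInt o (∑ a ∈ s, η a) i = ∑ a ∈ s, chartInt o (η a) i := by
  classical
  induction s using Finset.induction_on with
  | empty =>
    have : chartRep (0 : DForm n n M) i = fun _ => 0 := by funext y; ext v; rfl
    simp [chartInt, this]
  | insert a s ha ih =>
    rw [Finset.sum_insert ha, Finset.sum_insert ha,
      chartInt_add ho (hη a (by simp)) (IsSmooth.sum fun b hb => hη b (by simp [hb])) hC hCi
        (h0 a (by simp)), ih (fun b hb => hη b (by simp [hb])) fun b hb => h0 b (by simp [hb])]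
    intro x hx
    rw [Finset.sum_apply]
    exact Finset.sum_eq_zero fun b hb => h0 b (by simp [hb]) x hx

/-- Stokes' theorem in a chart. -/
theorem chartInt_d {m : ℕ} {M : Type*} [TopologicalSpace M] [ChartedSpace (Model (m + 1)) M]
    [IsManifold (𝓡 (m + 1)) ∞ M] {o : DForm (m + 1) (m + 1) M} {C : Set M} {i : M}
    (ho : IsVolumeForm o) {η : DForm (m + 1) m M} (hη : IsSmooth η)
    (hC : IsCompact C) (hCi : C ⊆ (extChartAt (𝓡 (m + 1)) i).source)
    (h0 : ∀ x, x ∉ C → η x = 0) : chartInt (n := m + 1) o (d η) i = 0 := by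
  obtain ⟨h1, h2, h3⟩ := isCompact_chart_image hC hCi
  have hT := isOpen_chart_target (n := m + 1) i
  -- The coefficient of `dη` is an alternating sum of partial derivatives of compactly supported
  -- components; each one integrates to zero separately.
  have key := fun a : Fin (m + 1) => setIntegral_sign_fderiv hT h1 h2
    (s := fun y => Real.sign (chartRep o i y (stdBasis (m + 1))))
    (contDiffOn_form_iff.1 (hη i) (a.removeNth (stdBasis (m + 1))))
    (fun y hy hyC => by rw [chartRep_eq_zero (h0 _ (h3 y hy hyC))]; rfl)
    (fun y hy => sign_locally_const ho hy) (stdBasis (m + 1) a)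
  have : ∀ y ∈ (extChartAt (𝓡 (m + 1)) i).target,
      Real.sign (chartRep o i y (stdBasis (m + 1))) * chartRep (n := m + 1) (d η) i y (stdBasis (m + 1)) =
      ∑ a : Fin (m + 1), (-1 : ℝ) ^ (a : ℕ) * (Real.sign (chartRep o i y (stdBasis (m + 1))) *
        fderiv ℝ (fun y => chartRep η i y (a.removeNth (stdBasis (m + 1)))) y
          (stdBasis (m + 1) a)) := fun y hy => by
    rw [chartRep_d hη i hy, extDeriv_apply ((hη.contDiffAt hy).differentiableAt (by simp)),
      Finset.mul_sum]
    refine Finset.sum_congr rfl fun a _ => ?_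
    rw [zsmul_eq_mul]
    push_cast
    ring
  rw [chartInt, setIntegral_congr_fun hT.measurableSet this,
    integral_finsetSum _ fun a _ => ((key a).1.const_mul _)]
  refine Finset.sum_eq_zero fun a _ => ?_
  rw [integral_const_mul, (key a).2, mul_zero]

end Charts

/-! ### Stability of compact support. -/

section CompactSupport

open Set

variable {n k : ℕ} {M : Type*} [TopologicalSpace M]

theorem HasCompactSupp.add {θ θ' : DForm n k M} (h : HasCompactSupp θ) (h' : HasCompactSupp θ') :
    HasCompactSupp (θ + θ') := by
  obtain ⟨K, hK, h0⟩ := h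
  obtain ⟨K', hK', h0'⟩ := h'
  refine ⟨K ∪ K', hK.union hK', fun x hx => ?_⟩
  rw [mem_union, not_or] at hx
  simp [h0 x hx.1, h0' x hx.2]

theorem HasCompactSupp.sum {ι : Type*} {s : Finset ι} {θ : ι → DForm n k M}
    (h : ∀ a ∈ s, HasCompactSupp (θ a)) : HasCompactSupp (∑ a ∈ s, θ a) := by
  classical
  induction s using Finset.induction_on with
  | empty => exact ⟨∅, isCompact_empty, fun x _ => rfl⟩
  | insert a s ha ih =>
    rw [Finset.sum_insert ha]
    exact (h a (by simp)).add (ih fun i hi => h i (by simp [hi]))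

theorem HasCompactSupp.smul {θ : DForm n k M} (h : HasCompactSupp θ) (c : ℝ) :
    HasCompactSupp (c • θ) := by
  obtain ⟨K, hK, h0⟩ := h
  exact ⟨K, hK, fun x hx => by simp [h0 x hx]⟩

theorem HasCompactSupp.wedge_left {α : DForm n 1 M} (h : HasCompactSupp α) (β : DForm n k M) :
    HasCompactSupp (wedge α β) := by
  obtain ⟨K, hK, h0⟩ := h
  refine ⟨K, hK, fun x hx => ?_⟩
  ext v
  simp [wedge_apply, h0 x hx]

theorem HasCompactSupp.wedge_right {β : DForm n k M} (h : HasCompactSupp β) (α : DForm n 1 M) :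
    HasCompactSupp (wedge α β) := by
  obtain ⟨K, hK, h0⟩ := h
  refine ⟨K, hK, fun x hx => ?_⟩
  ext v
  simp [wedge_apply, h0 x hx]

end CompactSupport

/-! ### The integral on the manifold. -/

section Global

open Set MeasureTheory Topology Filter

variable {n k : ℕ} {M : Type*} [TopologicalSpace M] [ChartedSpace (Model n) M]

theorem chartInt_zero (o : DForm n n M) (i : M) : chartInt o 0 i = 0 := by
  have : chartRep (0 : DForm n n M) i = fun _ => 0 := by funext y; ext v; rfl
  simp [chartInt, this]

/-- The operator `d` is local, and the form vanishes on a neighbourhood of any point off the closed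
set `C`. -/
theorem d_eq_zero_of_notMem {θ : DForm n k M} {C : Set M} (hC : IsClosed C)
    (h0 : ∀ x, x ∉ C → θ x = 0) {x : M} (hx : x ∉ C) : d θ x = 0 := by
  have : chartRep θ x =ᶠ[𝓝 (extChartAt (𝓡 n) x x)] fun _ => 0 := by
    have h1 : (extChartAt (𝓡 n) x).symm ⁻¹' Cᶜ ∈ 𝓝 (extChartAt (𝓡 n) x x) := by
      refine (continuousAt_extChartAt_symm x).preimage_mem_nhds ?_
      rw [extChartAt_to_inv]
      exact hC.isOpen_compl.mem_nhds hx
    filter_upwards [h1] with y hy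
    exact chartRep_eq_zero (h0 _ hy)
  rw [d, this.extDeriv_eq, extDeriv]
  simp only [fderiv_fun_const, Pi.zero_apply]
  rw [← ContinuousAlternatingMap.alternatizeUncurryFinCLM_apply, map_zero]
  rfl

theorem HasCompactSupp.d [T2Space M] {θ : DForm n k M} (h : HasCompactSupp θ) : HasCompactSupp (d θ) := by
  obtain ⟨K, hK, h0⟩ := h
  exact ⟨K, hK, fun x hx => d_eq_zero_of_notMem hK.isClosed h0 hx⟩

variable [IsManifold (𝓡 n) ∞ M] [T2Space M] [SigmaCompactSpace M]

theorem chartPartition_smooth (i : M) : SmoothFun n (chartPartition n M i) :=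
  SmoothFun.of_contMDiff (chartPartition n M i).contMDiff

theorem chartPartition_tsupport (i : M) :
    tsupport (chartPartition n M i) ⊆ (extChartAt (𝓡 n) i).source := by
  rw [extChartAt_source]
  exact (SmoothPartitionOfUnity.exists_isSubordinate_chartAt_source (𝓡 n) M).choose_spec i

theorem fmul_chartPartition_eq_zero {θ : DForm n k M} {K : Set M} (h0 : ∀ x, x ∉ K → θ x = 0)
    (i : M) (x : M) (hx : x ∉ K ∩ tsupport (chartPartition n M i)) :
    fmul (chartPartition n M i) θ x = 0 := by
  by_cases h : x ∈ K
  · have : x ∉ tsupport (chartPartition n M i) := fun h' => hx ⟨h, h'⟩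
    simp [fmul, image_eq_zero_of_notMem_tsupport this]
  · simp [fmul, h0 x h]

theorem chartPartition_inter_compact {K : Set M} (hK : IsCompact K) (i : M) :
    IsCompact (K ∩ tsupport (chartPartition n M i)) ∧
      K ∩ tsupport (chartPartition n M i) ⊆ (extChartAt (𝓡 n) i).source :=
  ⟨hK.inter_right (isClosed_tsupport _), fun _ hx => chartPartition_tsupport i hx.2⟩

theorem exists_finset_chartPartition {K : Set M} (hK : IsCompact K) :
    ∃ s : Finset M, ∀ i, i ∉ s → ∀ x ∈ K, chartPartition n M i x = 0 := by
  have h := (chartPartition n M).locallyFinite.finite_nonempty_inter_compact hK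
  refine ⟨h.toFinset, fun i hi x hx => ?_⟩
  by_contra h'
  exact hi (h.mem_toFinset.2 ⟨x, h', hx⟩)

/-- Local finiteness leaves finitely many indices that meet `K`. The finite set depends on `K`
alone, so it serves all forms of all degrees supported there. -/
theorem exists_finset_fmul_eq_zero {K : Set M} (hK : IsCompact K) :
    ∃ s : Finset M, ∀ {k : ℕ} (θ : DForm n k M), (∀ x, x ∉ K → θ x = 0) →
      (∀ i, i ∉ s → fmul (chartPartition n M i) θ = 0) ∧
      θ = ∑ i ∈ s, fmul (chartPartition n M i) θ := by
  obtain ⟨s, hs⟩ := exists_finset_chartPartition (n := n) hK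
  refine ⟨s, fun {k} θ h0 => ⟨fun i hi => ?_, ?_⟩⟩
  · funext x
    by_cases hx : x ∈ K
    · simp [fmul, hs i hi x hx]
    · simp [fmul, h0 x hx]
  · funext x
    rw [Finset.sum_apply]
    simp only [fmul]
    rw [← Finset.sum_smul]
    by_cases hx : x ∈ K
    · rw [← finsum_eq_sum_of_support_subset, (chartPartition n M).sum_eq_one (mem_univ x), one_smul]
      intro i hi
      by_contra h
      exact hi (hs i h x hx)
    · rw [h0 x hx, smul_zero]

theorem intForm_eq_finsum (o θ : DForm n n M) :
    intForm o θ = ∑ᶠ i : M, chartInt o (fmul (chartPartition n M i) θ) i := by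
  refine finsum_congr fun i => ?_
  rw [chartInt]
  congr 1
  funext y
  rw [chartRep_fmul, ContinuousAlternatingMap.smul_apply, smul_eq_mul]
  ring

/-- One index set for all forms supported in `K` lets additivity compare the three integrals term by
term. -/
theorem intForm_eq_sum {K : Set M} (hK : IsCompact K) : ∃ s : Finset M,
    ∀ o θ : DForm n n M, (∀ x, x ∉ K → θ x = 0) →
      intForm o θ = ∑ i ∈ s, chartInt o (fmul (chartPartition n M i) θ) i := by
  obtain ⟨s, hs⟩ := exists_finset_fmul_eq_zero (n := n) hK
  refine ⟨s, fun o θ h0 => ?_⟩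
  rw [intForm_eq_finsum, finsum_eq_sum_of_support_subset]
  intro i hi
  by_contra h
  exact hi (by simp only [(hs θ h0).1 i h, chartInt_zero])

variable {o : DForm n n M}

theorem intForm_add (ho : IsVolumeForm o) {θ θ' : DForm n n M} (hθ : IsSmooth θ)
    (hθ' : IsSmooth θ') (hc : HasCompactSupp θ) (hc' : HasCompactSupp θ') :
    intForm o (θ + θ') = intForm o θ + intForm o θ' := by
  obtain ⟨K, hK, h0⟩ := hc
  obtain ⟨K', hK', h0'⟩ := hc'
  have hU := hK.union hK'
  have e0 : ∀ x, x ∉ K ∪ K' → θ x = 0 := fun x hx => h0 x fun h => hx (Or.inl h)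
  have e0' : ∀ x, x ∉ K ∪ K' → θ' x = 0 := fun x hx => h0' x fun h => hx (Or.inr h)
  obtain ⟨s, hs⟩ := intForm_eq_sum (n := n) hU
  rw [hs o θ e0, hs o θ' e0', hs o (θ + θ') fun x hx => by simp [e0 x hx, e0' x hx],
    ← Finset.sum_add_distrib]
  refine Finset.sum_congr rfl fun i _ => ?_
  have hi := chartPartition_inter_compact (n := n) hU i
  rw [← chartInt_add ho (IsSmooth.fmul (chartPartition_smooth i) hθ)
    (IsSmooth.fmul (chartPartition_smooth i) hθ') hi.1 hi.2
    (fmul_chartPartition_eq_zero e0 i) (fmul_chartPartition_eq_zero e0' i)]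
  congr 1
  funext x
  exact smul_add _ _ _

theorem intForm_smul (o : DForm n n M) (c : ℝ) (θ : DForm n n M) :
    intForm o (c • θ) = c * intForm o θ := by
  rw [intForm, intForm, ← smul_eq_mul, smul_finsum]
  refine finsum_congr fun i => ?_
  rw [smul_eq_mul, ← integral_const_mul]
  congr 1
  funext y
  rw [chartRep_smul, Pi.smul_apply, ContinuousAlternatingMap.smul_apply, smul_eq_mul]
  ring

theorem intForm_zero (o : DForm n n M) : intForm o 0 = 0 := by
  simpa using intForm_smul o 0 0

theorem intForm_sum (ho : IsVolumeForm o) {ι : Type*} {s : Finset ι} {θ : ι → DForm n n M}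
    (hθ : ∀ a ∈ s, IsSmooth (θ a)) (hc : ∀ a ∈ s, HasCompactSupp (θ a)) :
    intForm o (∑ a ∈ s, θ a) = ∑ a ∈ s, intForm o (θ a) := by
  classical
  induction s using Finset.induction_on with
  | empty => simpa using intForm_zero o
  | insert a s ha ih =>
    rw [Finset.sum_insert ha, Finset.sum_insert ha,
      intForm_add ho (hθ a (by simp)) (IsSmooth.sum fun b hb => hθ b (by simp [hb]))
        (hc a (by simp)) (HasCompactSupp.sum fun b hb => hc b (by simp [hb])),
      ih (fun b hb => hθ b (by simp [hb])) fun b hb => hc b (by simp [hb])]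

/-- The integral of a form supported in a chart domain. -/
theorem intForm_eq_chartInt (ho : IsVolumeForm o) {η : DForm n n M} (hη : IsSmooth η) {C : Set M}
    {j : M} (hC : IsCompact C) (hCj : C ⊆ (extChartAt (𝓡 n) j).source)
    (h0 : ∀ x, x ∉ C → η x = 0) : intForm o η = chartInt o η j := by
  obtain ⟨s, hs⟩ := exists_finset_fmul_eq_zero (n := n) hC
  have h1 : ∀ i x, x ∉ C → fmul (chartPartition n M i) η x = 0 := fun i x hx => by
    simp [fmul, h0 x hx]
  -- Each piece of `η` is supported in both chart `i` and chart `j`; once all are moved to chart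
  -- `j`, they add up to `η` again.
  have h2 : ∀ i, chartInt o (fmul (chartPartition n M i) η) i =
      chartInt o (fmul (chartPartition n M i) η) j := fun i =>
    chartInt_eq_chartInt o _
      (fun x hx => fmul_chartPartition_eq_zero h0 i x fun h => hx (chartPartition_tsupport i h.2))
      (fun x hx => h1 i x fun h => hx (hCj h))
  rw [intForm_eq_finsum, finsum_eq_sum_of_support_subset (s := s)]
  · simp only [h2]
    rw [← chartInt_sum ho (fun i _ => IsSmooth.fmul (chartPartition_smooth i) hη) hC hCj
      fun i _ => h1 i, ← (hs η h0).2]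
  · intro i hi
    by_contra h
    exact hi (by simp only [(hs η h0).1 i h, chartInt_zero])

end Global

/-! ### Stokes' theorem. -/

section Stokes

open Set

variable {m : ℕ} {M : Type*} [TopologicalSpace M] [ChartedSpace (Model (m + 1)) M]
  [IsManifold (𝓡 (m + 1)) ∞ M] [T2Space M] [SigmaCompactSpace M]

/-- Stokes' theorem for compactly supported forms on manifolds without boundary. -/
theorem intForm_d {o : DForm (m + 1) (m + 1) M} (ho : IsVolumeForm o) {θ : DForm (m + 1) m M}
    (hθ : IsSmooth θ) (hc : HasCompactSupp θ) : intForm o (d θ) = 0 := by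
  obtain ⟨K, hK, h0⟩ := hc
  obtain ⟨s, hs⟩ := exists_finset_fmul_eq_zero (n := m + 1) hK
  have hsm : ∀ i, IsSmooth (fmul (chartPartition (m + 1) M i) θ) := fun i =>
    IsSmooth.fmul (chartPartition_smooth i) hθ
  have hi := chartPartition_inter_compact (n := m + 1) hK
  have hcs : ∀ i, HasCompactSupp (fmul (chartPartition (m + 1) M i) θ) := fun i =>
    ⟨_, (hi i).1, fmul_chartPartition_eq_zero h0 i⟩
  -- The partition of unity cuts `θ` rather than `dθ`, so every piece is the derivative of a form
  -- supported in one chart.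
  rw [(hs θ h0).2, d_sum fun i _ => hsm i,
    intForm_sum ho (fun i _ => (hsm i).d) fun i _ => (hcs i).d]
  refine Finset.sum_eq_zero fun i _ => ?_
  rw [intForm_eq_chartInt ho (hsm i).d (hi i).1 (hi i).2 fun x hx => d_eq_zero_of_notMem
    (hi i).1.isClosed (fmul_chartPartition_eq_zero h0 i) hx,
    chartInt_d ho (hsm i) (hi i).1 (hi i).2 (fmul_chartPartition_eq_zero h0 i)]

end Stokes

/-! ### The fundamental lemma of the calculus of variations. -/

section Fundamental

open Set MeasureTheory Topology Filter

theorem sign_mul_self_eq_abs (a : ℝ) : Real.sign a * a = |a| := by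
  simpa [Real.sign_one] using sign_mul_mul a 1 1

variable {M : Type*}

theorem ratio_mul {η v : DForm 4 4 M} {x : M} (hv : v x ≠ 0) (u : Fin 4 → Model 4) :
    η x u = ratio η v x * v x u := by
  have := top_form_ne_zero hv
  rw [top_form_apply, top_form_apply (v x), ratio]
  field_simp

variable [TopologicalSpace M] [ChartedSpace (Model 4) M]

theorem ratio_mul_chartRep {η v : DForm 4 4 M} (hv : ∀ x, v x ≠ 0) (i : M) (y : Model 4)
    (u : Fin 4 → Model 4) : chartRep η i y u =
      ratio η v ((extChartAt (𝓡 4) i).symm y) * chartRep v i y u :=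
  ratio_mul (hv _) _

variable [IsManifold (𝓡 4) ∞ M]

/-- In each chart the ratio is the quotient of the two chart coefficients, since the Jacobian
factors cancel. -/
theorem smoothFun_ratio {η v : DForm 4 4 M} (hη : IsSmooth η) (hv : IsVolumeForm v) :
    SmoothFun 4 (ratio η v) := fun i => by
  refine ((contDiffOn_form_iff.1 (hη i) (stdBasis 4)).div (contDiffOn_form_iff.1 (hv.1 i)
    (stdBasis 4)) fun y hy => chartRep_top_ne_zero hv.2 hy).congr fun y hy => ?_
  show ratio η v _ = chartRep η i y (stdBasis 4) / chartRep v i y (stdBasis 4)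
  rw [ratio_mul_chartRep (η := η) hv.2, mul_div_cancel_right₀ _ (chartRep_top_ne_zero hv.2 hy)]

variable [T2Space M] [SigmaCompactSpace M]

/-- The fundamental lemma of the calculus of variations for top-degree forms. -/
theorem eq_zero_of_intForm_fmul {o τ : DForm 4 4 M} (ho : IsVolumeForm o) (hτ : IsSmooth τ)
    (h : ∀ f : M → ℝ, SmoothFun 4 f → (∃ K, IsCompact K ∧ ∀ x, x ∉ K → f x = 0) →
      intForm o (fmul f τ) = 0) : τ = 0 := by
  by_contra hne
  obtain ⟨x₀, hx₀⟩ := Function.ne_iff.1 hne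
  let χ : SmoothBumpFunction (𝓡 4) x₀ := Classical.arbitrary _
  have hK : IsCompact (tsupport χ) := χ.hasCompactSupport
  have hKs : tsupport χ ⊆ (extChartAt (𝓡 4) x₀).source := by
    rw [extChartAt_source]; exact χ.tsupport_subset_chartAt_source
  -- The test function is a bump `χ` times `r = τ/o`. Its pairing with `τ` has density `χ r² |o|`,
  -- which is nonnegative and is positive at `x₀`.
  set r := ratio τ o
  have hf : SmoothFun 4 (fun x => χ x * r x) :=
    (SmoothFun.of_contMDiff χ.contMDiff).mul (smoothFun_ratio hτ ho)
  have hf0 : ∀ x, x ∉ tsupport χ → χ x * r x = 0 := fun x hx => by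
    rw [image_eq_zero_of_notMem_tsupport hx, zero_mul]
  have h1 := h _ hf ⟨_, hK, hf0⟩
  have hsm := IsSmooth.fmul hf hτ
  have h0 : ∀ x, x ∉ tsupport χ → fmul (fun x => χ x * r x) τ x = 0 := fun x hx => by
    show (χ x * r x) • τ x = 0
    rw [hf0 x hx, zero_smul]
  rw [intForm_eq_chartInt ho hsm hK hKs h0, chartInt] at h1
  obtain ⟨c1, c2, c3⟩ := isCompact_chart_image hK hKs
  have hT := isOpen_chart_target (n := 4) x₀
  obtain ⟨g1, g2⟩ := contDiff_indicator hT c1 c2 (contDiffOn_sign_mul ho hsm x₀) fun y hy hyC => by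
    rw [chartRep_eq_zero (h0 _ (c3 y hy hyC))]
    simp
  rw [← integral_indicator hT.measurableSet] at h1
  have hval : ∀ y, Real.sign (chartRep o x₀ y (stdBasis 4)) *
      chartRep (fmul (fun x => χ x * r x) τ) x₀ y (stdBasis 4) =
      χ ((extChartAt (𝓡 4) x₀).symm y) * (r ((extChartAt (𝓡 4) x₀).symm y)) ^ 2 *
        |chartRep o x₀ y (stdBasis 4)| := fun y => by
    rw [chartRep_fmul, ContinuousAlternatingMap.smul_apply, ratio_mul_chartRep (η := τ) ho.2,
      smul_eq_mul, ← sign_mul_self_eq_abs]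
    ring
  have hpos := g1.continuous.integral_pos_of_hasCompactSupport_nonneg_nonzero (μ := volume) g2
    (fun y => indicator_nonneg (fun y _ => by
      rw [hval]
      exact mul_nonneg (mul_nonneg χ.nonneg (sq_nonneg _)) (abs_nonneg _)) y)
    (x := extChartAt (𝓡 4) x₀ x₀) (by
      have hy := mem_extChartAt_target (I := 𝓡 4) x₀
      rw [indicator_of_mem hy, hval, extChartAt_to_inv, χ.eq_one, one_mul]
      refine mul_ne_zero (pow_ne_zero 2 fun hr => hx₀ ?_)
        (abs_ne_zero.2 (chartRep_top_ne_zero ho.2 hy))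
      ext u
      rw [ratio_mul (η := τ) (ho.2 x₀), show ratio τ o x₀ = 0 from hr, zero_mul]
      rfl)
  exact hpos.ne' h1

end Fundamental

/-! ### Dual frames and evaluation of wedge products on them. -/

section Frame

/-- Functionals which are linearly independent admit a dual frame. -/
theorem exists_dual_frame {e : Fin 4 → Model 4 [⋀^Fin 1]→L[ℝ] ℝ} (he : LinearIndependent ℝ e) :
    ∃ f : Module.Basis (Fin 4) ℝ (Model 4), ∀ I J, e I ![f J] = if I = J then 1 else 0 := by
  let S : (Model 4 [⋀^Fin 1]→L[ℝ] ℝ) →ₗ[ℝ] Module.Dual ℝ (Model 4) :=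
    { toFun := fun a =>
        ((ContinuousAlternatingMap.ofSubsingleton ℝ (Model 4) ℝ (0 : Fin 1)).symm a).toLinearMap
      map_add' := fun _ _ => rfl
      map_smul' := fun _ _ => rfl }
  have hS : ∀ a v, S a v = a ![v] := fun a v => congrArg a (by ext i; fin_cases i; rfl)
  have hSi : LinearMap.ker S = ⊥ := LinearMap.ker_eq_bot'.2 fun a ha => by
    ext v
    have : v = ![v 0] := by ext i; fin_cases i; rfl
    rw [this, ← hS, ha]
    rfl
  have hl := he.map' S hSi
  have hspan := hl.span_eq_top_of_card_eq_finrank (by simp)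
  let L : Model 4 →ₗ[ℝ] (Fin 4 → ℝ) := LinearMap.pi (S ∘ e)
  -- Four independent functionals span the four-dimensional dual, so a vector killed by all of them
  -- is zero. The dual frame is the basis whose coordinate map is `L`.
  have hL : Function.Injective L := (injective_iff_map_eq_zero L).2 fun v hv => by
    rw [← Module.forall_dual_apply_eq_zero_iff ℝ v]
    intro φ
    have hφ : φ ∈ Submodule.span ℝ (Set.range (S ∘ e)) := by rw [hspan]; trivial
    induction hφ using Submodule.span_induction with
    | mem φ h => obtain ⟨I, rfl⟩ := h; exact congrFun hv I
    | zero => rfl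
    | add φ ψ _ _ h1 h2 => rw [LinearMap.add_apply, h1, h2, add_zero]
    | smul c φ _ h => rw [LinearMap.smul_apply, h, smul_zero]
  let E := LinearMap.linearEquivOfInjective L hL (by simp)
  refine ⟨Module.Basis.ofEquivFun E, fun I J => ?_⟩
  rw [← hS]
  have h := (Module.Basis.ofEquivFun E).equivFun_self J I
  rw [Module.Basis.equivFun_ofEquivFun] at h
  simp only [eq_comm (a := I)]
  exact h

variable {E : Type*} [NormedAddCommGroup E] [NormedSpace ℝ E]

theorem ewedge_apply_two (a b : E [⋀^Fin 1]→L[ℝ] ℝ) (u v : E) :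
    ewedge a b ![u, v] = a ![u] * b ![v] - a ![v] * b ![u] := by
  have h : ∀ w : E, (fun _ : Fin 1 => w) = ![w] := fun w => by ext i; fin_cases i; rfl
  have r0 : (0 : Fin 2).removeNth ![u, v] = ![v] := by ext i; fin_cases i; rfl
  have r1 : (1 : Fin 2).removeNth ![u, v] = ![u] := by ext i; fin_cases i; rfl
  rw [ewedge_apply, Fin.sum_univ_two, r0, r1]
  simp [h, sub_eq_add_neg]

theorem ewedge_apply_three (a : E [⋀^Fin 1]→L[ℝ] ℝ) (b : E [⋀^Fin 2]→L[ℝ] ℝ) (u v w : E) :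
    ewedge a b ![u, v, w] = a ![u] * b ![v, w] - a ![v] * b ![u, w] + a ![w] * b ![u, v] := by
  have h : ∀ w : E, (fun _ : Fin 1 => w) = ![w] := fun w => by ext i; fin_cases i; rfl
  have r0 : (0 : Fin 3).removeNth ![u, v, w] = ![v, w] := by ext i; fin_cases i <;> rfl
  have r1 : (1 : Fin 3).removeNth ![u, v, w] = ![u, w] := by ext i; fin_cases i <;> rfl
  have r2 : (2 : Fin 3).removeNth ![u, v, w] = ![u, v] := by ext i; fin_cases i <;> rfl
  rw [ewedge_apply, Fin.sum_univ_three, r0, r1, r2]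
  simp [h, sub_eq_add_neg]

theorem ewedge_apply_four (a : E [⋀^Fin 1]→L[ℝ] ℝ) (b : E [⋀^Fin 3]→L[ℝ] ℝ) (u v w z : E) :
    ewedge a b ![u, v, w, z] = a ![u] * b ![v, w, z] - a ![v] * b ![u, w, z] +
      a ![w] * b ![u, v, z] - a ![z] * b ![u, v, w] := by
  have h : ∀ w : E, (fun _ : Fin 1 => w) = ![w] := fun w => by ext i; fin_cases i; rfl
  have r0 : (0 : Fin 4).removeNth ![u, v, w, z] = ![v, w, z] := by ext i; fin_cases i <;> rfl
  have r1 : (1 : Fin 4).removeNth ![u, v, w, z] = ![u, w, z] := by ext i; fin_cases i <;> rfl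
  have r2 : (2 : Fin 4).removeNth ![u, v, w, z] = ![u, v, z] := by ext i; fin_cases i <;> rfl
  have r3 : (3 : Fin 4).removeNth ![u, v, w, z] = ![u, v, w] := by ext i; fin_cases i <;> rfl
  rw [ewedge_apply, Fin.sum_univ_four, r0, r1, r2, r3]
  simp [h, sub_eq_add_neg, Odd.neg_one_pow (by decide : Odd 3)]

theorem two_form_swap (b : E [⋀^Fin 2]→L[ℝ] ℝ) (u v : E) : b ![u, v] = -b ![v, u] := by
  have h := b.toAlternatingMap.map_swap ![v, u] (i := 0) (j := 1) (by decide)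
  have e : ![v, u] ∘ Equiv.swap (0 : Fin 2) 1 = ![u, v] := by ext i; fin_cases i <;> rfl
  rw [e] at h
  exact h

theorem form_ext_basis {ι : Type*} {k : ℕ} (f : Module.Basis ι ℝ E) {b c : E [⋀^Fin k]→L[ℝ] ℝ}
    (h : ∀ s : Fin k → ι, b (fun i => f (s i)) = c (fun i => f (s i))) : b = c := by
  apply ContinuousAlternatingMap.toAlternatingMap_injective
  apply AlternatingMap.coe_multilinearMap_injective
  exact Module.Basis.ext_multilinear (fun _ => f) h

theorem form_ext_one {ι : Type*} (f : Module.Basis ι ℝ E) {b c : E [⋀^Fin 1]→L[ℝ] ℝ}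
    (h : ∀ m, b ![f m] = c ![f m]) : b = c :=
  form_ext_basis f fun s => by
    have : (fun i => f (s i)) = ![f (s 0)] := by ext i; fin_cases i; rfl
    rw [this, h]

theorem form_ext_two {ι : Type*} (f : Module.Basis ι ℝ E) {b c : E [⋀^Fin 2]→L[ℝ] ℝ}
    (h : ∀ m n, b ![f m, f n] = c ![f m, f n]) : b = c :=
  form_ext_basis f fun s => by
    have : (fun i => f (s i)) = ![f (s 0), f (s 1)] := by ext i; fin_cases i <;> rfl
    rw [this, h]

theorem form_ext_three {ι : Type*} (f : Module.Basis ι ℝ E) {b c : E [⋀^Fin 3]→L[ℝ] ℝ}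
    (h : ∀ l m n, b ![f l, f m, f n] = c ![f l, f m, f n]) : b = c :=
  form_ext_basis f fun s => by
    have : (fun i => f (s i)) = ![f (s 0), f (s 1), f (s 2)] := by ext i; fin_cases i <;> rfl
    rw [this, h]

end Frame

/-! ### The Levi-Civita symbol and the algebraic inversion in components. -/

section Components

/-- The symbol is the cast of an integer product of signs, so the identity is decidable over the 256
index tuples. -/
theorem eps_swap_first (I J K L : Fin 4) : eps I J K L = -eps J I K L := by
  have : ∀ I J K L : Fin 4,
    (((J.val : ℤ) - I.val).sign * ((K.val : ℤ) - I.val).sign * ((L.val : ℤ) - I.val).sign *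
      ((K.val : ℤ) - J.val).sign * ((L.val : ℤ) - J.val).sign * ((L.val : ℤ) - K.val).sign : ℤ) =
    -(((I.val : ℤ) - J.val).sign * ((K.val : ℤ) - J.val).sign * ((L.val : ℤ) - J.val).sign *
      ((K.val : ℤ) - I.val).sign * ((L.val : ℤ) - I.val).sign * ((L.val : ℤ) - K.val).sign) := by
    decide
  rw [eps, eps, this I J K L]
  push_cast
  rfl

theorem eps_pairs (I J K L : Fin 4) : eps I J K L = eps K L I J := by
  have : ∀ I J K L : Fin 4,
    (((J.val : ℤ) - I.val).sign * ((K.val : ℤ) - I.val).sign * ((L.val : ℤ) - I.val).sign *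
      ((K.val : ℤ) - J.val).sign * ((L.val : ℤ) - J.val).sign * ((L.val : ℤ) - K.val).sign : ℤ) =
    ((L.val : ℤ) - K.val).sign * ((I.val : ℤ) - K.val).sign * ((J.val : ℤ) - K.val).sign *
      ((I.val : ℤ) - L.val).sign * ((J.val : ℤ) - L.val).sign * ((J.val : ℤ) - I.val).sign := by
    decide
  rw [eps, eps, this I J K L]

theorem eps_swap_last (I J K L : Fin 4) : eps I J K L = -eps I J L K := by
  rw [eps_pairs, eps_swap_first, eps_pairs L K I J]

/-- The Hodge dual of an antisymmetric array. -/
def star (b : Fin 4 → Fin 4 → ℝ) : Fin 4 → Fin 4 → ℝ :=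
  ![![0, b 2 3, -b 1 3, b 1 2], ![-b 2 3, 0, b 0 3, -b 0 2], ![b 1 3, -b 0 3, 0, b 0 1],
    ![-b 1 2, b 0 2, -b 0 1, 0]]

theorem sign_two_three : Int.sign 2 = 1 ∧ Int.sign 3 = 1 := by decide

/-- The factor `2` appears because each unordered pair of indices is counted in both orders. -/
theorem sum_eps_eq_star {b : Fin 4 → Fin 4 → ℝ} (hb : ∀ m n, b m n = -b n m) (K L : Fin 4) :
    ∑ m, ∑ n, eps K L m n * b m n = 2 * star b K L := by
  have h0 : ∀ m, b m m = 0 := fun m => by linarith [hb m m]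
  have h10 := hb 1 0
  have h20 := hb 2 0
  have h30 := hb 3 0
  have h21 := hb 2 1
  have h31 := hb 3 1
  have h32 := hb 3 2
  fin_cases K <;> fin_cases L <;>
    simp [star, Fin.sum_univ_four, eps, sign_two_three, h0, h10, h20, h30, h21, h31, h32] <;> ring


/-- Components of `ε_{IJKL} e^J ∧ w^{KL}` in a frame. -/
def epsComp (W : Fin 4 → Fin 4 → Fin 4 → ℝ) (I m n : Fin 4) : ℝ :=
  2 * star (fun K L => W K L n) I m - 2 * star (fun K L => W K L m) I n

/-- Components of `connOf` in a frame. -/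
def connComp (b : Fin 4 → Fin 4 → Fin 4 → ℝ) (K L m : Fin 4) : ℝ :=
  -(1 / 2) * star (b m) K L - 1 / 2 * ∑ I, 1 / 2 *
    (star (b I) I K * (if L = m then 1 else 0) - star (b I) I L * (if K = m then 1 else 0))

/-- Uniqueness of the connection: the formula is a left inverse. Antisymmetry reduces every entry to
one with `K < L`, after which each case is a linear identity. -/
theorem connComp_epsComp {W : Fin 4 → Fin 4 → Fin 4 → ℝ} (hW : ∀ K L m, W K L m = -W L K m) :
    connComp (epsComp W) = W := by
  have h0 : ∀ K m, W K K m = 0 := fun K m => by linarith [hW K K m]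
  have h10 := hW 1 0
  have h20 := hW 2 0
  have h30 := hW 3 0
  have h21 := hW 2 1
  have h31 := hW 3 1
  have h32 := hW 3 2
  funext K L m
  fin_cases K <;> fin_cases L <;> fin_cases m <;>
    simp [connComp, epsComp, star, Fin.sum_univ_four, h0, h10, h20, h30, h21, h31, h32] <;>
    ring

-- Existence of the connection: the formula is also a right inverse. As `star` reads only entries
-- above the diagonal, the case `m < n` holds for any array; antisymmetry of `b` supplies the rest.
set_option maxHeartbeats 1000000 in
theorem epsComp_connComp {b : Fin 4 → Fin 4 → Fin 4 → ℝ} (hb : ∀ I m n, b I m n = -b I n m) :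
    epsComp (connComp b) = b := by
  have h0 : ∀ I m, b I m m = 0 := fun I m => by linarith [hb I m m]
  have hlt : ∀ I m n : Fin 4, m < n → epsComp (connComp b) I m n = b I m n := fun I m n hmn => by
    fin_cases m <;> fin_cases n <;> first
      | exact absurd hmn (by decide)
      | (fin_cases I <;>
          simp [connComp, epsComp, star, Fin.sum_univ_four] <;>
          ring)
  funext I m n
  rcases lt_trichotomy m n with h | rfl | h
  · exact hlt I m n h
  · rw [epsComp, sub_self, h0]
  · rw [hb, ← hlt I n m h, epsComp, epsComp]
    ring

theorem connComp_antisymm {b : Fin 4 → Fin 4 → Fin 4 → ℝ} (K L m : Fin 4) :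
    connComp b K L m = -connComp b L K m := by
  have hs : star (b m) K L = -star (b m) L K := by
    fin_cases K <;> fin_cases L <;> simp [star]
  rw [connComp, connComp, hs]
  simp only [Fin.sum_univ_four]
  ring

/-- One contribution for each of the `4!` permutations; it cancels the factor `1/24` in `vol`. -/
theorem sum_eps_mul_eps : ∑ I, ∑ J, ∑ K, ∑ L, eps I J K L * eps I J K L = 24 := by
  have : ∑ I : Fin 4, ∑ J : Fin 4, ∑ K : Fin 4, ∑ L : Fin 4,
    (((J.val : ℤ) - I.val).sign * ((K.val : ℤ) - I.val).sign * ((L.val : ℤ) - I.val).sign *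
      ((K.val : ℤ) - J.val).sign * ((L.val : ℤ) - J.val).sign * ((L.val : ℤ) - K.val).sign) *
    (((J.val : ℤ) - I.val).sign * ((K.val : ℤ) - I.val).sign * ((L.val : ℤ) - I.val).sign *
      ((K.val : ℤ) - J.val).sign * ((L.val : ℤ) - J.val).sign * ((L.val : ℤ) - K.val).sign) = 24 := by
    decide
  simp only [eps]
  exact_mod_cast this

end Components

/-! ### The connection in terms of the two-forms `B`. -/

section Connection

variable {M : Type*} {e : Tetrad 4 M} {x : M} {f : Module.Basis (Fin 4) ℝ (Model 4)}

/-- On a dual frame the coframe factors absorb the slots `K` and `L`, leaving the complementary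
component of `β` with its sign. -/
theorem wedge_wedge_frame (hf : ∀ I J, e I x ![f J] = if I = J then 1 else 0) (β : DForm 4 2 M)
    (K L : Fin 4) : wedge (e K) (wedge (e L) β) x ![f 0, f 1, f 2, f 3] =
      star (fun m n => β x ![f m, f n]) K L := by
  have h10 := two_form_swap (β x) (f 1) (f 0)
  have h20 := two_form_swap (β x) (f 2) (f 0)
  have h30 := two_form_swap (β x) (f 3) (f 0)
  have h21 := two_form_swap (β x) (f 2) (f 1)
  have h31 := two_form_swap (β x) (f 3) (f 1)
  have h32 := two_form_swap (β x) (f 3) (f 2)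
  show ewedge (e K x) (ewedge (e L x) (β x)) _ = _
  simp only [ewedge_apply_four, ewedge_apply_three, hf]
  fin_cases K <;> fin_cases L <;> simp [star]

theorem star_delta (I J K L : Fin 4) :
    star (fun m n => (if K = m then 1 else 0) * (if L = n then 1 else 0) -
      (if K = n then 1 else 0) * (if L = m then 1 else 0)) I J = eps I J K L := by
  have h := sum_eps_eq_star (b := fun m n => (if K = m then 1 else 0) * (if L = n then 1 else 0) -
      (if K = n then 1 else 0) * (if L = m then 1 else 0)) (fun m n => by ring) I J
  have h2 : ∑ m, ∑ n, eps I J m n * ((if K = m then 1 else 0) * (if L = n then 1 else 0) -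
      (if K = n then 1 else 0) * (if L = m then 1 else 0)) = eps I J K L - eps I J L K := by
    simp [mul_sub, Finset.sum_sub_distrib]
  rw [h2, eps_swap_last I J L K] at h
  linarith

/-- This normalization makes division by `vol e` the same as evaluation on the dual frame. -/
theorem vol_frame (hf : ∀ I J, e I x ![f J] = if I = J then 1 else 0) :
    vol e x ![f 0, f 1, f 2, f 3] = 1 := by
  have h : ∀ I J K L, wedge (e I) (wedge (e J) (wedge (e K) (e L))) x ![f 0, f 1, f 2, f 3] =
      eps I J K L := fun I J K L => by
    rw [wedge_wedge_frame hf, ← star_delta]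
    congr 1
    funext m n
    show ewedge (e K x) (e L x) _ = _
    rw [ewedge_apply_two]
    simp only [hf]
  simp only [vol, Pi.smul_apply, Finset.sum_apply, ContinuousAlternatingMap.smul_apply,
    ContinuousAlternatingMap.sum_apply, h, smul_eq_mul, sum_eps_mul_eps]
  norm_num

theorem ratio_frame (hf : ∀ I J, e I x ![f J] = if I = J then 1 else 0) (η : DForm 4 4 M) :
    ratio η (vol e) x = η x ![f 0, f 1, f 2, f 3] := by
  have hv := vol_frame hf
  have h0 : vol e x ≠ 0 := fun h => by rw [h] at hv; exact zero_ne_one hv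
  rw [ratio_mul h0, hv, mul_one]

theorem connOf_frame (hf : ∀ I J, e I x ![f J] = if I = J then 1 else 0) (B : Fin 4 → DForm 4 2 M)
    (K L m : Fin 4) : connOf e B K L x ![f m] =
      connComp (fun I m n => B I x ![f m, f n]) K L m := by
  simp only [connOf, ContinuousAlternatingMap.sub_apply, ContinuousAlternatingMap.smul_apply,
    ContinuousAlternatingMap.sum_apply, hf, smul_eq_mul, ratio_frame hf, wedge_wedge_frame hf,
    connComp]
  simp

theorem epsWedge_frame (hf : ∀ I J, e I x ![f J] = if I = J then 1 else 0) {w : Conn 4 M}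
    (hw : ∀ K L, w K L x = -w L K x) (I m n : Fin 4) : epsWedge e w I x ![f m, f n] =
      epsComp (fun K L m => w K L x ![f m]) I m n := by
  have hs : ∀ m n, ∑ K, ∑ L, eps I m K L * w K L x ![f n] = 2 * star (fun K L => w K L x ![f n]) I m :=
    fun m n => sum_eps_eq_star (fun K L => by rw [hw K L]; rfl) I m
  have h : ∀ J K L, wedge (e J) (w K L) x ![f m, f n] = (if J = m then 1 else 0) * w K L x ![f n] -
      (if J = n then 1 else 0) * w K L x ![f m] := fun J K L => by
    show ewedge (e J x) (w K L x) _ = _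
    rw [ewedge_apply_two, hf, hf]
  simp only [epsWedge, Finset.sum_apply, Pi.smul_apply, ContinuousAlternatingMap.smul_apply,
    ContinuousAlternatingMap.sum_apply, h, smul_eq_mul, epsComp, ← hs]
  simp [mul_sub, Finset.sum_sub_distrib]

/-- The connection is determined by `B`, pointwise. -/
theorem connOf_iff_at (he : LinearIndependent ℝ fun I => e I x) (w : Conn 4 M)
    (B : Fin 4 → DForm 4 2 M) :
    ((∀ K L, w K L x = -w L K x) ∧ ∀ I, epsWedge e w I x = B I x) ↔
      ∀ K L, w K L x = connOf e B K L x := by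
  obtain ⟨f, hf⟩ := exists_dual_frame he
  constructor
  · rintro ⟨hw, hB⟩ K L
    refine form_ext_one f fun m => ?_
    rw [connOf_frame hf]
    have : (fun I m n => B I x ![f m, f n]) = epsComp fun K L m => w K L x ![f m] := by
      funext I m n
      rw [← epsWedge_frame hf hw, hB]
    rw [this, connComp_epsComp fun K L m => by rw [hw K L]; rfl]
  · intro h
    have hw : ∀ K L, w K L x = -w L K x := fun K L => form_ext_one f fun m => by
      rw [h K L, h L K, connOf_frame hf, connComp_antisymm, ← connOf_frame hf]
      rfl
    refine ⟨hw, fun I => form_ext_two f fun m n => ?_⟩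
    rw [epsWedge_frame hf hw]
    have : (fun K L m => w K L x ![f m]) = connComp fun I m n => B I x ![f m, f n] := by
      funext K L m
      rw [h, connOf_frame hf]
    rw [this, epsComp_connComp fun I m n => two_form_swap (B I x) (f m) (f n)]

theorem connOf_iff {e : Tetrad 4 M} (he : Nondegenerate e) (w : Conn 4 M)
    (B : Fin 4 → DForm 4 2 M) : (Antisymm w ∧ epsWedge e w = B) ↔ w = connOf e B := by
  constructor
  · rintro ⟨h1, h2⟩
    funext K L x
    refine (connOf_iff_at (he x) w B).1 ⟨fun K L => ?_, fun I => by rw [h2]⟩ K L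
    rw [h1 K L]; rfl
  · intro h
    have := fun x => (connOf_iff_at (he x) w B).2 fun K L => by rw [h]
    exact ⟨fun K L => funext fun x => (this x).1 K L, funext fun I => funext fun x => (this x).2 I⟩

theorem vol_ne_zero {e : Tetrad 4 M} (he : Nondegenerate e) (x : M) : vol e x ≠ 0 := fun h => by
  obtain ⟨f, hf⟩ := exists_dual_frame (he x)
  have hv := vol_frame hf
  rw [h] at hv
  exact zero_ne_one hv

end Connection

/-! ### Cancelling coframe factors. -/

section Torsion

variable {M : Type*} {e : Tetrad 4 M}

/-- Three frame indices leave a fourth index `J` free; the component of `e^J ∧ η` with `f_J`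
inserted first is the given component of `η`. -/
theorem eq_zero_of_wedge_three (he : Nondegenerate e) {η : DForm 4 3 M}
    (h : ∀ J, wedge (e J) η = 0) : η = 0 := by
  funext x
  obtain ⟨f, hf⟩ := exists_dual_frame (he x)
  refine form_ext_three f fun a b c => ?_
  obtain ⟨J, h1, h2, h3⟩ : ∃ J : Fin 4, J ≠ a ∧ J ≠ b ∧ J ≠ c := by
    revert a b c; decide
  have hJ : ewedge (e J x) (η x) ![f J, f a, f b, f c] = 0 := by
    have := congrFun (h J) x
    exact congrArg (fun w => w ![f J, f a, f b, f c]) this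
  rw [ewedge_apply_four, hf, hf, hf, hf] at hJ
  simpa [h1, h2, h3] using hJ

/-- Vanishing of `e^L ∧ T^K - e^K ∧ T^L` implies the vanishing of the two-forms `T^K`. -/
theorem eq_zero_of_wedge_two (he : Nondegenerate e) {T : Fin 4 → DForm 4 2 M}
    (h : ∀ K L, wedge (e L) (T K) = wedge (e K) (T L)) (K : Fin 4) : T K = 0 := by
  funext x
  obtain ⟨f, hf⟩ := exists_dual_frame (he x)
  have H : ∀ K L a b c, ewedge (e L x) (T K x) ![f a, f b, f c] =
      ewedge (e K x) (T L x) ![f a, f b, f c] := fun K L a b c =>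
    congrArg (fun w => w ![f a, f b, f c]) (congrFun (h K L) x)
  simp only [ewedge_apply_three, hf] at H
  have hdiag : ∀ K m, T K x ![f m, f m] = 0 := fun K m => by
    have := two_form_swap (T K x) (f m) (f m); linarith
  -- Inserting a vector `f_L` with `L` different from `K`, `m`, `n` isolates this component on the
  -- left, while `e^K` kills the right side.
  have h1 : ∀ K m n, m ≠ K → n ≠ K → T K x ![f m, f n] = 0 := fun K m n hm hn => by
    by_cases hmn : m = n
    · rw [hmn, hdiag]
    obtain ⟨L, l1, l2, l3⟩ : ∃ L : Fin 4, L ≠ m ∧ L ≠ n ∧ L ≠ K := by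
      revert m n K; decide
    simpa [l1, l2, l3, l3.symm, hm.symm, hn.symm] using H K L L m n
  have h2 : ∀ K L n, K ≠ L → n ≠ K → n ≠ L → T K x ![f K, f n] + T L x ![f L, f n] = 0 :=
    fun K L n hKL hnK hnL => by
    have := H K L L K n
    simp only [hKL, hKL.symm, hnK.symm, hnL.symm, if_true, if_false] at this
    linarith
  -- Besides `n` there are three indices `K`, `L`, `N`. Their three components have vanishing
  -- pairwise sums by `h2`, so each is zero.
  have h3 : ∀ K n, n ≠ K → T K x ![f K, f n] = 0 := fun K n hn => by
    obtain ⟨L, N, a1, a2, a3, a4, a5⟩ : ∃ L N : Fin 4, L ≠ K ∧ N ≠ K ∧ L ≠ N ∧ n ≠ L ∧ n ≠ N := by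
      revert n K; decide
    linarith [h2 K L n a1.symm hn a4, h2 K N n a2.symm hn a5, h2 L N n a3 a4 a5]
  refine form_ext_two f fun m n => ?_
  show T K x ![f m, f n] = 0
  by_cases hm : m = K
  · subst hm
    by_cases hn : n = m
    · rw [hn, hdiag]
    · exact h3 m n hn
  · by_cases hn : n = K
    · subst hn
      rw [two_form_swap, h3 n m hm, neg_zero]
    · exact h1 K m n hm hn

end Torsion

/-! ### First variation and field equations. -/

section FieldEquations

variable {M : Type*} [TopologicalSpace M] [ChartedSpace (Model 4) M]

theorem sum_pairs_comm {A : Type*} [AddCommMonoid A] (F : Fin 4 → Fin 4 → Fin 4 → Fin 4 → A) :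
    ∑ I, ∑ J, ∑ K, ∑ L, F I J K L = ∑ K, ∑ L, ∑ I, ∑ J, F I J K L := by
  calc _ = ∑ I, ∑ K, ∑ J, ∑ L, F I J K L := Finset.sum_congr rfl fun I _ => Finset.sum_comm
    _ = ∑ K, ∑ I, ∑ J, ∑ L, F I J K L := Finset.sum_comm
    _ = ∑ K, ∑ I, ∑ L, ∑ J, F I J K L :=
      Finset.sum_congr rfl fun K _ => Finset.sum_congr rfl fun I _ => Finset.sum_comm
    _ = _ := Finset.sum_congr rfl fun K _ => Finset.sum_comm

/-- The polarization `ε_{IJKL} a^I ∧ b^J ∧ dw^{KL}` of the Lagrangian. -/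
def polarLagrangian (a b : Tetrad 4 M) (w : Conn 4 M) : DForm 4 4 M :=
  ∑ I, ∑ J, ∑ K, ∑ L, eps I J K L • wedge (a I) (wedge (b J) (d (w K L)))

variable {a a' b b' : Tetrad 4 M} {w w' : Conn 4 M}

theorem polarLagrangian_add_left :
    polarLagrangian (a + a') b w = polarLagrangian a b w + polarLagrangian a' b w := by
  simp only [polarLagrangian, Pi.add_apply, wedge_add_left, smul_add, Finset.sum_add_distrib]

theorem polarLagrangian_smul_left (c : ℝ) :
    polarLagrangian (c • a) b w = c • polarLagrangian a b w := by
  have : ∀ I, (c • a) I = c • a I := fun _ => rfl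
  simp only [polarLagrangian, this, wedge_smul_left, Finset.smul_sum, smul_comm c]

/-- The sign from exchanging indices of the symbol cancels the sign from exchanging the one-forms.
-/
theorem polarLagrangian_comm : polarLagrangian a b w = polarLagrangian b a w := by
  rw [polarLagrangian, Finset.sum_comm]
  refine Finset.sum_congr rfl fun I _ => Finset.sum_congr rfl fun J _ =>
    Finset.sum_congr rfl fun K _ => Finset.sum_congr rfl fun L _ => ?_
  rw [eps_swap_first, wedge_anticomm, neg_smul, smul_neg, neg_neg]

theorem polarLagrangian_add_right (hw : ∀ K L, IsSmooth (w K L)) (hw' : ∀ K L, IsSmooth (w' K L)) :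
    polarLagrangian a b (w + w') = polarLagrangian a b w + polarLagrangian a b w' := by
  have : ∀ K L, d ((w + w') K L) = d (w K L) + d (w' K L) := fun K L => d_add (hw K L) (hw' K L)
  simp only [polarLagrangian, this, wedge_add_right, smul_add, Finset.sum_add_distrib]

theorem polarLagrangian_smul_right (c : ℝ) :
    polarLagrangian a b (c • w) = c • polarLagrangian a b w := by
  have : ∀ K L, d ((c • w) K L) = c • d (w K L) := fun K L => d_smul c (w K L)
  simp only [polarLagrangian, this, wedge_smul_right, Finset.smul_sum, smul_comm c]

theorem lagrangian_variation {e δe : Tetrad 4 M} {w δw : Conn 4 M}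
    (hw : ∀ K L, IsSmooth (w K L)) (hδ : ∀ K L, IsSmooth (δw K L)) (t : ℝ) :
    lagrangian (e + t • δe) (w + t • δw) - lagrangian e w =
      t • ((2 : ℝ) • polarLagrangian δe e w + polarLagrangian e e δw) +
      (t ^ 2 • (polarLagrangian δe δe w + (2 : ℝ) • polarLagrangian δe e δw) +
        t ^ 3 • polarLagrangian δe δe δw) := by
  have hl : ∀ (a : Tetrad 4 M) (v : Conn 4 M), lagrangian a v = polarLagrangian a a v :=
    fun _ _ => rfl
  have hexp : ∀ v, polarLagrangian (e + t • δe) (e + t • δe) v = polarLagrangian e e v +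
      (2 * t) • polarLagrangian δe e v + t ^ 2 • polarLagrangian δe δe v := fun v => by
    rw [polarLagrangian_add_left, polarLagrangian_smul_left, polarLagrangian_comm,
      polarLagrangian_comm (a := δe), polarLagrangian_add_left, polarLagrangian_add_left,
      polarLagrangian_smul_left, polarLagrangian_smul_left, polarLagrangian_comm (a := e) (b := δe)]
    module
  rw [hl, hl, polarLagrangian_add_right (w' := t • δw) hw fun K L => (hδ K L).smul t, polarLagrangian_smul_right,
    hexp, hexp]
  module

variable [IsManifold (𝓡 4) ∞ M]

theorem isSmooth_polarLagrangian (ha : ∀ I, IsSmooth (a I)) (hb : ∀ I, IsSmooth (b I))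
    (hw : ∀ K L, IsSmooth (w K L)) : IsSmooth (polarLagrangian a b w) :=
  IsSmooth.sum fun I _ => IsSmooth.sum fun J _ => IsSmooth.sum fun K _ => IsSmooth.sum fun L _ =>
    ((ha I).wedge ((hb J).wedge (hw K L).d)).smul _

theorem hasCompactSupp_polarLagrangian_left (ha : ∀ I, HasCompactSupp (a I)) :
    HasCompactSupp (polarLagrangian a b w) :=
  HasCompactSupp.sum fun I _ => HasCompactSupp.sum fun _ _ => HasCompactSupp.sum fun _ _ =>
    HasCompactSupp.sum fun _ _ => ((ha I).wedge_left _).smul _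

variable [T2Space M]

theorem hasCompactSupp_polarLagrangian_right (hw : ∀ K L, HasCompactSupp (w K L)) :
    HasCompactSupp (polarLagrangian a b w) :=
  HasCompactSupp.sum fun _ _ => HasCompactSupp.sum fun _ _ => HasCompactSupp.sum fun K _ =>
    HasCompactSupp.sum fun L _ => (((hw K L).d.wedge_right _).wedge_right _).smul _

/-- The outer minus sign is that of `E_I ∧ δe^I = -δe^I ∧ E_I`, for a three-form and a one-form. -/
theorem sum_wedge_eulerTetrad (e δe : Tetrad 4 M) (w : Conn 4 M) :
    -∑ I, wedge (δe I) (eulerTetrad e w I) = (2 : ℝ) • polarLagrangian δe e w := by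
  have h : ∀ I, wedge (δe I) (eulerTetrad e w I) =
      (-2 : ℝ) • ∑ J, ∑ K, ∑ L, eps I J K L • wedge (δe I) (wedge (e J) (d (w K L))) := fun I => by
    simp only [eulerTetrad, wedge_smul_right, wedge_sum_right]
  rw [Finset.sum_congr rfl fun I _ => h I, ← Finset.smul_sum, ← neg_smul, neg_neg, polarLagrangian]

/-- Integration by parts before integrating: the Leibniz rule moves `d` from `δw` to `e ∧ e` at the
cost of an exact form. -/
theorem sum_wedge_eulerConn {e : Tetrad 4 M} {δw : Conn 4 M} (he : ∀ I, IsSmooth (e I))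
    (hδ : ∀ K L, IsSmooth (δw K L)) :
    -∑ I, ∑ J, wedge (δw I J) (eulerConn e I J) = polarLagrangian e e δw -
      d (∑ I, ∑ J, ∑ K, ∑ L, eps I J K L • wedge (δw I J) (wedge (e K) (e L))) := by
  have hs : ∀ I J K L, IsSmooth (eps I J K L • wedge (δw I J) (wedge (e K) (e L))) :=
    fun I J K L => ((hδ I J).wedge ((he K).wedge (he L))).smul _
  have hd : d (∑ I, ∑ J, ∑ K, ∑ L, eps I J K L • wedge (δw I J) (wedge (e K) (e L))) =
      ∑ I, ∑ J, ∑ K, ∑ L, eps I J K L •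
        (wedge (e K) (wedge (e L) (d (δw I J))) - wedge (δw I J) (d (wedge (e K) (e L)))) := by
    rw [d_sum fun I _ => IsSmooth.sum fun J _ => IsSmooth.sum fun K _ => IsSmooth.sum fun L _ =>
      hs I J K L]
    refine Finset.sum_congr rfl fun I _ => ?_
    rw [d_sum fun J _ => IsSmooth.sum fun K _ => IsSmooth.sum fun L _ => hs I J K L]
    refine Finset.sum_congr rfl fun J _ => ?_
    rw [d_sum fun K _ => IsSmooth.sum fun L _ => hs I J K L]
    refine Finset.sum_congr rfl fun K _ => ?_
    rw [d_sum fun L _ => hs I J K L]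
    refine Finset.sum_congr rfl fun L _ => ?_
    rw [d_smul, d_wedge_two (hδ I J) (he K) (he L)]
  have hp : polarLagrangian e e δw =
      ∑ I, ∑ J, ∑ K, ∑ L, eps I J K L • wedge (e K) (wedge (e L) (d (δw I J))) := by
    rw [polarLagrangian, sum_pairs_comm]
    refine Finset.sum_congr rfl fun I _ => Finset.sum_congr rfl fun J _ =>
      Finset.sum_congr rfl fun K _ => Finset.sum_congr rfl fun L _ => ?_
    rw [eps_pairs]
  rw [hd, hp]
  simp only [eulerConn, wedge_neg_right, wedge_sum_right, wedge_smul_right, smul_sub,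
    Finset.sum_sub_distrib, Finset.sum_neg_distrib, neg_neg, sub_sub_cancel]

variable [SigmaCompactSpace M] {o : DForm 4 4 M}

/-- The first variation of the action. -/
theorem hasDerivAt_actionChange (ho : IsVolumeForm o) {e δe : Tetrad 4 M} {w δw : Conn 4 M}
    (hf : IsField e w) (hv : IsVariation δe δw) :
    HasDerivAt (fun t : ℝ => actionChange o e w (t • δe) (t • δw))
      (intForm o (-(∑ I, wedge (δe I) (eulerTetrad e w I))
        - ∑ I, ∑ J, wedge (δw I J) (eulerConn e I J))) 0 := by
  obtain ⟨he, -, hw, -⟩ := hf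
  obtain ⟨hδe, hce, hδw, hcw, -⟩ := hv
  have s1 : IsSmooth ((2 : ℝ) • polarLagrangian δe e w + polarLagrangian e e δw) :=
    ((isSmooth_polarLagrangian hδe he hw).smul _).add (isSmooth_polarLagrangian he he hδw)
  have c1 : HasCompactSupp ((2 : ℝ) • polarLagrangian δe e w + polarLagrangian e e δw) :=
    ((hasCompactSupp_polarLagrangian_left hce).smul _).add
      (hasCompactSupp_polarLagrangian_right hcw)
  have s2 : IsSmooth (polarLagrangian δe δe w + (2 : ℝ) • polarLagrangian δe e δw) :=
    (isSmooth_polarLagrangian hδe hδe hw).add ((isSmooth_polarLagrangian hδe he hδw).smul _)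
  have c2 : HasCompactSupp (polarLagrangian δe δe w + (2 : ℝ) • polarLagrangian δe e δw) :=
    (hasCompactSupp_polarLagrangian_left hce).add
      ((hasCompactSupp_polarLagrangian_left hce).smul _)
  have s3 : IsSmooth (polarLagrangian δe δe δw) := isSmooth_polarLagrangian hδe hδe hδw
  have c3 : HasCompactSupp (polarLagrangian δe δe δw) := hasCompactSupp_polarLagrangian_left hce
  -- The action change is an exact cubic polynomial in `t`, so no differentiation under the integral
  -- is needed.
  have hpoly : ∀ t : ℝ, actionChange o e w (t • δe) (t • δw) =
      t * intForm o ((2 : ℝ) • polarLagrangian δe e w + polarLagrangian e e δw) +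
      (t ^ 2 * intForm o (polarLagrangian δe δe w + (2 : ℝ) • polarLagrangian δe e δw) +
      t ^ 3 * intForm o (polarLagrangian δe δe δw)) := fun t => by
    rw [actionChange, lagrangian_variation hw hδw,
      intForm_add ho (s1.smul _) ((s2.smul _).add (s3.smul _)) (c1.smul _)
        ((c2.smul _).add (c3.smul _)),
      intForm_add ho (s2.smul _) (s3.smul _) (c2.smul _) (c3.smul _),
      intForm_smul, intForm_smul, intForm_smul]
  have hlin : intForm o (-(∑ I, wedge (δe I) (eulerTetrad e w I))
        - ∑ I, ∑ J, wedge (δw I J) (eulerConn e I J)) =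
      intForm o ((2 : ℝ) • polarLagrangian δe e w + polarLagrangian e e δw) := by
    have hsb : IsSmooth (∑ I, ∑ J, ∑ K, ∑ L, eps I J K L • wedge (δw I J) (wedge (e K) (e L))) :=
      IsSmooth.sum fun I _ => IsSmooth.sum fun J _ => IsSmooth.sum fun K _ => IsSmooth.sum fun L _ =>
        ((hδw I J).wedge ((he K).wedge (he L))).smul _
    have hcb : HasCompactSupp
        (∑ I, ∑ J, ∑ K, ∑ L, eps I J K L • wedge (δw I J) (wedge (e K) (e L))) :=
      HasCompactSupp.sum fun I _ => HasCompactSupp.sum fun J _ => HasCompactSupp.sum fun K _ =>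
        HasCompactSupp.sum fun L _ => ((hcw I J).wedge_left _).smul _
    have h : -(∑ I, wedge (δe I) (eulerTetrad e w I))
        - ∑ I, ∑ J, wedge (δw I J) (eulerConn e I J) =
        ((2 : ℝ) • polarLagrangian δe e w + polarLagrangian e e δw) + (-1 : ℝ) •
          d (∑ I, ∑ J, ∑ K, ∑ L, eps I J K L • wedge (δw I J) (wedge (e K) (e L))) := by
      rw [sub_eq_add_neg, sum_wedge_eulerTetrad, sum_wedge_eulerConn he hδw]
      module
    rw [h, intForm_add ho s1 (hsb.d.smul _) c1 (hcb.d.smul _), intForm_smul,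
      intForm_d (m := 3) ho hsb hcb, mul_zero, add_zero]
  rw [hlin, show (fun t : ℝ => actionChange o e w (t • δe) (t • δw)) = _ from funext hpoly]
  have h := ((hasDerivAt_id (0 : ℝ)).mul_const
      (intForm o ((2 : ℝ) • polarLagrangian δe e w + polarLagrangian e e δw))).add
    (((hasDerivAt_pow 2 (0 : ℝ)).mul_const
      (intForm o (polarLagrangian δe δe w + (2 : ℝ) • polarLagrangian δe e δw))).add
    ((hasDerivAt_pow 3 (0 : ℝ)).mul_const (intForm o (polarLagrangian δe δe δw))))
  refine h.congr_deriv ?_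
  norm_num

theorem eulerConn_antisymm (e : Tetrad 4 M) (I J : Fin 4) :
    eulerConn e I J = -eulerConn e J I := by
  rw [eulerConn, eulerConn, neg_neg, ← Finset.sum_neg_distrib]
  refine Finset.sum_congr rfl fun K _ => ?_
  rw [← Finset.sum_neg_distrib]
  refine Finset.sum_congr rfl fun L _ => ?_
  rw [eps_swap_first, neg_smul, neg_neg]

theorem hasCompactSupp_fmul {k : ℕ} {f : M → ℝ} (hf : ∃ K, IsCompact K ∧ ∀ x, x ∉ K → f x = 0)
    (θ : DForm 4 k M) : HasCompactSupp (fmul f θ) := by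
  obtain ⟨K, hK, h⟩ := hf
  exact ⟨K, hK, fun x hx => by rw [fmul, h x hx, zero_smul]⟩

theorem isSmooth_eulerTetrad {e : Tetrad 4 M} {w : Conn 4 M} (he : ∀ I, IsSmooth (e I))
    (hw : ∀ K L, IsSmooth (w K L)) (I : Fin 4) : IsSmooth (eulerTetrad e w I) :=
  (IsSmooth.sum fun J _ => IsSmooth.sum fun K _ => IsSmooth.sum fun L _ =>
    ((he J).wedge (hw K L).d).smul _).smul _

theorem isSmooth_eulerConn {e : Tetrad 4 M} (he : ∀ I, IsSmooth (e I)) (I J : Fin 4) :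
    IsSmooth (eulerConn e I J) :=
  (IsSmooth.sum fun K _ => IsSmooth.sum fun L _ => ((he K).wedge (he L)).d.smul _).neg

theorem hasCompactSupp_zero {k : ℕ} : HasCompactSupp (0 : DForm 4 k M) :=
  ⟨∅, isCompact_empty, fun _ _ => rfl⟩

/-- Varying only the `I`-th tetrad form, by `f e^J` with arbitrary `f`, isolates the top form `e^J ∧
E_I`; its vanishing for every `J` gives `E_I = 0`. -/
theorem eulerTetrad_eq_zero (ho : IsVolumeForm o) {e : Tetrad 4 M} {w : Conn 4 M}
    (hf : IsField e w) (hs : IsStationary o e w) : eulerTetrad e w = 0 := by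
  funext I
  refine eq_zero_of_wedge_three hf.nondegenerate fun J => eq_zero_of_intForm_fmul ho
    ((hf.smooth_tetrad J).wedge (isSmooth_eulerTetrad hf.smooth_tetrad hf.smooth_conn I))
    fun f hsf hcf => ?_
  have hv : IsVariation (fun A => if A = I then fmul f (e J) else 0) (0 : Conn 4 M) := by
    refine ⟨fun A => ?_, fun A => ?_, fun _ _ => isSmooth_zero, fun _ _ => hasCompactSupp_zero,
      fun _ _ => neg_zero.symm⟩
    · by_cases hA : A = I
      · simpa only [if_pos hA] using (hf.smooth_tetrad J).fmul hsf
      · simpa only [if_neg hA] using isSmooth_zero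
    · by_cases hA : A = I
      · simpa only [if_pos hA] using hasCompactSupp_fmul hcf _
      · simpa only [if_neg hA] using hasCompactSupp_zero
  have h := (hasDerivAt_actionChange ho hf hv).unique (hs _ _ hv)
  have hz : ∑ A, ∑ B, wedge ((0 : Conn 4 M) A B) (eulerConn e A B) = 0 :=
    Finset.sum_eq_zero fun A _ => Finset.sum_eq_zero fun B _ => wedge_zero_left _
  have he : -(∑ A, wedge (if A = I then fmul f (e J) else 0) (eulerTetrad e w A))
      - ∑ A, ∑ B, wedge ((0 : Conn 4 M) A B) (eulerConn e A B) =
      (-1 : ℝ) • fmul f (wedge (e J) (eulerTetrad e w I)) := by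
    rw [Finset.sum_eq_single I (fun A _ hA => by rw [if_neg hA, wedge_zero_left]) (by simp),
      if_pos rfl, hz, wedge_fmul_left, sub_zero, neg_one_smul]
  rw [he, intForm_smul] at h
  linarith

theorem eulerConn_eq_zero (ho : IsVolumeForm o) {e : Tetrad 4 M} {w : Conn 4 M}
    (hf : IsField e w) (hs : IsStationary o e w) : eulerConn e = 0 := by
  funext I J
  refine eq_zero_of_wedge_three hf.nondegenerate fun K => eq_zero_of_intForm_fmul ho
    ((hf.smooth_tetrad K).wedge (isSmooth_eulerConn hf.smooth_tetrad I J)) fun f hsf hcf => ?_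
  -- Admissible variations are antisymmetric, so the elementary matrix is antisymmetrized.
  -- Antisymmetry of `E_{IJ}` then makes both terms agree, which yields the factor `-2`.
  let c : Fin 4 → Fin 4 → ℝ := fun A B =>
    (if A = I then if B = J then 1 else 0 else 0) - if B = I then if A = J then 1 else 0 else 0
  have hv : IsVariation (0 : Tetrad 4 M) (fun A B => c A B • fmul f (e K)) :=
    ⟨fun _ => isSmooth_zero, fun _ => hasCompactSupp_zero,
      fun A B => ((hf.smooth_tetrad K).fmul hsf).smul _,
      fun A B => (hasCompactSupp_fmul hcf _).smul _,
      fun A B => by rw [← neg_smul, neg_sub]⟩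
  have h := (hasDerivAt_actionChange ho hf hv).unique (hs _ _ hv)
  have hz : ∑ A, wedge ((0 : Tetrad 4 M) A) (eulerTetrad e w A) = 0 :=
    Finset.sum_eq_zero fun A _ => wedge_zero_left _
  have he : -(∑ A, wedge ((0 : Tetrad 4 M) A) (eulerTetrad e w A))
      - ∑ A, ∑ B, wedge (c A B • fmul f (e K)) (eulerConn e A B) =
      (-2 : ℝ) • fmul f (wedge (e K) (eulerConn e I J)) := by
    rw [hz]
    simp only [wedge_smul_left]
    simp only [c, sub_smul, ite_smul, one_smul, zero_smul, Finset.sum_sub_distrib]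
    rw [Finset.sum_comm (f := fun A B => if B = I then if A = J then
      wedge (fmul f (e K)) (eulerConn e A B) else 0 else 0)]
    simp only [Finset.sum_ite_irrel, Finset.sum_const_zero, Finset.sum_ite_eq', Finset.mem_univ,
      if_true]
    rw [eulerConn_antisymm e J I, wedge_neg_right, wedge_fmul_left]
    module
  rw [he, intForm_smul] at h
  linarith

theorem eulerTetrad_eq_zero_iff {e : Tetrad 4 M} {w : Conn 4 M} : eulerTetrad e w = 0 ↔
    ∀ I, ∑ J, ∑ K, ∑ L, eps I J K L • wedge (e J) (d (w K L)) = 0 := by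
  rw [funext_iff]
  refine forall_congr' fun I => ?_
  constructor
  · intro h
    have h2 := congrArg (fun θ => (-(1 / 2) : ℝ) • θ) h
    simp only [eulerTetrad, smul_smul] at h2
    norm_num at h2
    exact h2
  · intro h
    rw [eulerTetrad, h, smul_zero]
    rfl

/-- The dual merely permutes the six independent components up to sign. -/
theorem eq_zero_of_star {b : Fin 4 → Fin 4 → ℝ} (hb : ∀ m n, b m n = -b n m)
    (h : ∀ I J, star b I J = 0) (K L : Fin 4) : b K L = 0 := by
  have h0 : ∀ m, b m m = 0 := fun m => by linarith [hb m m]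
  have s01 : b 2 3 = 0 := h 0 1
  have s20 : b 1 3 = 0 := h 2 0
  have s03 : b 1 2 = 0 := h 0 3
  have s12 : b 0 3 = 0 := h 1 2
  have s31 : b 0 2 = 0 := h 3 1
  have s23 : b 0 1 = 0 := h 2 3
  fin_cases K <;> fin_cases L <;>
    first | exact h0 _ | assumption | exact (hb _ _).trans (neg_eq_zero.2 (by assumption))

theorem d_wedge_eq_zero_of_eulerConn {e : Tetrad 4 M} (h : eulerConn e = 0) (K L : Fin 4) :
    d (wedge (e K) (e L)) = 0 := by
  funext x
  ext v
  have hb : ∀ m n, d (wedge (e m) (e n)) x v = -d (wedge (e n) (e m)) x v := fun m n => by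
    rw [wedge_comm, d_neg]
    rfl
  refine eq_zero_of_star hb (fun I J => ?_) K L
  have h2 : eulerConn e I J x v = 0 := by rw [h]; rfl
  have h3 : -∑ K, ∑ L, eps I J K L * d (wedge (e K) (e L)) x v = 0 := by
    simpa only [eulerConn, Pi.neg_apply, ContinuousAlternatingMap.neg_apply, Finset.sum_apply,
      ContinuousAlternatingMap.sum_apply, Pi.smul_apply, ContinuousAlternatingMap.smul_apply,
      smul_eq_mul] using h2
  rw [sum_eps_eq_star hb] at h3
  linarith

/-- Vanishing of the torsion. -/
theorem eulerConn_eq_zero_iff {e : Tetrad 4 M} (hs : ∀ I, IsSmooth (e I)) (he : Nondegenerate e) :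
    eulerConn e = 0 ↔ ∀ I, d (e I) = 0 := by
  constructor
  · intro h
    -- By the Leibniz rule, `d(e^K ∧ e^L) = 0` is the hypothesis of `eq_zero_of_wedge_two` for `T^K
    -- = de^K`.
    refine eq_zero_of_wedge_two he fun K L => ?_
    have := d_wedge_one (hs K) (hs L)
    rw [d_wedge_eq_zero_of_eulerConn h] at this
    exact sub_eq_zero.1 this.symm
  · intro h
    funext I J
    have : ∀ K L, d (wedge (e K) (e L)) = 0 := fun K L => by
      rw [d_wedge_one (hs K) (hs L), h, h, wedge_zero_right, wedge_zero_right, sub_zero]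
    simp only [eulerConn, this, smul_zero, Finset.sum_const_zero, neg_zero]
    rfl

theorem isStationary_iff (ho : IsVolumeForm o) {e : Tetrad 4 M} {w : Conn 4 M}
    (hf : IsField e w) : IsStationary o e w ↔ eulerTetrad e w = 0 ∧ eulerConn e = 0 := by
  refine ⟨fun h => ⟨eulerTetrad_eq_zero ho hf h, eulerConn_eq_zero ho hf h⟩, fun h δe δw hv => ?_⟩
  have hd := hasDerivAt_actionChange ho hf hv
  have h0 : -(∑ I, wedge (δe I) (eulerTetrad e w I))
        - ∑ I, ∑ J, wedge (δw I J) (eulerConn e I J) = 0 := by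
    have h1 : ∑ I, wedge (δe I) (eulerTetrad e w I) = 0 := Finset.sum_eq_zero fun I _ => by
      rw [h.1]
      exact wedge_zero_right _
    have h2 : ∑ I, ∑ J, wedge (δw I J) (eulerConn e I J) = 0 :=
      Finset.sum_eq_zero fun I _ => Finset.sum_eq_zero fun J _ => by
        rw [h.2]
        exact wedge_zero_right _
    rw [h1, h2, neg_zero, sub_zero]
  rwa [h0, intForm_zero] at hd

theorem isStationary_iff_reducedEqs (ho : IsVolumeForm o) {e : Tetrad 4 M} {w : Conn 4 M}
    (hf : IsField e w) : IsStationary o e w ↔ ReducedEqs e w := by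
  rw [isStationary_iff ho hf, eulerTetrad_eq_zero_iff,
    eulerConn_eq_zero_iff hf.smooth_tetrad hf.nondegenerate, ReducedEqs, and_comm]

end FieldEquations

/-! ### Closed forms modulo exact forms. -/

section DeRhamRepresentatives

variable {n k r : ℕ} {M : Type*} [TopologicalSpace M] [ChartedSpace (Model n) M]
  {φ : Fin r → closedForms n (k + 1) M}

theorem exists_exact_add_sum (hφ : RepresentsBasis φ) {θ : DForm n (k + 1) M} (hθ : IsSmooth θ)
    (hd : d θ = 0) : ∃ (β : DForm n k M) (c : Fin r → ℝ), IsSmooth β ∧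
      θ = d β + ∑ i, c i • (φ i : DForm n (k + 1) M) := by
  let θ' : closedForms n (k + 1) M := ⟨θ, hθ, hd⟩
  have hmem : deRhamClass θ' ∈ Submodule.span ℝ (Set.range fun i => deRhamClass (φ i)) := by
    rw [hφ.2]
    exact Submodule.mem_top
  obtain ⟨c, hc⟩ := (Submodule.mem_span_range_iff_exists_fun ℝ).1 hmem
  have h2 : deRhamClass θ' = deRhamClass (∑ i, c i • φ i) := by
    rw [← hc]
    exact (map_sum (Submodule.mkQ _) (fun i => c i • φ i) Finset.univ).symm
  obtain ⟨β, hβ, h3⟩ := (Submodule.Quotient.eq _).1 h2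
  refine ⟨β, c, hβ, ?_⟩
  have h4 : d β = θ - ∑ i, c i • (φ i : DForm n (k + 1) M) := by
    rw [h3]
    simp [θ']
  rw [h4, sub_add_cancel]

/-- Linear independence of the classes fixes the coefficients. Only `dβ` is then determined, as `β`
may change by a closed form. -/
theorem exact_add_sum_unique (hφ : RepresentsBasis φ) {β β' : DForm n k M} (hβ : IsSmooth β)
    (hβ' : IsSmooth β') {c c' : Fin r → ℝ}
    (h : d β + ∑ i, c i • (φ i : DForm n (k + 1) M) =
      d β' + ∑ i, c' i • (φ i : DForm n (k + 1) M)) : c = c' ∧ d β = d β' := by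
  have hc : c = c' := by
    have h0 : ∑ i, (c i - c' i) • deRhamClass (φ i) = 0 := by
      have h1 : ∑ i, (c i - c' i) • deRhamClass (φ i) = deRhamClass (∑ i, (c i - c' i) • φ i) :=
        (map_sum (Submodule.mkQ _) (fun i => (c i - c' i) • φ i) Finset.univ).symm
      rw [h1]
      refine (Submodule.Quotient.mk_eq_zero _).2 ⟨(-1 : ℝ) • (β - β'), (hβ.sub hβ').smul _, ?_⟩
      rw [d_smul, d_sub hβ hβ']
      have h2 : d β - d β' = ∑ i, c' i • (φ i : DForm n (k + 1) M) -
          ∑ i, c i • (φ i : DForm n (k + 1) M) := by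
        rw [sub_eq_sub_iff_add_eq_add, h]
        exact add_comm _ _
      rw [h2]
      simp [sub_smul]
    funext i
    exact sub_eq_zero.1 (Fintype.linearIndependent_iff.1 hφ.1 _ h0 i)
  refine ⟨hc, ?_⟩
  rw [hc] at h
  exact add_right_cancel h

variable [IsManifold (𝓡 n) ∞ M]

theorem isSmooth_exact_add_sum {β : DForm n k M} (hβ : IsSmooth β) (c : Fin r → ℝ) :
    IsSmooth (d β + ∑ i, c i • (φ i : DForm n (k + 1) M)) :=
  hβ.d.add (IsSmooth.sum fun i _ => (φ i).2.1.smul _)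

theorem d_exact_add_sum {β : DForm n k M} (hβ : IsSmooth β) (c : Fin r → ℝ) :
    d (d β + ∑ i, c i • (φ i : DForm n (k + 1) M)) = 0 := by
  rw [d_add hβ.d (IsSmooth.sum fun i _ => (φ i).2.1.smul _), d_d hβ,
    d_sum fun i _ => (φ i).2.1.smul _, zero_add]
  refine Finset.sum_eq_zero fun i _ => ?_
  rw [d_smul, (φ i).2.2, smul_zero]

end DeRhamRepresentatives

/-! ### Bilinearity of the map to `B`. -/

section EpsWedge

variable {M : Type*}

theorem epsWedge_add_left (e e' : Tetrad 4 M) (w : Conn 4 M) :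
    epsWedge (e + e') w = epsWedge e w + epsWedge e' w := by
  funext I
  simp only [epsWedge, Pi.add_apply, wedge_add_left, smul_add, Finset.sum_add_distrib]

theorem epsWedge_smul_left (c : ℝ) (e : Tetrad 4 M) (w : Conn 4 M) :
    epsWedge (c • e) w = c • epsWedge e w := by
  funext I
  have : ∀ I, (c • e) I = c • e I := fun _ => rfl
  show epsWedge (c • e) w I = c • epsWedge e w I
  simp only [epsWedge, this, wedge_smul_left, Finset.smul_sum, smul_comm c]

theorem epsWedge_add_right (e : Tetrad 4 M) (w w' : Conn 4 M) :
    epsWedge e (w + w') = epsWedge e w + epsWedge e w' := by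
  funext I
  simp only [epsWedge, Pi.add_apply, wedge_add_right, smul_add, Finset.sum_add_distrib]

theorem epsWedge_smul_right (c : ℝ) (e : Tetrad 4 M) (w : Conn 4 M) :
    epsWedge e (c • w) = c • epsWedge e w := by
  funext I
  have : ∀ K L, (c • w) K L = c • w K L := fun _ _ => rfl
  show epsWedge e (c • w) I = c • epsWedge e w I
  simp only [epsWedge, this, wedge_smul_right, Finset.smul_sum, smul_comm c]

end EpsWedge

/-! ### The general solution. -/

section GeneralSolution

variable {M : Type*} [TopologicalSpace M] [ChartedSpace (Model 4) M]
  {n₁ n₂ : ℕ} {φ₁ : Fin n₁ → closedForms 4 1 M} {φ₂ : Fin n₂ → closedForms 4 2 M}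
  {e : Tetrad 4 M} {w : Conn 4 M}

section

variable [IsManifold (𝓡 4) ∞ M]

theorem isSmooth_epsWedge (he : ∀ I, IsSmooth (e I)) (hw : ∀ K L, IsSmooth (w K L)) (I : Fin 4) :
    IsSmooth (epsWedge e w I) :=
  IsSmooth.sum fun J _ => IsSmooth.sum fun K _ => IsSmooth.sum fun L _ =>
    ((he J).wedge (hw K L)).smul _

theorem d_epsWedge (he : ∀ I, IsSmooth (e I)) (hw : ∀ K L, IsSmooth (w K L)) (I : Fin 4) :
    d (epsWedge e w I) = ∑ J, ∑ K, ∑ L, eps I J K L • wedge (w K L) (d (e J)) -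
      ∑ J, ∑ K, ∑ L, eps I J K L • wedge (e J) (d (w K L)) := by
  have hs : ∀ J K L, IsSmooth (eps I J K L • wedge (e J) (w K L)) :=
    fun J K L => ((he J).wedge (hw K L)).smul _
  simp only [← Finset.sum_sub_distrib, ← smul_sub]
  rw [epsWedge, d_sum fun J _ => IsSmooth.sum fun K _ => IsSmooth.sum fun L _ => hs J K L]
  refine Finset.sum_congr rfl fun J _ => ?_
  rw [d_sum fun K _ => IsSmooth.sum fun L _ => hs J K L]
  refine Finset.sum_congr rfl fun K _ => ?_
  rw [d_sum fun L _ => hs J K L]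
  refine Finset.sum_congr rfl fun L _ => ?_
  rw [d_smul, d_wedge_one (he J) (hw K L)]

/-- For a closed tetrad, the field equation on `w` becomes closedness of the two-forms `B_I`; this
linearizes the problem into cohomology. -/
theorem d_epsWedge_of_closed (he : ∀ I, IsSmooth (e I)) (hd : ∀ I, d (e I) = 0)
    (hw : ∀ K L, IsSmooth (w K L)) (I : Fin 4) :
    d (epsWedge e w I) = -∑ J, ∑ K, ∑ L, eps I J K L • wedge (e J) (d (w K L)) := by
  have hz : ∑ J, ∑ K, ∑ L, eps I J K L • wedge (w K L) (d (e J)) = 0 :=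
    Finset.sum_eq_zero fun J _ => Finset.sum_eq_zero fun K _ => Finset.sum_eq_zero fun L _ => by
      rw [hd, wedge_zero_right, smul_zero]
  rw [d_epsWedge he hw, hz, zero_sub]

theorem isVolumeForm_vol (hs : ∀ I, IsSmooth (e I)) (he : Nondegenerate e) :
    IsVolumeForm (vol e) :=
  ⟨(IsSmooth.sum fun I _ => IsSmooth.sum fun J _ => IsSmooth.sum fun K _ => IsSmooth.sum fun L _ =>
    ((hs I).wedge ((hs J).wedge ((hs K).wedge (hs L)))).smul _).smul _, vol_ne_zero he⟩

theorem isSmooth_connOf (hs : ∀ I, IsSmooth (e I)) (he : Nondegenerate e)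
    {B : Fin 4 → DForm 4 2 M} (hB : ∀ I, IsSmooth (B I)) (K L : Fin 4) :
    IsSmooth (connOf e B K L) := by
  have hr : ∀ K L I, SmoothFun 4 (ratio (wedge (e K) (wedge (e L) (B I))) (vol e)) :=
    fun K L I => smoothFun_ratio ((hs K).wedge ((hs L).wedge (hB I))) (isVolumeForm_vol hs he)
  have h : connOf e B K L =
      -(1 / 2 : ℝ) • (∑ I, fmul (ratio (wedge (e K) (wedge (e L) (B I))) (vol e)) (e I))
        - (1 / 2 : ℝ) • ∑ I, (1 / 2 : ℝ) •
          (fmul (ratio (wedge (e I) (wedge (e K) (B I))) (vol e)) (e L)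
            - fmul (ratio (wedge (e I) (wedge (e L) (B I))) (vol e)) (e K)) := by
    funext x
    simp only [connOf, Pi.sub_apply, Pi.smul_apply, Finset.sum_apply, fmul]
  rw [h]
  exact ((IsSmooth.sum fun I _ => (hs I).fmul (hr K L I)).smul _).sub
    ((IsSmooth.sum fun I _ =>
      (((hs L).fmul (hr I K I)).sub ((hs K).fmul (hr I L I))).smul _).smul _)

end

theorem Params.isSmooth_tetrad [IsManifold (𝓡 4) ∞ M] {p : Params M n₁ n₂} (hp : p.Smooth)
    (I : Fin 4) : IsSmooth (p.tetrad φ₁ I) := isSmooth_exact_add_sum (hp.1 I) _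

theorem Params.d_tetrad [IsManifold (𝓡 4) ∞ M] {p : Params M n₁ n₂} (hp : p.Smooth)
    (I : Fin 4) : d (p.tetrad φ₁ I) = 0 := d_exact_add_sum (hp.1 I) _

theorem Params.isSmooth_B [IsManifold (𝓡 4) ∞ M] {p : Params M n₁ n₂} (hp : p.Smooth)
    (I : Fin 4) : IsSmooth (p.B φ₂ I) := isSmooth_exact_add_sum (hp.2 I) _

theorem Params.d_B [IsManifold (𝓡 4) ∞ M] {p : Params M n₁ n₂} (hp : p.Smooth)
    (I : Fin 4) : d (p.B φ₂ I) = 0 := d_exact_add_sum (hp.2 I) _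

theorem exists_params (hφ₁ : RepresentsBasis (k := 0) φ₁) (hφ₂ : RepresentsBasis (k := 1) φ₂)
    {B : Fin 4 → DForm 4 2 M} (he : ∀ I, IsSmooth (e I)) (hde : ∀ I, d (e I) = 0)
    (hB : ∀ I, IsSmooth (B I)) (hdB : ∀ I, d (B I) = 0) :
    ∃ p : Params M n₁ n₂, p.Smooth ∧ e = p.tetrad φ₁ ∧ B = p.B φ₂ := by
  choose h η hh hη using fun I => exists_exact_add_sum hφ₁ (he I) (hde I)
  choose g γ hg hγ using fun I => exists_exact_add_sum hφ₂ (hB I) (hdB I)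
  exact ⟨⟨h, η, g, γ⟩, ⟨hh, hg⟩, funext hη, funext hγ⟩

variable [IsManifold (𝓡 4) ∞ M] [T2Space M] [SigmaCompactSpace M] {o : DForm 4 4 M}

/-- The general solution of the field equations. -/
theorem isSolution_iff (ho : IsVolumeForm o) (hφ₁ : RepresentsBasis (k := 0) φ₁)
    (hφ₂ : RepresentsBasis (k := 1) φ₂) : IsSolution o e w ↔
      ∃ p : Params M n₁ n₂, p.Smooth ∧ e = p.tetrad φ₁ ∧ Nondegenerate e ∧
        w = connOf e (p.B φ₂) := by
  constructor
  · rintro ⟨hf, hst⟩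
    obtain ⟨hde, hdw⟩ := (isStationary_iff_reducedEqs ho hf).1 hst
    obtain ⟨p, hp, h1, h2⟩ := exists_params hφ₁ hφ₂ hf.smooth_tetrad hde
      (isSmooth_epsWedge hf.smooth_tetrad hf.smooth_conn) fun I => by
        rw [d_epsWedge_of_closed hf.smooth_tetrad hde hf.smooth_conn, hdw, neg_zero]
    exact ⟨p, hp, h1, hf.nondegenerate,
      (connOf_iff hf.nondegenerate w _).1 ⟨hf.antisymm, h2⟩⟩
  · rintro ⟨p, hp, he, hn, hw⟩
    have hs : ∀ I, IsSmooth (e I) := fun I => he ▸ Params.isSmooth_tetrad hp I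
    have hde : ∀ I, d (e I) = 0 := fun I => he ▸ Params.d_tetrad hp I
    have hsw : ∀ K L, IsSmooth (w K L) := fun K L =>
      hw ▸ isSmooth_connOf hs hn (Params.isSmooth_B hp) K L
    obtain ⟨ha, hB⟩ := (connOf_iff hn w _).2 hw
    have hf : IsField e w := ⟨hs, hn, hsw, ha⟩
    refine ⟨hf, (isStationary_iff_reducedEqs ho hf).2 ⟨hde, fun I => ?_⟩⟩
    rw [← neg_eq_zero, ← d_epsWedge_of_closed hs hde hsw, hB, Params.d_B hp]

end GeneralSolution

/-! ### Tangent vectors to the solution space. -/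

section TangentSpace

variable {M : Type*} [TopologicalSpace M] [ChartedSpace (Model 4) M] [IsManifold (𝓡 4) ∞ M]
  {n₁ n₂ : ℕ} {φ₁ : Fin n₁ → closedForms 4 1 M} {φ₂ : Fin n₂ → closedForms 4 2 M}
  {e : Tetrad 4 M} {w : Conn 4 M}

theorem isSmooth_varB (hf : IsField e w) {δ : Tetrad 4 M × Conn 4 M} (h1 : ∀ I, IsSmooth (δ.1 I))
    (h2 : ∀ K L, IsSmooth (δ.2 K L)) (I : Fin 4) : IsSmooth (varB e w δ I) :=
  (isSmooth_epsWedge h1 hf.smooth_conn I).add (isSmooth_epsWedge hf.smooth_tetrad h2 I)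

/-- The linearized field equation is closedness of `δB`, just as the full equation is closedness of
`B`. -/
theorem d_varB (hf : IsField e w) (hde : ∀ I, d (e I) = 0) {δ : Tetrad 4 M × Conn 4 M}
    (h1 : ∀ I, IsSmooth (δ.1 I)) (h2 : ∀ K L, IsSmooth (δ.2 K L)) (hd : ∀ I, d (δ.1 I) = 0)
    (I : Fin 4) : d (varB e w δ I) = -∑ J, ∑ K, ∑ L, eps I J K L •
      (wedge (δ.1 J) (d (w K L)) + wedge (e J) (d (δ.2 K L))) := by
  have h : varB e w δ I = epsWedge δ.1 w I + epsWedge e δ.2 I := rfl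
  rw [h, d_add (isSmooth_epsWedge h1 hf.smooth_conn I) (isSmooth_epsWedge hf.smooth_tetrad h2 I),
    d_epsWedge_of_closed h1 hd hf.smooth_conn, d_epsWedge_of_closed hf.smooth_tetrad hde h2]
  simp only [smul_add, Finset.sum_add_distrib, neg_add]

/-- Every tangent vector is given by data `(δh, δη, δg, δγ)`. -/
theorem exists_params_of_mem_tangentSpace (hφ₁ : RepresentsBasis (k := 0) φ₁)
    (hφ₂ : RepresentsBasis (k := 1) φ₂) (hf : IsField e w) (hde : ∀ I, d (e I) = 0)
    {δ : Tetrad 4 M × Conn 4 M} (hδ : δ ∈ tangentSpace e w) :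
    ∃ p : Params M n₁ n₂, p.Smooth ∧ δ.1 = p.tetrad φ₁ ∧ varB e w δ = p.B φ₂ := by
  obtain ⟨h1, h2, -, h4, h5⟩ := hδ
  exact exists_params hφ₁ hφ₂ h1 h4 (isSmooth_varB hf h1 h2) fun I => by
    rw [d_varB hf hde h1 h2 h4, h5, neg_zero]

theorem snd_eq_connOf (hf : IsField e w) {δ : Tetrad 4 M × Conn 4 M} (ha : Antisymm δ.2)
    {B : Fin 4 → DForm 4 2 M} (h : varB e w δ = B) : δ.2 = connOf e (B - epsWedge δ.1 w) :=
  (connOf_iff hf.nondegenerate _ _).1 ⟨ha, by rw [← h, varB, add_sub_cancel_left]⟩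

/-- The data `(δh, δη, δg, δγ)` come from exactly one tangent vector. -/
theorem existsUnique_tangent (hf : IsField e w) (hde : ∀ I, d (e I) = 0) {p : Params M n₁ n₂}
    (hp : p.Smooth) : ∃! δ, δ ∈ tangentSpace e w ∧ δ.1 = p.tetrad φ₁ ∧ varB e w δ = p.B φ₂ := by
  refine ⟨(p.tetrad φ₁, connOf e (p.B φ₂ - epsWedge (p.tetrad φ₁) w)), ⟨?_, rfl, ?_⟩, ?_⟩
  · have h1 := Params.isSmooth_tetrad (φ₁ := φ₁) hp
    have h2 := isSmooth_connOf hf.smooth_tetrad hf.nondegenerate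
      (B := p.B φ₂ - epsWedge (p.tetrad φ₁) w) fun I =>
        (Params.isSmooth_B hp I).sub (isSmooth_epsWedge h1 hf.smooth_conn I)
    obtain ⟨ha, hB⟩ := (connOf_iff hf.nondegenerate _ _).2
      (rfl : connOf e (p.B φ₂ - epsWedge (p.tetrad φ₁) w) = _)
    refine ⟨h1, h2, ha, Params.d_tetrad hp, fun I => ?_⟩
    rw [← neg_eq_zero]
    refine (d_varB (δ := (p.tetrad φ₁, connOf e (p.B φ₂ - epsWedge (p.tetrad φ₁) w))) hf hde h1 h2
      (Params.d_tetrad hp) I).symm.trans ?_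
    rw [varB, hB, add_sub_cancel, Params.d_B hp]
  · obtain ⟨-, hB⟩ := (connOf_iff hf.nondegenerate _ _).2
      (rfl : connOf e (p.B φ₂ - epsWedge (p.tetrad φ₁) w) = _)
    rw [varB, hB, add_sub_cancel]
  · rintro ⟨δe, δw⟩ ⟨hT, rfl, hB⟩
    exact Prod.ext rfl (snd_eq_connOf hf hT.2.2.1 hB)

end TangentSpace

/-! ### Differentiating the formula for the connection. -/

section Derivative

open Filter Topology

variable {M : Type*}

theorem continuous_wedge_apply {n k : ℕ} {x : M} {α : ℝ → DForm n 1 M} {β : ℝ → DForm n k M}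
    (hα : ∀ u, Continuous fun t => α t x u) (hβ : ∀ u, Continuous fun t => β t x u)
    (u : Fin (k + 1) → Model n) : Continuous fun t => wedge (α t) (β t) x u := by
  simp only [wedge_apply]
  exact continuous_finsetSum _ fun i _ => continuous_const.mul ((hα _).mul (hβ _))

theorem continuous_vol_apply {x : M} {a : ℝ → Tetrad 4 M}
    (ha : ∀ I u, Continuous fun t => a t I x u) (u : Fin 4 → Model 4) :
    Continuous fun t => vol (a t) x u := by
  simp only [vol, Pi.smul_apply, Finset.sum_apply, ContinuousAlternatingMap.smul_apply,
    ContinuousAlternatingMap.sum_apply, smul_eq_mul]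
  exact continuous_const.mul (continuous_finsetSum _ fun I _ => continuous_finsetSum _ fun J _ =>
    continuous_finsetSum _ fun K _ => continuous_finsetSum _ fun L _ => continuous_const.mul
      (continuous_wedge_apply (ha I) (continuous_wedge_apply (ha J)
        (continuous_wedge_apply (ha K) (ha L))) u))

theorem continuousAt_connOf_apply {x : M} {a : ℝ → Tetrad 4 M} {t : ℝ}
    (ha : ∀ I u, Continuous fun t => a t I x u) (h : Nondegenerate (a t))
    (C : Fin 4 → DForm 4 2 M) (K L : Fin 4) (u : Fin 1 → Model 4) :
    ContinuousAt (fun t => connOf (a t) C K L x u) t := by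
  have hr : ∀ K L I, ContinuousAt
      (fun t => ratio (wedge (a t K) (wedge (a t L) (C I))) (vol (a t)) x) t := fun K L I =>
    (continuous_wedge_apply (ha K) (continuous_wedge_apply (ha L) fun _ => continuous_const)
      _).continuousAt.div (continuous_vol_apply ha _).continuousAt
        (top_form_ne_zero (vol_ne_zero h x))
  simp only [connOf, ContinuousAlternatingMap.sub_apply, ContinuousAlternatingMap.smul_apply,
    ContinuousAlternatingMap.sum_apply, smul_eq_mul]
  refine (continuousAt_const.mul (tendsto_finsetSum _ fun I _ =>
    (hr K L I).mul (ha I u).continuousAt)).sub (continuousAt_const.mul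
    (tendsto_finsetSum _ fun I _ => continuousAt_const.mul (((hr I K I).mul
      (ha L u).continuousAt).sub ((hr I L I).mul (ha K u).continuousAt))))

theorem hasDerivAt_of_eventually_eq_quadratic {F g : ℝ → ℝ} {a b : ℝ} (hg : ContinuousAt g 0)
    (h : ∀ᶠ t in 𝓝 0, F t = a + t * b - t ^ 2 * g t) : HasDerivAt F b 0 := by
  have h1 : HasDerivAt (fun t : ℝ => t * (t * g t)) 0 0 := by
    rw [hasDerivAt_iff_tendsto_slope]
    have h2 : Tendsto (fun t : ℝ => t * g t) (𝓝[≠] 0) (𝓝 0) := by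
      have : Tendsto (fun t : ℝ => t * g t) (𝓝 0) (𝓝 (0 * g 0)) := (continuousAt_id.mul hg).tendsto
      rw [zero_mul] at this
      exact this.mono_left nhdsWithin_le_nhds
    refine h2.congr' ?_
    filter_upwards [self_mem_nhdsWithin] with t ht
    have ht' : t ≠ 0 := ht
    rw [slope_def_field]
    field_simp
    ring
  have h3 := (((hasDerivAt_id (0 : ℝ)).mul_const b).const_add a).sub h1
  refine (h3.congr_deriv (by ring)).congr_of_eventuallyEq ?_
  filter_upwards [h] with t ht
  rw [ht]
  show _ = a + t * b - t * (t * g t)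
  ring

/-- Linear independence is an open condition. Only the fixed point `x` is considered, since no
uniformity over the manifold is available or needed. -/
theorem eventually_linearIndependent {x : M} {e a : Tetrad 4 M} (he : Nondegenerate e) :
    ∀ᶠ t : ℝ in 𝓝 0, LinearIndependent ℝ fun I => (e + t • a) I x := by
  have hc : Continuous fun (t : ℝ) (I : Fin 4) => (e + t • a) I x := by
    refine continuous_pi fun I => ?_
    show Continuous fun t : ℝ => e I x + t • a I x
    fun_prop
  refine (isOpen_setOfPred_linearIndependent.preimage hc).mem_nhds ?_
  show LinearIndependent ℝ fun I => (e + (0 : ℝ) • a) I x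
  have : (e + (0 : ℝ) • a) = e := by
    funext I
    show e I + (0 : ℝ) • a I = e I
    rw [zero_smul, add_zero]
  rw [this]
  exact he x

/-- The variation of the connection is the derivative of `connOf`. -/
theorem hasDerivAt_connOf {e : Tetrad 4 M} {w : Conn 4 M} {δ : Tetrad 4 M × Conn 4 M}
    {B B' : Fin 4 → DForm 4 2 M} (he : Nondegenerate e) (hw : Antisymm w) (hδ : Antisymm δ.2)
    (hB : epsWedge e w = B) (hB' : epsWedge δ.1 w + epsWedge e δ.2 = B') (K L : Fin 4) (x : M)
    (u : Fin 1 → Model 4) : HasDerivAt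
      (fun t : ℝ => connOf (e + t • δ.1) (B + t • B') K L x u) (δ.2 K L x u) 0 := by
  obtain ⟨δe, δw⟩ := δ
  have hg : ContinuousAt (fun t : ℝ => connOf (e + t • δe) (epsWedge δe δw) K L x u) 0 := by
    refine continuousAt_connOf_apply (fun I u => ?_) ?_ _ K L u
    · show Continuous fun t : ℝ => e I x u + t * δe I x u
      fun_prop
    · have : (e + (0 : ℝ) • δe) = e := by
        funext I
        show e I + (0 : ℝ) • δe I = e I
        rw [zero_smul, add_zero]
      rwa [this]
  refine hasDerivAt_of_eventually_eq_quadratic (a := w K L x u) hg ?_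
  filter_upwards [eventually_linearIndependent (x := x) (a := δe) he] with t ht
  -- The candidate `w + t δw` gives the required `B + t B'` up to the error `t² ε δe ∧ δw`.
  -- Subtracting `t² G` removes it, so by uniqueness the connection at `t` is exactly `w + t δw - t²
  -- G`, and the rational formula need not be differentiated.
  set G := connOf (e + t • δe) (epsWedge δe δw) with hG
  obtain ⟨hGa, hGe⟩ := (connOf_iff_at ht G (epsWedge δe δw)).2 fun _ _ => rfl
  have hlin : epsWedge (e + t • δe) (w + t • δw + (-t ^ 2) • G) =
      epsWedge e w + t • (epsWedge δe w + epsWedge e δw) + t ^ 2 • epsWedge δe δw +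
        (-t ^ 2) • epsWedge (e + t • δe) G := by
    rw [epsWedge_add_right, epsWedge_add_right, epsWedge_smul_right, epsWedge_smul_right,
      epsWedge_add_left e _ w, epsWedge_add_left e _ δw, epsWedge_smul_left, epsWedge_smul_left]
    module
  have hkey := (connOf_iff_at ht (w + t • δw + (-t ^ 2) • G) (B + t • B')).1
    ⟨fun K L => ?_, fun I => ?_⟩ K L
  · rw [← hkey]
    show w K L x u + t * δw K L x u + -t ^ 2 * G K L x u = _
    ring
  · show w K L x + t • δw K L x + (-t ^ 2) • G K L x =
      -(w L K x + t • δw L K x + (-t ^ 2) • G L K x)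
    have h1 : w K L x = -w L K x := congrFun (hw K L) x
    have h2 : δw K L x = -δw L K x := congrFun (hδ K L) x
    rw [h1, h2, hGa]
    module
  · rw [hlin, hB, hB']
    show B I x + t • B' I x + t ^ 2 • epsWedge δe δw I x +
      (-t ^ 2) • epsWedge (e + t • δe) G I x = B I x + t • B' I x
    rw [hGe]
    module

end Derivative

/-! ### The symplectic integrand and its exact part. -/

section Integrand

variable {M : Type*} {e : Tetrad 4 M} {w : Conn 4 M}

theorem sum_wedge_epsWedge_comm (a b : Tetrad 4 M) (w : Conn 4 M) :
    ∑ I, wedge (a I) (epsWedge b w I) = ∑ I, wedge (b I) (epsWedge a w I) := by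
  have h : ∀ a b : Tetrad 4 M, ∑ I, wedge (a I) (epsWedge b w I) =
      ∑ I, ∑ J, ∑ K, ∑ L, eps I J K L • wedge (a I) (wedge (b J) (w K L)) := fun a b => by
    simp only [epsWedge, wedge_sum_right, wedge_smul_right]
  rw [h, h, Finset.sum_comm]
  refine Finset.sum_congr rfl fun I _ => Finset.sum_congr rfl fun J _ =>
    Finset.sum_congr rfl fun K _ => Finset.sum_congr rfl fun L _ => ?_
  rw [eps_swap_first, wedge_anticomm, neg_smul, smul_neg, neg_neg]

variable [TopologicalSpace M] [ChartedSpace (Model 4) M]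

/-- Replacing `e ∧ δω` by `δB` adds `ε δ₁e ∧ δ₂e ∧ ω`, which is symmetric in the two variations and
drops out of the difference. -/
theorem sum_wedge_varB (δ₁ δ₂ : Tetrad 4 M × Conn 4 M) :
    ∑ I, ∑ J, ∑ K, ∑ L, eps I J K L •
      (wedge (δ₁.1 I) (wedge (e J) (δ₂.2 K L)) - wedge (δ₂.1 I) (wedge (e J) (δ₁.2 K L))) =
    ∑ I, wedge (δ₁.1 I) (varB e w δ₂ I) - ∑ I, wedge (δ₂.1 I) (varB e w δ₁ I) := by
  have h : ∀ δ δ' : Tetrad 4 M × Conn 4 M, ∑ I, wedge (δ.1 I) (varB e w δ' I) =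
      ∑ I, wedge (δ.1 I) (epsWedge δ'.1 w I) +
        ∑ I, ∑ J, ∑ K, ∑ L, eps I J K L • wedge (δ.1 I) (wedge (e J) (δ'.2 K L)) := fun δ δ' => by
    have h1 : ∀ I, varB e w δ' I = epsWedge δ'.1 w I + epsWedge e δ'.2 I := fun _ => rfl
    rw [← Finset.sum_add_distrib]
    refine Finset.sum_congr rfl fun I _ => ?_
    have h2 : epsWedge e δ'.2 I = ∑ J, ∑ K, ∑ L, eps I J K L • wedge (e J) (δ'.2 K L) := rfl
    rw [h1, wedge_add_right, h2]
    simp only [wedge_sum_right, wedge_smul_right]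
  rw [h, h, sum_wedge_epsWedge_comm δ₂.1, add_sub_add_left_eq_sub]
  simp only [smul_sub, Finset.sum_sub_distrib]

variable [IsManifold (𝓡 4) ∞ M] {n₁ n₂ : ℕ}

/-- The product of closed forms, up to exact forms. -/
theorem exists_wedge_eq_exact_add_sum {φ₁ : Fin n₁ → closedForms 4 1 M}
    {φ₂ : Fin n₂ → closedForms 4 2 M} {h : DForm 4 0 M} {g : DForm 4 1 M} (hh : IsSmooth h)
    (hg : IsSmooth g) (η : Fin n₁ → ℝ) (γ : Fin n₂ → ℝ) : ∃ ψ : DForm 4 2 M, IsSmooth ψ ∧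
      wedge (d h + ∑ i, η i • (φ₁ i : DForm 4 1 M)) (d g + ∑ j, γ j • (φ₂ j : DForm 4 2 M)) =
        d ψ + ∑ i, ∑ j, (η i * γ j) • wedge (φ₁ i : DForm 4 1 M) (φ₂ j : DForm 4 2 M) := by
  have hB := isSmooth_exact_add_sum (φ := φ₂) hg γ
  have hdB := d_exact_add_sum (φ := φ₂) hg γ
  have hφ : IsSmooth (∑ i, η i • (φ₁ i : DForm 4 1 M)) :=
    IsSmooth.sum fun i _ => (φ₁ i).2.1.smul _
  have hdφ : d (∑ i, η i • (φ₁ i : DForm 4 1 M)) = 0 := by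
    rw [d_sum fun i _ => (φ₁ i).2.1.smul _]
    refine Finset.sum_eq_zero fun i _ => ?_
    rw [d_smul, (φ₁ i).2.2, smul_zero]
  -- With `B = dg + ∑ γ_j φ_j` and `φ = ∑ η_i φ_i` closed, `d(hB) = dh ∧ B` and `d(φ ∧ g) = -φ ∧
  -- dg`; hence the primitive `hB - φ ∧ g`.
  refine ⟨fmul (toFun h) (d g + ∑ j, γ j • (φ₂ j : DForm 4 2 M)) -
    wedge (∑ i, η i • (φ₁ i : DForm 4 1 M)) g, (hB.fmul hh.toFun).sub (hφ.wedge hg), ?_⟩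
  have hz : fmul (toFun h) (0 : DForm 4 3 M) = 0 := by
    funext x
    simp [fmul]
  rw [d_sub (hB.fmul hh.toFun) (hφ.wedge hg), d_fmul hh hB, hdB, hz, add_zero, d_wedge_one hφ hg,
    hdφ, wedge_zero_right, zero_sub, sub_neg_eq_add, wedge_add_left]
  refine Eq.trans ?_ (add_assoc _ _ _).symm
  congr 1
  rw [wedge_add_right]
  congr 1
  simp only [wedge_sum_left, wedge_smul_left, wedge_sum_right, wedge_smul_right, smul_smul,
    Finset.smul_sum]
  rw [Finset.sum_comm]
  refine Finset.sum_congr rfl fun i _ => Finset.sum_congr rfl fun j _ => ?_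
  rw [mul_comm]

end Integrand

/-! ### Evaluation of the symplectic form. -/

section Symplectic

variable {M : Type*} [TopologicalSpace M] [ChartedSpace (Model 4) M] [IsManifold (𝓡 4) ∞ M]
  {S : Type*} [TopologicalSpace S] [ChartedSpace (Model 3) S]

theorem pullback_add {n m k : ℕ} {M N : Type*} [TopologicalSpace M] [ChartedSpace (Model n) M]
    [TopologicalSpace N] [ChartedSpace (Model m) N] (f : N → M) (θ θ' : DForm n k M) :
    pullback (m := m) f (θ + θ') = pullback f θ + pullback f θ' := rfl

theorem pullback_sub {n m k : ℕ} {M N : Type*} [TopologicalSpace M] [ChartedSpace (Model n) M]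
    [TopologicalSpace N] [ChartedSpace (Model m) N] (f : N → M) (θ θ' : DForm n k M) :
    pullback (m := m) f (θ - θ') = pullback f θ - pullback f θ' := rfl

theorem pullback_smul {n m k : ℕ} {M N : Type*} [TopologicalSpace M] [ChartedSpace (Model n) M]
    [TopologicalSpace N] [ChartedSpace (Model m) N] (f : N → M) (c : ℝ) (θ : DForm n k M) :
    pullback (m := m) f (c • θ) = c • pullback f θ := rfl

theorem pullback_sum {n m k : ℕ} {M N : Type*} [TopologicalSpace M] [ChartedSpace (Model n) M]
    [TopologicalSpace N] [ChartedSpace (Model m) N] {A : Type*} (s : Finset A) (f : N → M)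
    (θ : A → DForm n k M) :
    pullback (m := m) f (∑ a ∈ s, θ a) = ∑ a ∈ s, pullback f (θ a) :=
  map_sum (AddMonoidHom.mk' (pullback (m := m) f) (pullback_add f)) θ s

variable [IsManifold (𝓡 3) ∞ S] [T2Space S] [CompactSpace S] {ι : S → M} {o : DForm 3 3 S}
  {n₁ n₂ : ℕ} {φ₁ : Fin n₁ → closedForms 4 1 M} {φ₂ : Fin n₂ → closedForms 4 2 M}

theorem hasCompactSupp_of_compactSpace {k : ℕ} (θ : DForm 3 k S) : HasCompactSupp θ :=
  ⟨Set.univ, isCompact_univ, fun x hx => absurd (Set.mem_univ x) hx⟩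

variable (ι o φ₁ φ₂) in
/-- The integrals `∫_S ι^*φ_i^{(1)} ∧ ι^*φ_j^{(2)}`. -/
def intersection (i : Fin n₁) (j : Fin n₂) : ℝ :=
  intForm o (wedge (pullback ι (φ₁ i : DForm 4 1 M)) (pullback ι (φ₂ j : DForm 4 2 M)))

/-- The exact part stays exact after pullback and integrates to zero on the compact manifold `S`, so
only the cohomology coefficients survive. -/
theorem intForm_pullback_wedge (ho : IsVolumeForm o) (hι : ContMDiff (𝓡 3) (𝓡 4) ∞ ι)
    {h : DForm 4 0 M} {g : DForm 4 1 M} (hh : IsSmooth h) (hg : IsSmooth g) (η : Fin n₁ → ℝ)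
    (γ : Fin n₂ → ℝ) :
    intForm o (pullback ι (wedge (d h + ∑ i, η i • (φ₁ i : DForm 4 1 M))
      (d g + ∑ j, γ j • (φ₂ j : DForm 4 2 M)))) =
      ∑ i, ∑ j, intersection ι o φ₁ φ₂ i j * (η i * γ j) := by
  obtain ⟨ψ, hψ, h1⟩ := exists_wedge_eq_exact_add_sum (φ₁ := φ₁) (φ₂ := φ₂) hh hg η γ
  have hs : ∀ i j, IsSmooth (pullback (m := 3) ι
      ((η i * γ j) • wedge (φ₁ i : DForm 4 1 M) (φ₂ j : DForm 4 2 M))) := fun i j =>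
    IsSmooth.pullback hι (((φ₁ i).2.1.wedge (φ₂ j).2.1).smul _)
  have hψs := IsSmooth.pullback (m := 3) hι hψ
  rw [h1, pullback_add, ← d_pullback hι hψ, pullback_sum]
  simp only [pullback_sum]
  rw [intForm_add ho hψs.d (IsSmooth.sum fun i _ => IsSmooth.sum fun j _ => hs i j)
      (hasCompactSupp_of_compactSpace _) (hasCompactSupp_of_compactSpace _),
    intForm_d (m := 2) ho hψs (hasCompactSupp_of_compactSpace _), zero_add,
    intForm_sum ho (fun i _ => IsSmooth.sum fun j _ => hs i j)
      fun i _ => hasCompactSupp_of_compactSpace _]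
  refine Finset.sum_congr rfl fun i _ => ?_
  rw [intForm_sum ho (fun j _ => hs i j) fun i _ => hasCompactSupp_of_compactSpace _]
  refine Finset.sum_congr rfl fun j _ => ?_
  rw [pullback_smul, intForm_smul, pullback_wedge, mul_comm]
  rfl

/-- The symplectic form in terms of the data `(δη, δγ)`. -/
theorem symplecticForm_eq (ho : IsVolumeForm o) (hι : ContMDiff (𝓡 3) (𝓡 4) ∞ ι)
    {e : Tetrad 4 M} {w : Conn 4 M} {p₁ p₂ : Params M n₁ n₂} (hp₁ : p₁.Smooth) (hp₂ : p₂.Smooth)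
    {δ₁ δ₂ : Tetrad 4 M × Conn 4 M} (h₁ : δ₁.1 = p₁.tetrad φ₁) (h₁' : varB e w δ₁ = p₁.B φ₂)
    (h₂ : δ₂.1 = p₂.tetrad φ₁) (h₂' : varB e w δ₂ = p₂.B φ₂) :
    symplecticForm o ι e δ₁ δ₂ = ∑ i, ∑ j, intersection ι o φ₁ φ₂ i j *
      ∑ I, (p₁.η I i * p₂.γ I j - p₂.η I i * p₁.γ I j) := by
  have hs : ∀ p q : Params M n₁ n₂, p.Smooth → q.Smooth → ∀ I,
      IsSmooth (pullback (m := 3) ι (wedge (p.tetrad φ₁ I) (q.B φ₂ I))) := fun p q hp hq I =>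
    IsSmooth.pullback hι ((Params.isSmooth_tetrad hp I).wedge (Params.isSmooth_B hq I))
  have hint : ∀ p q : Params M n₁ n₂, p.Smooth → q.Smooth →
      intForm o (∑ I, pullback ι (wedge (p.tetrad φ₁ I) (q.B φ₂ I))) =
        ∑ I, ∑ i, ∑ j, intersection ι o φ₁ φ₂ i j * (p.η I i * q.γ I j) := fun p q hp hq => by
    rw [intForm_sum ho (fun I _ => hs p q hp hq I) fun I _ => hasCompactSupp_of_compactSpace _]
    exact Finset.sum_congr rfl fun I _ =>
      intForm_pullback_wedge ho hι (hp.1 I) (hq.2 I) (p.η I) (q.γ I)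
  have h : (∑ I, ∑ J, ∑ K, ∑ L, eps I J K L •
      (wedge (pullTetrad ι δ₁.1 I) (wedge (pullTetrad ι e J) (pullConn ι δ₂.2 K L))
        - wedge (pullTetrad ι δ₂.1 I) (wedge (pullTetrad ι e J) (pullConn ι δ₁.2 K L))) :
          DForm 3 3 S) =
      ∑ I, pullback ι (wedge (p₁.tetrad φ₁ I) (p₂.B φ₂ I)) +
        (-1 : ℝ) • ∑ I, pullback ι (wedge (p₂.tetrad φ₁ I) (p₁.B φ₂ I)) := by
    rw [← h₁, ← h₂, ← h₁', ← h₂', neg_one_smul, ← sub_eq_add_neg, ← pullback_sum, ← pullback_sum,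
      ← pullback_sub, ← sum_wedge_varB]
    simp only [pullback_sum, pullback_smul, pullback_sub, pullback_wedge]
    rfl
  rw [symplecticForm, h, intForm_add ho (IsSmooth.sum fun I _ => hs p₁ p₂ hp₁ hp₂ I)
    ((IsSmooth.sum fun I _ => hs p₂ p₁ hp₂ hp₁ I).smul _) (hasCompactSupp_of_compactSpace _)
    (hasCompactSupp_of_compactSpace _), intForm_smul, hint p₁ p₂ hp₁ hp₂, hint p₂ p₁ hp₂ hp₁,
    neg_one_mul, ← sub_eq_add_neg]
  simp only [← Finset.sum_sub_distrib, ← mul_sub, Finset.mul_sum]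
  rw [Finset.sum_comm]
  exact Finset.sum_congr rfl fun i _ => Finset.sum_comm

end Symplectic

/-! ### Finite rank of the symplectic form. -/

section Rank

variable {M : Type*} [TopologicalSpace M] [ChartedSpace (Model 4) M] [IsManifold (𝓡 4) ∞ M]
  {n₁ n₂ : ℕ}

/-- The coefficients of the class of a closed form in a basis of the cohomology. -/
def coeffs {n k r : ℕ} {M : Type*} [TopologicalSpace M] [ChartedSpace (Model n) M]
    {φ : Fin r → closedForms n (k + 1) M} (hφ : RepresentsBasis φ) :
    closedForms n (k + 1) M →ₗ[ℝ] Fin r → ℝ :=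
  (Module.Basis.mk hφ.1 hφ.2.ge).equivFun.toLinearMap ∘ₗ Submodule.mkQ _

theorem coeffs_exact_add_sum {n k r : ℕ} {M : Type*} [TopologicalSpace M] [ChartedSpace (Model n) M]
    {φ : Fin r → closedForms n (k + 1) M} (hφ : RepresentsBasis φ) {θ : closedForms n (k + 1) M}
    {β : DForm n k M} (hβ : IsSmooth β) {c : Fin r → ℝ}
    (h : (θ : DForm n (k + 1) M) = d β + ∑ i, c i • (φ i : DForm n (k + 1) M)) :
    coeffs hφ θ = c := by
  have h1 : deRhamClass θ = ∑ i, c i • deRhamClass (φ i) := by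
    have h2 : ∑ i, c i • deRhamClass (φ i) = deRhamClass (∑ i, c i • φ i) :=
      (map_sum (Submodule.mkQ _) (fun i => c i • φ i) Finset.univ).symm
    rw [h2]
    refine (Submodule.Quotient.eq _).2 ⟨β, hβ, ?_⟩
    have h3 : d β = (θ : DForm n (k + 1) M) - ∑ i, c i • (φ i : DForm n (k + 1) M) := by
      rw [h, add_sub_cancel_right]
    rw [h3]
    simp
  have h4 : coeffs hφ θ = (Module.Basis.mk hφ.1 hφ.2.ge).equivFun (deRhamClass θ) := rfl
  rw [h4, ← LinearEquiv.eq_symm_apply, Module.Basis.equivFun_symm_apply, h1]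
  exact Finset.sum_congr rfl fun i _ => by rw [Module.Basis.mk_apply]

/-- The linear map `δ ↦ δB` on tangent vectors, with values in closed forms. -/
def varBClosed {e : Tetrad 4 M} {w : Conn 4 M} (hf : IsField e w) (hde : ∀ I, d (e I) = 0)
    (I : Fin 4) : tangentSpace e w →ₗ[ℝ] closedForms 4 2 M where
  toFun δ := ⟨varB e w δ.1 I, isSmooth_varB hf δ.2.1 δ.2.2.1 I, by
    rw [d_varB hf hde δ.2.1 δ.2.2.1 δ.2.2.2.2.1, δ.2.2.2.2.2, neg_zero]⟩
  map_add' δ δ' := Subtype.ext <| by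
    show (epsWedge (δ.1.1 + δ'.1.1) w + epsWedge e (δ.1.2 + δ'.1.2)) I =
      (epsWedge δ.1.1 w + epsWedge e δ.1.2) I + (epsWedge δ'.1.1 w + epsWedge e δ'.1.2) I
    rw [epsWedge_add_left, epsWedge_add_right]
    exact congrFun (add_add_add_comm _ _ _ _) I
  map_smul' c δ := Subtype.ext <| by
    show (epsWedge (c • δ.1.1) w + epsWedge e (c • δ.1.2)) I =
      c • (epsWedge δ.1.1 w + epsWedge e δ.1.2) I
    rw [epsWedge_smul_left, epsWedge_smul_right]
    exact congrFun (smul_add c (epsWedge δ.1.1 w) (epsWedge e δ.1.2)).symm I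

/-- The linear map `δ ↦ δe` on tangent vectors, with values in closed forms. -/
def tetradClosed (e : Tetrad 4 M) (w : Conn 4 M) (I : Fin 4) :
    tangentSpace e w →ₗ[ℝ] closedForms 4 1 M where
  toFun δ := ⟨δ.1.1 I, δ.2.1 I, δ.2.2.2.2.1 I⟩
  map_add' _ _ := rfl
  map_smul' _ _ := rfl

variable {φ₁ : Fin n₁ → closedForms 4 1 M} {φ₂ : Fin n₂ → closedForms 4 2 M}

/-- The coefficients `(δη, δγ)` of a tangent vector. -/
def tangentCoeffs (hφ₁ : RepresentsBasis (k := 0) φ₁) (hφ₂ : RepresentsBasis (k := 1) φ₂)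
    {e : Tetrad 4 M} {w : Conn 4 M} (hf : IsField e w) (hde : ∀ I, d (e I) = 0) :
    tangentSpace e w →ₗ[ℝ] (Fin 4 → Fin n₁ → ℝ) × (Fin 4 → Fin n₂ → ℝ) :=
  (LinearMap.pi fun I => coeffs hφ₁ ∘ₗ tetradClosed e w I).prod
    (LinearMap.pi fun I => coeffs hφ₂ ∘ₗ varBClosed hf hde I)

/-- The bilinear form `∑ c_{ij} dη^I_i ∧ dγ_{Ij}`. -/
def coeffForm (c : Fin n₁ → Fin n₂ → ℝ) :
    (Fin 4 → Fin n₁ → ℝ) × (Fin 4 → Fin n₂ → ℝ) →ₗ[ℝ]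
      (Fin 4 → Fin n₁ → ℝ) × (Fin 4 → Fin n₂ → ℝ) →ₗ[ℝ] ℝ :=
  LinearMap.mk₂ ℝ (fun u v => ∑ i, ∑ j, c i j * ∑ I, (u.1 I i * v.2 I j - v.1 I i * u.2 I j))
    (fun u u' v => by
      simp only [← Finset.sum_add_distrib, ← mul_add]
      refine Finset.sum_congr rfl fun i _ => Finset.sum_congr rfl fun j _ =>
        congrArg _ (Finset.sum_congr rfl fun I _ => ?_)
      simp only [Prod.fst_add, Prod.snd_add, Pi.add_apply]
      ring)
    (fun a u v => by
      simp only [smul_eq_mul, Finset.mul_sum]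
      refine Finset.sum_congr rfl fun i _ => Finset.sum_congr rfl fun j _ =>
        Finset.sum_congr rfl fun I _ => ?_
      simp only [Prod.smul_fst, Prod.smul_snd, Pi.smul_apply, smul_eq_mul]
      ring)
    (fun u v v' => by
      simp only [← Finset.sum_add_distrib, ← mul_add]
      refine Finset.sum_congr rfl fun i _ => Finset.sum_congr rfl fun j _ =>
        congrArg _ (Finset.sum_congr rfl fun I _ => ?_)
      simp only [Prod.fst_add, Prod.snd_add, Pi.add_apply]
      ring)
    (fun a u v => by
      simp only [smul_eq_mul, Finset.mul_sum]
      refine Finset.sum_congr rfl fun i _ => Finset.sum_congr rfl fun j _ =>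
        Finset.sum_congr rfl fun I _ => ?_
      simp only [Prod.smul_fst, Prod.smul_snd, Pi.smul_apply, smul_eq_mul]
      ring)

variable {S : Type*} [TopologicalSpace S] [ChartedSpace (Model 3) S]
  [IsManifold (𝓡 3) ∞ S] [T2Space S] [CompactSpace S] {ι : S → M} {o : DForm 3 3 S}

/-- The form factors through a linear map to a finite-dimensional space; this is the absence of
local degrees of freedom. -/
theorem symplecticForm_eq_coeffForm (ho : IsVolumeForm o) (hι : ContMDiff (𝓡 3) (𝓡 4) ∞ ι)
    (hφ₁ : RepresentsBasis (k := 0) φ₁) (hφ₂ : RepresentsBasis (k := 1) φ₂)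
    {e : Tetrad 4 M} {w : Conn 4 M} (hf : IsField e w) (hde : ∀ I, d (e I) = 0)
    (δ δ' : tangentSpace e w) : symplecticForm o ι e δ δ' =
      coeffForm (intersection ι o φ₁ φ₂) (tangentCoeffs hφ₁ hφ₂ hf hde δ)
        (tangentCoeffs hφ₁ hφ₂ hf hde δ') := by
  obtain ⟨p, hp, h1, h2⟩ := exists_params_of_mem_tangentSpace hφ₁ hφ₂ hf hde δ.2
  obtain ⟨q, hq, h3, h4⟩ := exists_params_of_mem_tangentSpace hφ₁ hφ₂ hf hde δ'.2
  have hc : ∀ (δ : tangentSpace e w) (p : Params M n₁ n₂), p.Smooth → δ.1.1 = p.tetrad φ₁ →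
      varB e w δ = p.B φ₂ → tangentCoeffs hφ₁ hφ₂ hf hde δ = (p.η, p.γ) := fun δ p hp h h' =>
    Prod.ext (funext fun I => coeffs_exact_add_sum hφ₁ (θ := tetradClosed e w I δ) (hp.1 I)
        (congrFun h I))
      (funext fun I => coeffs_exact_add_sum hφ₂ (θ := varBClosed hf hde I δ) (hp.2 I)
        (congrFun h' I))
  rw [hc δ p hp h1 h2, hc δ' q hq h3 h4, symplecticForm_eq ho hι hp hq h1 h2 h3 h4]
  rfl

/-- The quotient is isomorphic to the range of the composite, which lies in the range of `f`.
Neither `T` nor `W` has to be finite-dimensional. -/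
theorem finite_quotient_ker_comp {T V W : Type*} [AddCommGroup T] [Module ℝ T] [AddCommGroup V]
    [Module ℝ V] [AddCommGroup W] [Module ℝ W] [FiniteDimensional ℝ V] (D : T →ₗ[ℝ] V)
    (f : V →ₗ[ℝ] W) : Module.Finite ℝ (T ⧸ LinearMap.ker (f ∘ₗ D)) ∧
      Module.finrank ℝ (T ⧸ LinearMap.ker (f ∘ₗ D)) ≤ Module.finrank ℝ V := by
  have hle : LinearMap.range (f ∘ₗ D) ≤ LinearMap.range f := LinearMap.range_comp_le_range D f
  have hfin : FiniteDimensional ℝ (LinearMap.range (f ∘ₗ D)) :=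
    Submodule.finiteDimensional_of_le hle
  refine ⟨Module.Finite.equiv (f ∘ₗ D).quotKerEquivRange.symm, ?_⟩
  rw [(f ∘ₗ D).quotKerEquivRange.finrank_eq]
  exact (Submodule.finrank_mono hle).trans (LinearMap.finrank_range_le f)

/-- The symplectic form has finite rank. -/
theorem exists_ker_symplecticForm (ho : IsVolumeForm o) (hι : ContMDiff (𝓡 3) (𝓡 4) ∞ ι)
    (hφ₁ : RepresentsBasis (k := 0) φ₁) (hφ₂ : RepresentsBasis (k := 1) φ₂)
    {e : Tetrad 4 M} {w : Conn 4 M} (hf : IsField e w) (hde : ∀ I, d (e I) = 0) :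
    ∃ K : Submodule ℝ (tangentSpace e w),
      (∀ δ, δ ∈ K ↔ ∀ δ' : tangentSpace e w, symplecticForm o ι e δ δ' = 0) ∧
      Module.Finite ℝ (tangentSpace e w ⧸ K) ∧
      Module.finrank ℝ (tangentSpace e w ⧸ K) ≤ 4 * (n₁ + n₂) := by
  let D := tangentCoeffs hφ₁ hφ₂ hf hde
  -- Both arguments pass through `D`, so `f ∘ D` sends `δ` to the functional `Ω(δ, ·)` on the
  -- tangent space, and its kernel is that of `Ω`.
  let f := (LinearMap.lcomp ℝ ℝ D) ∘ₗ coeffForm (intersection ι o φ₁ φ₂)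
  obtain ⟨h1, h2⟩ := finite_quotient_ker_comp D f
  refine ⟨LinearMap.ker (f ∘ₗ D), fun δ => ?_, h1, h2.trans ?_⟩
  · rw [LinearMap.mem_ker, LinearMap.ext_iff]
    refine forall_congr' fun δ' => ?_
    rw [symplecticForm_eq_coeffForm ho hι hφ₁ hφ₂ hf hde]
    rfl
  · simp [Module.finrank_pi_fintype, mul_add]

end Rank

end AbelianCP

end

/-! ### The full statement. -/

open scoped Manifold ContDiff in
open AbelianCP in
theorem mainTheorem6
    {M : Type*} [TopologicalSpace M] [ChartedSpace (Model 4) M] [IsManifold (𝓡 4) ∞ M]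
    [T2Space M] [SigmaCompactSpace M]
    {S : Type*} [TopologicalSpace S] [ChartedSpace (Model 3) S] [IsManifold (𝓡 3) ∞ S]
    [T2Space S] [CompactSpace S]
    (oM : DForm 4 4 M) (hoM : IsVolumeForm oM)
    (oS : DForm 3 3 S) (hoS : IsVolumeForm oS)
    (ι : S → M) (hι : ContMDiff (𝓡 3) (𝓡 4) ∞ ι)
    {n₁ n₂ : ℕ}
    (φ₁ : Fin n₁ → closedForms 4 1 M) (hφ₁ : RepresentsBasis (k := 0) φ₁)
    (φ₂ : Fin n₂ → closedForms 4 2 M) (hφ₂ : RepresentsBasis (k := 1) φ₂) :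
    -- first variation of the action, and equivalent forms of the field equations
    (∀ e w, IsField e w →
      (∀ δe δw, IsVariation δe δw →
        HasDerivAt (fun t : ℝ => actionChange oM e w (t • δe) (t • δw))
          (intForm oM (-(∑ I, wedge (δe I) (eulerTetrad e w I))
            - ∑ I, ∑ J, wedge (δw I J) (eulerConn e I J))) 0) ∧
      (IsStationary oM e w ↔ eulerTetrad e w = 0 ∧ eulerConn e = 0) ∧
      (IsStationary oM e w ↔ ReducedEqs e w)) ∧
    -- algebraic determination of the connection
    (∀ (e : Tetrad 4 M) (w : Conn 4 M) (B : Fin 4 → DForm 4 2 M), Nondegenerate e →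
      ((Antisymm w ∧ epsWedge e w = B) ↔ w = connOf e B)) ∧
    -- explicit form of all the solutions
    (∀ e w, IsSolution oM e w ↔
      ∃ p : Params M n₁ n₂, p.Smooth ∧ e = p.tetrad φ₁ ∧ Nondegenerate e ∧
        w = connOf e (p.B φ₂)) ∧
    -- uniqueness of the coefficients and of the exact parts
    (∀ p q : Params M n₁ n₂, p.Smooth → q.Smooth →
      (p.tetrad φ₁ = q.tetrad φ₁ → p.η = q.η ∧ ∀ I, d (p.h I) = d (q.h I)) ∧
      (p.B φ₂ = q.B φ₂ → p.γ = q.γ ∧ ∀ I, d (p.g I) = d (q.g I))) ∧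
    -- tangent vectors and symplectic form at a solution
    (∀ e w, IsSolution oM e w →
      (∀ δ ∈ tangentSpace e w, ∃ p : Params M n₁ n₂, p.Smooth ∧
        δ.1 = p.tetrad φ₁ ∧ varB e w δ = p.B φ₂) ∧
      (∀ p : Params M n₁ n₂, p.Smooth → ∃! δ, δ ∈ tangentSpace e w ∧
        δ.1 = p.tetrad φ₁ ∧ varB e w δ = p.B φ₂) ∧
      (∀ p₀ : Params M n₁ n₂, p₀.Smooth → e = p₀.tetrad φ₁ → w = connOf e (p₀.B φ₂) →
        ∀ p : Params M n₁ n₂, p.Smooth → ∀ δ ∈ tangentSpace e w,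
        δ.1 = p.tetrad φ₁ → varB e w δ = p.B φ₂ →
        ∀ K L x v, HasDerivAt (fun t : ℝ =>
          connOf (p₀.tetrad φ₁ + t • p.tetrad φ₁) (p₀.B φ₂ + t • p.B φ₂) K L x v)
          (δ.2 K L x v) 0) ∧
      (∀ (p₁ p₂ : Params M n₁ n₂), p₁.Smooth → p₂.Smooth →
        ∀ δ₁ ∈ tangentSpace e w, ∀ δ₂ ∈ tangentSpace e w,
        δ₁.1 = p₁.tetrad φ₁ → varB e w δ₁ = p₁.B φ₂ →
        δ₂.1 = p₂.tetrad φ₁ → varB e w δ₂ = p₂.B φ₂ →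
        symplecticForm oS ι e δ₁ δ₂ = ∑ i, ∑ j,
          intForm oS (wedge (pullback ι (φ₁ i : DForm 4 1 M)) (pullback ι (φ₂ j : DForm 4 2 M))) *
            ∑ I, (p₁.η I i * p₂.γ I j - p₂.η I i * p₁.γ I j)) ∧
      -- no local degrees of freedom: the form has finite rank
      (∃ K : Submodule ℝ (tangentSpace e w),
        (∀ δ, δ ∈ K ↔ ∀ δ' : tangentSpace e w, symplecticForm oS ι e δ δ' = 0) ∧
        Module.Finite ℝ (tangentSpace e w ⧸ K) ∧
        Module.finrank ℝ (tangentSpace e w ⧸ K) ≤ 4 * (n₁ + n₂))) := by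
  have hred : ∀ {e w}, IsSolution oM e w → IsField e w ∧ ∀ I, d (e I) = 0 := fun h =>
    ⟨h.1, ((isStationary_iff_reducedEqs hoM h.1).1 h.2).1⟩
  refine ⟨fun e w hf => ⟨fun δe δw hv => hasDerivAt_actionChange hoM hf hv,
      isStationary_iff hoM hf, isStationary_iff_reducedEqs hoM hf⟩,
    fun e w B he => connOf_iff he w B, fun e w => isSolution_iff hoM hφ₁ hφ₂,
    fun p q hp hq => ⟨fun h => ?_, fun h => ?_⟩, fun e w hsol => ?_⟩
  · have hu := fun I => exact_add_sum_unique hφ₁ (hp.1 I) (hq.1 I) (congrFun h I)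
    exact ⟨funext fun I => (hu I).1, fun I => (hu I).2⟩
  · have hu := fun I => exact_add_sum_unique hφ₂ (hp.2 I) (hq.2 I) (congrFun h I)
    exact ⟨funext fun I => (hu I).1, fun I => (hu I).2⟩
  · obtain ⟨hf, hde⟩ := hred hsol
    refine ⟨fun δ hδ => exists_params_of_mem_tangentSpace hφ₁ hφ₂ hf hde hδ,
      fun p hp => existsUnique_tangent hf hde hp, ?_,
      fun p₁ p₂ hp₁ hp₂ δ₁ _ δ₂ _ h₁ h₁' h₂ h₂' => symplecticForm_eq hoS hι hp₁ hp₂ h₁ h₁' h₂ h₂',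
      exists_ker_symplecticForm hoS hι hφ₁ hφ₂ hf hde⟩
    intro p₀ _ he hw p _ δ hδ h₁ h₂ K L x v
    rw [← he, ← h₁]
    exact hasDerivAt_connOf hf.nondegenerate hf.antisymm hδ.2.2.1
      ((connOf_iff hf.nondegenerate _ _).2 hw).2 h₂ K L x v
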